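/- Let $A$ be a finite alphabet and let $\sigma$ be a substitution over $A$, i.e. a non-erasing morphism of the free monoid $A^*$; it acts on bi-infinite words by $\sigma(w)=\cdots\sigma(w_{-1})\cdot\sigma(w_0)\sigma(w_1)\cdots$. Its incidence matrix is $M=(|\sigma(a)|_b)_{(b,a)\in A^2}$, where $|\sigma(a)|_b$ is the number of occurrences of the letter $b$ in $\sigma(a)$. Let $S$ be the shift $(w_i)_i\mapsto(w_{i+1})_i$ on $A^{\mathbb Z}$, and let $\Omega_\sigma\subseteq A^{\mathbb Z}$ be the smallest non-empty compact set invariant under $\sigma$ and $S$. For $w\in A^{\mathbb Z}$ and $n\ge 0$ put $\mathrm{ab}(w_{[0,n)})=\sum_{0\le i<n}e_{w_i}$, and for $n<0$ put $\mathrm{ab}(w_{[0,n)})=-\sum_{n\le i<0}e_{w_i}$, where $(e_a)_{a\in A}$ is the canonical basis of $\mathbb R^A$. Assume: * $M$ is primitive (some power $M^n$, $n\ge1$, has only positive entries), and its Perron eigenvalue $\beta$ (the real eigenvalue equal to the spectral radius) is a unit Pisot number of degree $d+1$, with minimal polynomial $\pi_\beta$. Here a Pisot number is an algebraic integer $\beta>1$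 all of whose other conjugates have modulus $<1$, and it is a unit if $\pi_\beta(0)=\pm1$; * $u\in\Omega_\sigma$ satisfies $\sigma(u)=u$; * the characteristic polynomial of $M$ is $\pi_\beta P$ with $P\in\mathbb Z[X]$, and $V:\mathbb R^A\to\mathbb R^d$ is a surjective linear map with kernel $\ker((M-\beta I)P(M))$; * $\sigma$ is proper: all the words $\sigma(a)$, $a\in A$, start with the same letter, and all of them end with the same letter. Then the map $S^nu\mapsto V\mathrm{ab}(u_{[0,n)})$, $n\in\mathbb Z$, is well defined on the orbit of $u$ and extends to a continuous map $\phi:\Omega_\sigma\to\mathbb R^d$. Put $R=\phi(\Omega_\sigma)$ and $R_a=\phi(\{w\in\Omega_\sigma: w_0=a\})$, and let $\lambda$ be the Lebesgue measure. The following hold. 1. $R=\bigcup_{a\in A}R_a=\bigcup_{a\in A}(R_a+Ve_a)$, and in each of the two unions the sets with different indices meet in $\lambda$-null sets. 2. The map $E(x)=x+Ve_a$ for $x\in R_a$ is well defined on the set $D$ of the points that lie in exactly one $R_a$; $R\setminus D$ is $\lambda$-null, $E$ maps $D$ into $R$, and $E$ is a domain exchange on $R$ with pieces $R_a$: each $R_a$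 is the closure of its interior and has a $\lambda$-null boundary, the interior of $R_a$ is contained in $D$ and $E$ is a translation on it, and $\lambda(E(D))=\lambda(R)$. Moreover $E$ is invertible almost everywhere: there is a measurable set $F\subseteq D$ with $\lambda(R\setminus F)=0$ which $E$ maps bijectively onto itself. 3. There is exactly one $S$-invariant Borel probability measure $\mu$ on $\Omega_\sigma$, and $\phi$ is a measurable conjugacy from $(\Omega_\sigma,S,\mu)$ to $(R,E,\lambda|_R/\lambda(R))$: there are measurable sets $X_0\subseteq\Omega_\sigma$ and $Y_0\subseteq D$, of full measure for $\mu$ and for $\lambda|_R$ respectively, such that $S:X_0\to X_0$ and $E:Y_0\to Y_0$ are bijective, $\phi:X_0\to Y_0$ is bijective and measurable with measurable inverse, $\phi\circ S=E\circ\phi$ on $X_0$, and $\phi$ carries $\mu$ to $\lambda|_R/\lambda(R)$. -/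

import Mathlib

open MeasureTheory Filter Topology

namespace RauzyExchange

/-! ### Words, substitutions and their subshifts -/

/-- A substitution over the alphabet `A`: a non-erasing morphism of the free monoid `A*`, given by
the images of the letters. -/
structure Substitution (A : Type*) where
  img : A → List A
  nonerasing : ∀ a, img a ≠ []

/-- The `n`-th power `S^n` of the shift map on bi-infinite words, `(S^n w)_i = w_{i+n}`. -/
def shiftPow {A : Type*} (n : ℤ) (w : ℤ → A) : ℤ → A := fun i => w (i + n)

/-- The shift map `S`. -/
def shift {A : Type*} (w : ℤ → A) : ℤ → A := shiftPow 1 w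

theorem lt_length_flatMap_range {A : Type*} (f : ℕ → List A) (hf : ∀ i, f i ≠ []) (m : ℕ) :
    m < ((List.range (m + 1)).flatMap f).length := by
  induction m with
  | zero =>
    have := List.length_pos_of_ne_nil (hf 0)
    simpa using this
  | succ k ih =>
    have := List.length_pos_of_ne_nil (hf (k + 1))
    rw [List.range_succ, List.flatMap_append, List.length_append]
    simp only [List.flatMap_cons, List.flatMap_nil, List.append_nil]
    omega

/-- The image `σ(w) = … σ(w_{-2}) σ(w_{-1}) · σ(w_0) σ(w_1) …` of a bi-infinite word, where `σ(w_0)`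
starts at position `0`. The letter at position `m ≥ 0` is letter number `m` of
`σ(w_0) … σ(w_m)`; the letter at position `-(m+1)` is letter number `m`, counted from the right,
of `σ(w_{-(m+1)}) … σ(w_{-1})`. -/
def Substitution.onWord {A : Type*} (σ : Substitution A) (w : ℤ → A) : ℤ → A
  | Int.ofNat m =>
      ((List.range (m + 1)).flatMap fun i => σ.img (w (Int.ofNat i)))[m]'
        (lt_length_flatMap_range _ (fun _ => σ.nonerasing _) m)
  | Int.negSucc m =>
      ((List.range (m + 1)).flatMap fun i => (σ.img (w (Int.negSucc i))).reverse)[m]'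
        (lt_length_flatMap_range _
          (fun _ h => σ.nonerasing _ (List.reverse_eq_nil_iff.mp h)) m)

/-- The incidence matrix `M_σ`, with entry `|σ(a)|_b` in row `b` and column `a`. -/
def Substitution.incidence {A : Type*} [DecidableEq A] (σ : Substitution A) : Matrix A A ℕ :=
  Matrix.of fun b a => (σ.img a).count b

/-- A square matrix with entries in `ℕ` is primitive if some power with exponent `≥ 1` has only
strictly positive entries. -/
def IsPrimitiveMatrix {A : Type*} [Fintype A] [DecidableEq A] (M : Matrix A A ℕ) : Prop :=
  ∃ n : ℕ, 1 ≤ n ∧ ∀ i j, 0 < (M ^ n) i j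

def Substitution.IsLeftProper {A : Type*} (σ : Substitution A) : Prop :=
  ∃ a₀, ∀ a, (σ.img a).head? = some a₀

def Substitution.IsRightProper {A : Type*} (σ : Substitution A) : Prop :=
  ∃ a₀, ∀ a, (σ.img a).getLast? = some a₀

def Substitution.IsProper {A : Type*} (σ : Substitution A) : Prop :=
  σ.IsLeftProper ∧ σ.IsRightProper

/-- The subshift `Ω_σ`: the smallest non-empty compact subset of `A^ℤ` that is invariant under the
substitution and under the shift. -/
def Substitution.subshift {A : Type*} [TopologicalSpace A] (σ : Substitution A) : Set (ℤ → A) :=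
  ⋂₀ {K | K.Nonempty ∧ IsCompact K ∧ Set.MapsTo σ.onWord K K ∧ shift '' K = K}

/-- The abelianized vector `ab(w_{[0,n)})` for `n : ℤ`; for `n < 0` it is `-ab(w_{[n,0)})`
(one of the two sums is always empty). -/
noncomputable def abPrefix {A : Type*} [DecidableEq A] (w : ℤ → A) (n : ℤ) : A → ℝ :=
  (∑ i ∈ Finset.Ico 0 n, Pi.single (w i) 1) - ∑ i ∈ Finset.Ico n 0, Pi.single (w i) 1

/-! ### Eigenvalues and projections -/

/-- `β` is the Perron eigenvalue of `M`: a real eigenvalue equal to the spectral radius. -/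
def IsPerronEigenvalue {A : Type*} [Fintype A] [DecidableEq A] (M : Matrix A A ℕ) (β : ℝ) : Prop :=
  Module.End.HasEigenvalue (Matrix.toLin' (M.map (Nat.cast : ℕ → ℝ))) β ∧
    ∀ z ∈ spectrum ℂ (M.map (Nat.cast : ℕ → ℂ)), ‖z‖ ≤ β

/-- A Pisot number: an algebraic integer `β > 1` all of whose other conjugates have modulus `< 1`. -/
def IsPisot (β : ℝ) : Prop :=
  IsIntegral ℤ β ∧ 1 < β ∧
    ∀ z : ℂ, Polynomial.aeval z (minpoly ℚ β) = 0 → z ≠ (β : ℂ) → ‖z‖ < 1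

/-- A unit Pisot number: the constant term of the minimal polynomial is `±1`. -/
def IsUnitPisot (β : ℝ) : Prop :=
  IsPisot β ∧ ((minpoly ℚ β).coeff 0 = 1 ∨ (minpoly ℚ β).coeff 0 = -1)

/-- `V` is a projection along the subspace `F`. -/
def IsProjectionAlong {X Y : Type*} [AddCommGroup X] [Module ℝ X] [AddCommGroup Y] [Module ℝ Y]
    (V : X →ₗ[ℝ] Y) (F : Submodule ℝ X) : Prop :=
  LinearMap.ker V = F ∧ Module.finrank ℝ Y + Module.finrank ℝ F = Module.finrank ℝ X

/-- The subspace `ker ((M - β I) P(M))` of `ℝ^A`. -/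
noncomputable def projKernel {A : Type*} [Fintype A] [DecidableEq A] (M : Matrix A A ℕ) (β : ℝ)
    (P : Polynomial ℤ) : Submodule ℝ (A → ℝ) :=
  LinearMap.ker (Matrix.toLin'
    ((M.map (Nat.cast : ℕ → ℝ) - β • (1 : Matrix A A ℝ)) *
      Polynomial.aeval (M.map (Nat.cast : ℕ → ℝ)) P))

/-! ### The Rauzy fractal -/

/-- The extension by continuity of the map `S^n u ↦ V ab(u_{[0,n)})` from the orbit of `u` to its
closure: the value at `w` is the limit of `V ab(u_{[0,n)})` as `S^n u → w`. -/
noncomputable def rauzyMap {A : Type*} [DecidableEq A] [TopologicalSpace A] {X : Type*}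
    [AddCommGroup X] [Module ℝ X] [TopologicalSpace X]
    (V : (A → ℝ) →ₗ[ℝ] X) (u : ℤ → A) (w : ℤ → A) : X :=
  haveI : Nonempty X := ⟨0⟩
  limUnder (comap (fun n : ℤ => shiftPow n u) (𝓝 w)) (fun n : ℤ => V (abPrefix u n))

/-- The Rauzy fractal `R = φ(Ω_σ)`. -/
noncomputable def fractal {A : Type*} [DecidableEq A] [TopologicalSpace A] {X : Type*}
    [AddCommGroup X] [Module ℝ X] [TopologicalSpace X]
    (σ : Substitution A) (V : (A → ℝ) →ₗ[ℝ] X) (u : ℤ → A) : Set X :=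
  rauzyMap V u '' σ.subshift

/-- The piece `R_a = φ([a])`, where `[a]` is the set of the `w` in `Ω_σ` with `w_0 = a`. -/
noncomputable def piece {A : Type*} [DecidableEq A] [TopologicalSpace A] {X : Type*}
    [AddCommGroup X] [Module ℝ X] [TopologicalSpace X]
    (σ : Substitution A) (V : (A → ℝ) →ₗ[ℝ] X) (u : ℤ → A) (a : A) : Set X :=
  rauzyMap V u '' {w | w ∈ σ.subshift ∧ w 0 = a}

/-! ### Domain exchanges and measurable conjugacies

A map that is defined almost everywhere is given by a domain `D` and a function `E`, of which only
the values on `D` are meant. -/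

/-- The set of the points that lie in exactly one of the pieces `P a`. -/
def exchangeDomain {ι X : Type*} (P : ι → Set X) : Set X := {x | ∃! a, x ∈ P a}

open Classical in
/-- The map `x ↦ x + t_a` if `x ∈ P a`, for `x` in exactly one piece (the value elsewhere is never
used). -/
noncomputable def exchangeMap {ι X : Type*} [Add X] (P : ι → Set X) (t : ι → X) (x : X) : X :=
  if h : ∃! a, x ∈ P a then x + t h.choose else x

/-- The set `R` with the map `E : R → R`, defined almost everywhere, namely on `D`, is a domain
exchange with pieces `P a`. -/
structure IsDomainExchange {ι X : Type*} [Finite ι] [AddCommGroup X] [TopologicalSpace X]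
    [MeasureSpace X] (R D : Set X) (E : X → X) (P : ι → Set X) : Prop where
  subset : D ⊆ R
  ae_defined : volume (R \ D) = 0
  mapsTo : Set.MapsTo E D R
  union : R = ⋃ a, P a
  disjoint : Pairwise fun a b => AEDisjoint volume (P a) (P b)
  closure_interior : ∀ a, closure (interior (P a)) = P a
  frontier_null : ∀ a, volume (frontier (P a)) = 0
  interior_subset : ∀ a, interior (P a) ⊆ D
  translation : ∀ a, ∃ t, ∀ x ∈ interior (P a), E x = x + t
  volume_image : volume (E '' D) = volume R

/-- The map `E`, defined on `D ⊆ R`, is invertible up to null sets: it restricts to a bijection of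
a measurable set of full measure in `R`. -/
def IsAEInvertible {X : Type*} [MeasureSpace X] (R D : Set X) (E : X → X) : Prop :=
  ∃ F : Set X, F ⊆ D ∧ MeasurableSet F ∧ volume (R \ F) = 0 ∧ Set.BijOn E F F

/-- `μ` is a shift-invariant probability measure on the subshift `Ω`. -/
def IsInvariantProb {A : Type*} [MeasurableSpace A] (Ω : Set (ℤ → A)) (μ : Measure (ℤ → A)) :
    Prop :=
  IsProbabilityMeasure μ ∧ μ Ωᶜ = 0 ∧ μ.map shift = μ

/-- `φ`, considered on `Ω`, is a measurable conjugacy (isomorphism of measure preserving systems)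
from `(Ω, T, μ)` to `(Y, E, ν)`, where `E` is defined on `D`: there are measurable sets of full
measure, on which `T` and `E` are bijective, between which `φ` is a bijection that is measurable
with measurable inverse `ψ`, intertwines `T` and `E` and carries `μ` to `ν`. -/
def IsMeasurableConjugacy {X Y : Type*} [MeasurableSpace X] [MeasurableSpace Y]
    (Ω : Set X) (T : X → X) (μ : Measure X) (D : Set Y) (E : Y → Y) (ν : Measure Y)
    (φ : X → Y) : Prop :=
  ∃ (X₀ : Set X) (Y₀ : Set Y) (ψ : Y → X),
    X₀ ⊆ Ω ∧ MeasurableSet X₀ ∧ μ X₀ᶜ = 0 ∧ Set.BijOn T X₀ X₀ ∧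
    Y₀ ⊆ D ∧ MeasurableSet Y₀ ∧ ν Y₀ᶜ = 0 ∧ Set.BijOn E Y₀ Y₀ ∧
    Set.MapsTo φ X₀ Y₀ ∧ Set.MapsTo ψ Y₀ X₀ ∧ Set.InvOn ψ φ X₀ Y₀ ∧
    Measurable (X₀.domRestrict φ) ∧ Measurable (Y₀.domRestrict ψ) ∧
    (∀ x ∈ X₀, φ (T x) = E (φ x)) ∧
    ∀ B, MeasurableSet B → μ (X₀ ∩ φ ⁻¹' B) = ν B

end RauzyExchange

open RauzyExchange

/-!
Let `l` be the positive left eigenvector of the incidence matrix for the Perron eigenvalue `β`, and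
let `N` be the map that the incidence matrix induces on the contracting space `F`, so that
`N (V x) = V (M x)`.

*The projection* (`exists_isContractingProjection`). The map `x ↦ (V x, l · x)` has the same kernel
as `P(M)`, hence `(V x, l · x)` for an integer vector `x` is determined by the integer vector
`P(M) x`, and the images of the integer vectors form a lattice in `F × ℝ`. The constant term `±1` of
the minimal polynomial makes the action of `M` on this lattice invertible, so that `|det N| = β⁻¹`.
The powers of `N` tend to `0`, since its eigenvalues are the conjugates of `β` other than `β`.

*Continuity of `φ`* (`continuousOn_rauzyMap`). The points `V ab(u_{[0,n)})` stay bounded by the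
contraction, and `u` is uniformly recurrent. By the argument of Gottschalk and Hedlund the points
depend continuously on `S^n u`. No recognizability is needed.

*The pieces.* Every word in `Ω_σ` is a shift of some `σ^k(w)` within the block `σ^k(w_0)`. This
expresses `R_b` as the union of copies `N^k R_a + t`, one for each occurrence of `b` in `σ^k(a)`
(`piece_eq_iUnion`). The volumes `x_b` of the pieces satisfy `β x ≤ M x` since `|det N| = β⁻¹`, and
pairing with `l` turns this into an equality, so that the copies are disjoint up to null sets. As all
words `σ(a)` start with the same letter, one piece contains copies of all pieces by the same affine
map: the pieces are disjoint up to null sets (`aedisjoint_piece`). The common last letter gives the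
same for the pieces `R_a + V e_a` (`aedisjoint_translate`). The projected integer vectors are dense,
and locally they lie in finitely many translates of the compact set `R`. These translates cover the
space, so that by Baire's theorem some piece has an interior point
(`exists_nonempty_interior_piece`). By the subdivision every piece is the closure of its interior,
and the pairing with `l` shows that its boundary is a null set (`volume_frontier_piece`).

*The conjugacy.* A point `φ(w)` that lies in only one piece determines `w_0`, hence also
`φ(Sw) = φ(w) + V e_{w_0}`. If it lies in only one piece `R_a + V e_a`, then it determines `w_{-1}`,
hence `φ(S⁻¹w)`. Therefore `φ` is injective on the words all of whose shifts have unambiguous images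
(`injOn_rauzyMap`). The image of this set of words has full measure, since `φ` varies within an
orbit by a countable set of vectors. The inverse of `φ` carries the Lebesgue measure to an invariant
measure on the subshift.

*Unique ergodicity* (`isInvariantProb_unique`). For a proper substitution and large `K`, the sum of
a local function over a block `σ^K(w_0)` depends on `w_0` only. Sums over longer blocks are obtained
by applying powers of the incidence matrix, which rescaled by `β` converge to a projection onto the
Perron eigenvector. This determines the integrals of local functions for every invariant measure.
-/

set_option linter.unusedSectionVars false

namespace RauzyExchange

/-! ### Sums along the integers -/

/-- The sum `f 0 + … + f (n-1)` for `n ≥ 0` and `-(f n + … + f (-1))` for `n < 0`. -/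
noncomputable def intSum {G : Type*} [AddCommGroup G] (f : ℤ → G) (n : ℤ) : G :=
  (∑ i ∈ Finset.Ico 0 n, f i) - ∑ i ∈ Finset.Ico n 0, f i

section intSum
variable {G H : Type*} [AddCommGroup G] [AddCommGroup H]

@[simp] theorem intSum_zero (f : ℤ → G) : intSum f 0 = 0 := by simp [intSum]

theorem intSum_succ (f : ℤ → G) (n : ℤ) : intSum f (n + 1) = intSum f n + f n := by
  unfold intSum
  rcases le_or_gt 0 n with h | h
  · rw [← Finset.insert_Ico_right_eq_Ico_add_one h, Finset.sum_insert (by simp)]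
    rw [Finset.Ico_eq_empty_of_le h, Finset.Ico_eq_empty_of_le (by omega : 0 ≤ n + 1)]
    simp [add_comm]
  · rw [← Finset.insert_Ico_add_one_left_eq_Ico h, Finset.sum_insert (by simp)]
    rw [Finset.Ico_eq_empty_of_le h.le, Finset.Ico_eq_empty_of_le (by omega : n + 1 ≤ 0)]
    simp

theorem eq_intSum {f g : ℤ → G} (h0 : g 0 = 0) (h : ∀ n, g (n + 1) = g n + f n) (n : ℤ) :
    g n = intSum f n := by
  induction n using Int.induction_on with
  | zero => simp [h0]
  | succ k ih => rw [h, ih, intSum_succ]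
  | pred k ih =>
    have h1 := h (-(k : ℤ) - 1)
    have h2 := intSum_succ f (-(k : ℤ) - 1)
    rw [sub_add_cancel] at h1 h2
    rw [h1, h2] at ih
    exact add_right_cancel ih

theorem intSum_add (f : ℤ → G) (m n : ℤ) :
    intSum f (m + n) = intSum f m + intSum (fun i => f (i + m)) n := by
  have := eq_intSum (f := fun i => f (i + m)) (g := fun n => intSum f (m + n) - intSum f m)
    (by simp) (fun n => by
      rw [← add_assoc, intSum_succ, add_comm n m]; abel) n
  rw [← this]; abel

theorem map_intSum {F : Type*} [FunLike F G H] [AddMonoidHomClass F G H] (φ : F) (f : ℤ → G)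
    (n : ℤ) : φ (intSum f n) = intSum (fun i => φ (f i)) n :=
  eq_intSum (g := fun n => φ (intSum f n)) (by simp) (fun n => by rw [intSum_succ, map_add]) n

theorem intSum_natCast (f : ℤ → G) (n : ℕ) : intSum f n = ∑ j ∈ Finset.range n, f j := by
  induction n with
  | zero => simp
  | succ k ih => rw [Nat.cast_succ, intSum_succ, ih, Finset.sum_range_succ]

theorem intSum_add_natCast (f : ℤ → G) (m : ℤ) (n : ℕ) :
    intSum f (m + n) = intSum f m + ∑ j ∈ Finset.range n, f (m + j) := by
  rw [intSum_add, intSum_natCast]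
  simp only [add_comm]

theorem intSum_congr {f g : ℤ → G} {m n : ℤ} (hn : m ≤ n) (h : ∀ i, m ≤ i → i < n → f i = g i) :
    intSum f n - intSum f m = intSum g n - intSum g m := by
  obtain ⟨k, rfl⟩ := Int.exists_add_of_le hn
  rw [intSum_add_natCast, intSum_add_natCast, add_sub_cancel_left, add_sub_cancel_left]
  refine Finset.sum_congr rfl fun j hj => h _ (by omega) ?_
  have := Finset.mem_range.1 hj
  omega

end intSum

theorem sum_range_getElem {α G : Type*} [AddCommMonoid G] (L : List α) (F : α → G) (f : ℕ → G)
    (h : ∀ j (hj : j < L.length), f j = F L[j]) :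
    ∑ j ∈ Finset.range L.length, f j = (L.map F).sum := by
  rw [Finset.sum_range, ← List.sum_ofFn]
  congr 1
  apply List.ext_getElem <;> simp [h]

/-! ### Images of bi-infinite words -/

namespace Substitution
variable {A : Type*} (σ τ : Substitution A)

theorem length_img_pos (a : A) : 0 < (σ.img a).length :=
  List.length_pos_of_ne_nil (σ.nonerasing a)

/-- The position in `σ(w)` at which the image of the letter `w_n` starts. -/
noncomputable def pos (w : ℤ → A) (n : ℤ) : ℤ := intSum (fun i => ((σ.img (w i)).length : ℤ)) n

@[simp] theorem pos_zero (w : ℤ → A) : σ.pos w 0 = 0 := by simp [pos]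

theorem pos_succ (w : ℤ → A) (n : ℤ) : σ.pos w (n + 1) = σ.pos w n + (σ.img (w n)).length :=
  intSum_succ _ _

theorem pos_add_le (w : ℤ → A) (m : ℤ) (k : ℕ) : σ.pos w m + k ≤ σ.pos w (m + k) := by
  induction k with
  | zero => simp
  | succ k ih =>
    have := σ.pos_succ w (m + k)
    have := σ.length_img_pos (w (m + k))
    push_cast
    rw [← add_assoc m]
    omega

theorem pos_strictMono (w : ℤ → A) : StrictMono (σ.pos w) := by
  intro m n h
  obtain ⟨k, rfl⟩ := Int.exists_add_of_le h.le
  have := σ.pos_add_le w m k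
  omega

theorem le_pos (w : ℤ → A) {n : ℤ} (hn : 0 ≤ n) : n ≤ σ.pos w n := by
  lift n to ℕ using hn
  simpa using σ.pos_add_le w 0 n

theorem pos_le (w : ℤ → A) {n : ℤ} (hn : n ≤ 0) : σ.pos w n ≤ n := by
  obtain ⟨k, hk⟩ := Int.exists_add_of_le hn
  have := σ.pos_add_le w n k
  rw [← hk, pos_zero] at this
  omega

theorem exists_pos_add (w : ℤ → A) (m : ℤ) :
    ∃ (n : ℤ) (j : ℕ), j < (σ.img (w n)).length ∧ m = σ.pos w n + j := by
  induction m using Int.induction_on with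
  | zero => exact ⟨0, 0, σ.length_img_pos _, by simp⟩
  | succ k ih =>
    obtain ⟨n, j, hj, h⟩ := ih
    rcases Nat.lt_or_ge (j + 1) (σ.img (w n)).length with h1 | h1
    · exact ⟨n, j + 1, h1, by push_cast; omega⟩
    · refine ⟨n + 1, 0, σ.length_img_pos _, ?_⟩
      rw [pos_succ]; push_cast; omega
  | pred k ih =>
    obtain ⟨n, j, hj, h⟩ := ih
    rcases Nat.eq_zero_or_pos j with h1 | h1
    · have h2 := σ.pos_succ w (n - 1)
      have h3 := σ.length_img_pos (w (n - 1))
      rw [sub_add_cancel] at h2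
      refine ⟨n - 1, (σ.img (w (n - 1))).length - 1, by omega, ?_⟩
      omega
    · exact ⟨n, j - 1, by omega, by omega⟩

/-- Letter number `j` of the factor `f n` of `f 0 ⋯ f (k-1)`. -/
theorem getElem?_flatMap_range (f : ℕ → List A) {n j k : ℕ} (hj : j < (f n).length) (hk : n < k) :
    ((List.range k).flatMap f)[((List.range n).flatMap f).length + j]? = (f n)[j]? := by
  obtain ⟨r, rfl⟩ := Nat.exists_eq_add_of_lt hk
  rw [add_assoc, List.range_add, List.flatMap_append, List.getElem?_append_right (by omega),
    Nat.add_sub_cancel_left, Nat.add_comm r 1, List.range_add, List.map_append, List.flatMap_append]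
  simp only [List.range_one, List.map_cons, List.map_nil, List.flatMap_cons, List.flatMap_nil,
    List.append_nil, add_zero]
  rw [List.getElem?_append_left hj]

theorem pos_natCast (w : ℤ → A) (n : ℕ) :
    σ.pos w n = ((List.range n).flatMap fun i => σ.img (w (Int.ofNat i))).length := by
  induction n with
  | zero => simp
  | succ k ih => rw [List.range_succ, Nat.cast_succ, pos_succ, ih]; simp

theorem pos_neg (w : ℤ → A) (n : ℕ) :
    σ.pos w (-n) =
      -((List.range n).flatMap fun i => (σ.img (w (Int.negSucc i))).reverse).length := by
  induction n with
  | zero => simp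
  | succ k ih =>
    have := σ.pos_succ w (-(k + 1 : ℕ))
    rw [List.range_succ]
    have h1 : (-((k + 1 : ℕ) : ℤ)) = Int.negSucc k := rfl
    have h2 : (-((k + 1 : ℕ) : ℤ)) + 1 = -(k : ℤ) := by push_cast; ring
    rw [h2, ih] at this
    rw [h1] at this ⊢
    simp only [List.flatMap_append, List.length_append, List.flatMap_cons, List.flatMap_nil,
      List.append_nil, List.length_reverse]
    push_cast
    linarith

theorem onWord_pos_add (w : ℤ → A) (n : ℤ) {j : ℕ} (hj : j < (σ.img (w n)).length) :
    σ.onWord w (σ.pos w n + j) = (σ.img (w n))[j] := by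
  rcases n with n | n
  · set f : ℕ → List A := fun i => σ.img (w (Int.ofNat i)) with hf
    have h1 : σ.pos w (Int.ofNat n) + j = Int.ofNat (((List.range n).flatMap f).length + j) := by
      have := σ.pos_natCast w n
      simp only [Int.ofNat_eq_natCast] at this ⊢
      rw [this]; push_cast; rfl
    have h2 := σ.le_pos w (Int.natCast_nonneg n)
    rw [σ.pos_natCast w n] at h2
    have h3 : n ≤ ((List.range n).flatMap f).length := by exact_mod_cast h2
    rw [h1]
    have := getElem?_flatMap_range f (n := n) (j := j)
      (k := ((List.range n).flatMap f).length + j + 1) hj (by omega)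
    simp only [onWord]
    rw [← Option.some_inj, ← List.getElem?_eq_getElem, ← List.getElem?_eq_getElem]
    exact this
  · set f : ℕ → List A := fun i => (σ.img (w (Int.negSucc i))).reverse with hf
    have h0 := σ.pos_succ w (Int.negSucc n)
    have h1 : Int.negSucc n + 1 = -(n : ℤ) := by omega
    rw [h1, σ.pos_neg w n] at h0
    set l := (σ.img (w (Int.negSucc n))).length with hl
    have hlen : (f n).length = l := by simp [hf, hl]
    have h2 : σ.pos w (Int.negSucc n) + j
        = Int.negSucc (((List.range n).flatMap f).length + (l - 1 - j)) := by
      have h4 : (((List.range n).flatMap f).length : ℤ) =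
        (((List.range n).flatMap fun i => (σ.img (w (Int.negSucc i))).reverse).length : ℤ) := rfl
      rw [Int.negSucc_eq (_ + _)]
      push_cast
      rw [h4]; omega
    have h3 := σ.pos_le w (n := -(n : ℤ)) (by omega)
    rw [σ.pos_neg w n] at h3
    have h4 : n ≤ ((List.range n).flatMap f).length := by
      have : (n : ℤ) ≤ (((List.range n).flatMap f).length : ℤ) := by
        change (n : ℤ) ≤ (((List.range n).flatMap
          fun i => (σ.img (w (Int.negSucc i))).reverse).length : ℤ)
        omega
      exact_mod_cast this
    rw [h2]
    have := getElem?_flatMap_range f (n := n) (j := l - 1 - j)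
      (k := ((List.range n).flatMap f).length + (l - 1 - j) + 1) (by omega) (by omega)
    simp only [onWord]
    rw [← Option.some_inj, ← List.getElem?_eq_getElem, ← List.getElem?_eq_getElem]
    refine this.trans ?_
    rw [List.getElem?_reverse (by omega)]
    congr 1
    omega

/-- `σ(w)` is the only word that reads `σ(w_n)` from position `pos w n` on, for all `n`. -/
theorem onWord_eq {w v : ℤ → A}
    (h : ∀ n (j : ℕ) (hj : j < (σ.img (w n)).length), v (σ.pos w n + j) = (σ.img (w n))[j]) :
    σ.onWord w = v := by
  funext m
  obtain ⟨n, j, hj, rfl⟩ := σ.exists_pos_add w m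
  rw [onWord_pos_add _ _ _ hj, h _ _ hj]

theorem pos_shiftPow (w : ℤ → A) (n m : ℤ) :
    σ.pos (shiftPow n w) m = σ.pos w (n + m) - σ.pos w n := by
  unfold pos
  rw [intSum_add]
  simp [shiftPow]

theorem onWord_shiftPow (w : ℤ → A) (n : ℤ) :
    σ.onWord (shiftPow n w) = shiftPow (σ.pos w n) (σ.onWord w) := by
  refine σ.onWord_eq fun m j hj => ?_
  have h := σ.onWord_pos_add w (m + n) hj
  refine Eq.trans ?_ h
  rw [pos_shiftPow, shiftPow]
  congr 1
  rw [add_comm n m]; ring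

/-- `σ(w)` on `[pos m, pos n)` is determined by `w` on `[m, n)`, given that the blocks number `k` of
the two words start at the same position. -/
theorem onWord_congr {w w' : ℤ → A} {k : ℤ} (hk : σ.pos w k = σ.pos w' k) {m n : ℤ}
    (hmk : m ≤ k) (hkn : k ≤ n)
    (h : ∀ i, m ≤ i → i < n → w i = w' i) (i : ℤ) (hi : σ.pos w m ≤ i) (hi' : i < σ.pos w n) :
    σ.onWord w i = σ.onWord w' i := by
  obtain ⟨q, j, hj, rfl⟩ := σ.exists_pos_add w i
  have h1 : q < n := by
    by_contra hc
    have := (σ.pos_strictMono w).monotone (not_lt.1 hc)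
    omega
  have h2 : m ≤ q := by
    by_contra hc
    have h3 := (σ.pos_strictMono w).monotone (Int.add_one_le_iff.2 (not_le.1 hc))
    rw [pos_succ] at h3
    omega
  have h4 : σ.pos w q = σ.pos w' q := by
    rcases le_total k q with hq | hq
    · have := intSum_congr (f := fun i => ((σ.img (w i)).length : ℤ))
        (g := fun i => ((σ.img (w' i)).length : ℤ)) hq
        (fun i hi hi' => by rw [h i (by omega) (by omega)])
      unfold pos at hk ⊢
      linarith
    · have := intSum_congr (f := fun i => ((σ.img (w i)).length : ℤ))
        (g := fun i => ((σ.img (w' i)).length : ℤ)) hq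
        (fun i hi hi' => by rw [h i (by omega) (by omega)])
      unfold pos at hk ⊢
      linarith
  have h5 := h q h2 h1
  rw [σ.onWord_pos_add w q hj, h4, σ.onWord_pos_add w' q (h5 ▸ hj)]
  simp only [h5]

theorem continuous_onWord [TopologicalSpace A] [DiscreteTopology A] : Continuous σ.onWord := by
  refine continuous_pi fun i => ?_
  refine continuous_discrete_rng.2 fun a => ?_
  rw [isOpen_iff_mem_nhds]
  intro w hw
  have ho : IsOpen ((Set.Icc (-|i| - 1) (|i| + 1)).pi fun j => ({w j} : Set A)) :=
    isOpen_set_pi (Set.finite_Icc _ _) fun _ _ => isOpen_discrete _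
  filter_upwards [ho.mem_nhds fun j _ => rfl] with v hv
  have hwa : σ.onWord w i = a := hw
  change σ.onWord v i = a
  rw [← hwa]
  symm
  have h1 := σ.le_pos w (n := |i| + 1) (by positivity)
  have h2 := σ.pos_le w (n := -|i| - 1) (by have := abs_nonneg i; omega)
  refine σ.onWord_congr (k := 0) (m := -|i| - 1) (n := |i| + 1) (by simp)
    (by have := abs_nonneg i; omega) (by positivity) (fun j hj hj' => ?_) i ?_ ?_
  · exact (hv j ⟨hj, hj'.le⟩).symm
  · have := neg_abs_le i; omega
  · have := le_abs_self i; omega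

/-! ### Composition and powers of substitutions -/

/-- The composition `σ ∘ τ`. -/
def comp : Substitution A where
  img a := (τ.img a).flatMap σ.img
  nonerasing a h := by
    obtain ⟨b, l, hl⟩ := List.exists_cons_of_ne_nil (τ.nonerasing a)
    rw [hl, List.flatMap_cons, List.append_eq_nil_iff] at h
    exact σ.nonerasing b h.1

theorem length_comp (a : A) :
    ((σ.comp τ).img a).length = ((τ.img a).map fun b => (σ.img b).length).sum := by
  simp [comp, List.length_flatMap]

theorem pos_comp (w : ℤ → A) (n : ℤ) :
    (σ.comp τ).pos w n = σ.pos (τ.onWord w) (τ.pos w n) := by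
  symm
  refine eq_intSum (g := fun n => σ.pos (τ.onWord w) (τ.pos w n)) (by simp) (fun n => ?_) n
  rw [pos_succ]
  conv_lhs => rw [pos, intSum_add_natCast]
  rw [pos, length_comp, sum_range_getElem (τ.img (w n)) (fun b => ((σ.img b).length : ℤ))]
  · congr 1
    rw [Nat.cast_list_sum, List.map_map]
    rfl
  · intro j hj
    exact congrArg (fun b => ((σ.img b).length : ℤ)) (τ.onWord_pos_add w n hj)

theorem getElem?_flatMap {α γ : Type*} (L : List α) (f : α → List γ) {j i : ℕ} (hj : j < L.length)
    (hi : i < (f L[j]).length) :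
    (L.flatMap f)[((L.take j).flatMap f).length + i]? = (f L[j])[i]? := by
  conv_lhs => rw [← List.take_append_drop j L]
  rw [List.flatMap_append, List.getElem?_append_right, List.drop_eq_getElem_cons hj,
    List.flatMap_cons, List.getElem?_append_left]
  · congr 1
    simp [List.take_append_drop]
  · simpa [List.take_append_drop] using hi
  · simp [List.take_append_drop]

theorem onWord_comp (w : ℤ → A) : (σ.comp τ).onWord w = σ.onWord (τ.onWord w) := by
  funext m
  obtain ⟨q, i, hi, rfl⟩ := σ.exists_pos_add (τ.onWord w) m
  rw [onWord_pos_add _ _ _ hi]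
  obtain ⟨n, j, hj, rfl⟩ := τ.exists_pos_add w q
  have hy := τ.onWord_pos_add w n hj
  set k := (((τ.img (w n)).take j).flatMap σ.img).length + i with hk
  have h0 := getElem?_flatMap (τ.img (w n)) σ.img (i := i) hj (by rw [← hy]; exact hi)
  have hi2 : i < (σ.img (τ.img (w n))[j]).length := by rw [← hy]; exact hi
  rw [List.getElem?_eq_getElem hi2] at h0
  obtain ⟨h1, h2⟩ := List.getElem?_eq_some_iff.1 h0
  have h3 : σ.pos (τ.onWord w) (τ.pos w n + j) + i = (σ.comp τ).pos w n + k := by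
    rw [pos_comp, hk]
    have h4 := intSum_add_natCast (fun i => ((σ.img (τ.onWord w i)).length : ℤ)) (τ.pos w n) j
    change σ.pos (τ.onWord w) (τ.pos w n + j) = _ at h4
    rw [h4]
    change σ.pos (τ.onWord w) (τ.pos w n) + _ + _ = _
    push_cast
    rw [← add_assoc, List.length_flatMap]
    congr 2
    rw [Nat.cast_list_sum, List.map_map]
    rw [← sum_range_getElem ((τ.img (w n)).take j) _
      (fun k => (((σ.img (τ.onWord w (τ.pos w n + k))).length : ℤ)))]
    · rw [List.length_take, min_eq_left hj.le]
    · intro k hk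
      have hk2 : k < (τ.img (w n)).length := by
        rw [List.length_take] at hk; omega
      rw [onWord_pos_add _ _ _ hk2]
      simp
  rw [h3, (σ.comp τ).onWord_pos_add w n (j := k) h1]
  refine h2.trans ?_
  simp only [hy]

/-- The powers `σ^k`. -/
def pow : ℕ → Substitution A
  | 0 => ⟨fun a => [a], fun _ => by simp⟩
  | k + 1 => (pow k).comp σ

theorem onWord_pow_zero (w : ℤ → A) : (σ.pow 0).onWord w = w := by
  have hp : ∀ n, (σ.pow 0).pos w n = n := fun n => by
    symm
    exact eq_intSum (f := fun i => (((σ.pow 0).img (w i)).length : ℤ)) (g := fun n => n) rfl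
      (fun n => by simp [pow]) n
  refine onWord_eq _ fun n j hj => ?_
  have : j = 0 := by simpa [pow] using hj
  subst this
  rw [hp]
  simp [pow]

theorem onWord_pow_succ (k : ℕ) (w : ℤ → A) :
    (σ.pow (k + 1)).onWord w = (σ.pow k).onWord (σ.onWord w) := onWord_comp _ _ _

theorem pow_add (j k : ℕ) : σ.pow (j + k) = (σ.pow j).comp (σ.pow k) := by
  induction k with
  | zero =>
    cases hs : σ.pow j with
    | mk img _ =>
      simp [comp, pow]
  | succ k ih =>
    rw [← add_assoc]
    simp only [pow]
    rw [ih]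
    simp only [comp, Substitution.mk.injEq]
    funext a
    rw [List.flatMap_assoc]

theorem onWord_pow_fixed {u : ℤ → A} (hu : σ.onWord u = u) (k : ℕ) : (σ.pow k).onWord u = u := by
  induction k with
  | zero => exact σ.onWord_pow_zero u
  | succ k ih => rw [onWord_pow_succ, hu, ih]

/-- The first letter of a block of a proper substitution does not depend on the block. -/
theorem onWord_pos_eq (hp : σ.IsProper) (w v : ℤ → A) (n m : ℤ) :
    σ.onWord w (σ.pos w n) = σ.onWord v (σ.pos v m) := by
  obtain ⟨a₀, ha₀⟩ := hp.1
  have key : ∀ (w : ℤ → A) n, σ.onWord w (σ.pos w n) = a₀ := by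
    intro w n
    have h1 := σ.onWord_pos_add w n (σ.length_img_pos _)
    have h2 := ha₀ (w n)
    rw [List.head?_eq_getElem?, List.getElem?_eq_getElem (σ.length_img_pos _),
      Option.some_inj] at h2
    rw [← h2, ← h1]
    simp
  rw [key, key]

/-- The last letter of a block of a proper substitution does not depend on the block. -/
theorem onWord_pos_sub_one_eq (hp : σ.IsProper) (w v : ℤ → A) (n m : ℤ) :
    σ.onWord w (σ.pos w n - 1) = σ.onWord v (σ.pos v m - 1) := by
  obtain ⟨b₀, hb₀⟩ := hp.2
  have key : ∀ (w : ℤ → A) n, σ.onWord w (σ.pos w n - 1) = b₀ := by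
    intro w n
    have hlen := σ.length_img_pos (w (n - 1))
    have h1 := σ.onWord_pos_add w (n - 1) (j := (σ.img (w (n - 1))).length - 1) (by omega)
    have h2 := hb₀ (w (n - 1))
    rw [List.getLast?_eq_getElem?, List.getElem?_eq_getElem (by omega), Option.some_inj] at h2
    rw [← h2, ← h1]
    congr 1
    have h3 := σ.pos_succ w (n - 1)
    rw [sub_add_cancel] at h3
    omega
  rw [key, key]

/-! ### Incidence matrices -/

section incidence
variable [Fintype A] [DecidableEq A]

theorem sum_map_eq_sum_count {G : Type*} [AddCommMonoid G] (L : List A) (F : A → G) :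
    (L.map F).sum = ∑ b, L.count b • F b := by
  rw [Finset.sum_list_map_count]
  refine Finset.sum_subset (Finset.subset_univ _) fun b _ hb => ?_
  rw [List.count_eq_zero_of_not_mem (by simpa using hb), zero_smul]

theorem incidence_comp : (σ.comp τ).incidence = σ.incidence * τ.incidence := by
  ext b a
  simp only [incidence, Matrix.of_apply, comp, Matrix.mul_apply, List.count_flatMap, Function.comp_def]
  rw [sum_map_eq_sum_count]
  simp [mul_comm]

theorem incidence_pow (k : ℕ) : (σ.pow k).incidence = σ.incidence ^ k := by
  induction k with
  | zero =>
    ext b a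
    simp only [pow, incidence, Matrix.of_apply, pow_zero, Matrix.one_apply, List.count_singleton]
    simp [eq_comm (a := a)]
  | succ k ih => rw [pow, incidence_comp, ih, pow_succ]

/-- The sum of a letter function `F` over the block `σ(w_n)` of `σ(w)`. -/
theorem sum_block {G : Type*} [AddCommMonoid G] (F : A → G) (w : ℤ → A) (n : ℤ) :
    ∑ j ∈ Finset.range (σ.img (w n)).length, F (σ.onWord w (σ.pos w n + j)) =
      ∑ b, σ.incidence b (w n) • F b := by
  rw [sum_range_getElem _ F _ fun j hj => by rw [onWord_pos_add _ _ _ hj], sum_map_eq_sum_count]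
  rfl

theorem length_img (a : A) : (σ.img a).length = ∑ b, σ.incidence b a := by
  have := sum_map_eq_sum_count (σ.img a) (fun _ => 1)
  simpa [incidence] using this

omit [Fintype A] in
theorem incidence_pos_iff (a b : A) : 0 < σ.incidence b a ↔ b ∈ σ.img a := by
  simp [incidence, List.count_pos_iff]

end incidence
end Substitution

section abPrefix
variable {A : Type*} [DecidableEq A]

theorem abPrefix_eq (w : ℤ → A) : abPrefix w = intSum fun i => Pi.single (w i) (1 : ℝ) := rfl

theorem abPrefix_zero (w : ℤ → A) : abPrefix w 0 = 0 := intSum_zero _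

theorem abPrefix_succ (w : ℤ → A) (n : ℤ) :
    abPrefix w (n + 1) = abPrefix w n + Pi.single (w n) 1 := intSum_succ _ _

theorem abPrefix_add (w : ℤ → A) (m n : ℤ) :
    abPrefix w (m + n) = abPrefix w m + abPrefix (shiftPow m w) n := by
  rw [abPrefix_eq, intSum_add]
  rfl

theorem abPrefix_congr {w w' : ℤ → A} {m n : ℤ} (hn : m ≤ n)
    (h : ∀ i, m ≤ i → i < n → w i = w' i) :
    abPrefix w n - abPrefix w m = abPrefix w' n - abPrefix w' m :=
  intSum_congr hn fun i hi hi' => by rw [h i hi hi']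

theorem exists_int_abPrefix (w : ℤ → A) (n : ℤ) :
    ∃ x : A → ℤ, abPrefix w n = fun a => (x a : ℝ) := by
  refine ⟨intSum (fun i => Pi.single (w i) (1 : ℤ)) n, ?_⟩
  have := map_intSum ((Int.castAddHom ℝ).compLeft A) (fun i => Pi.single (w i) (1 : ℤ)) n
  rw [abPrefix_eq]
  refine Eq.trans ?_ this.symm
  congr 1
  funext i a
  simp [Pi.single_apply]

variable [Fintype A]

/-- The incidence matrix maps the broken line of `w` to that of `σ(w)`. -/
theorem mulVec_abPrefix (σ : Substitution A) (w : ℤ → A) (n : ℤ) :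
    (σ.incidence.map (Nat.cast : ℕ → ℝ)).mulVec (abPrefix w n) =
      abPrefix (σ.onWord w) (σ.pos w n) := by
  have h1 := map_intSum (σ.incidence.map (Nat.cast : ℕ → ℝ)).mulVecLin
    (fun i => Pi.single (w i) (1 : ℝ)) n
  refine Eq.trans h1 ?_
  symm
  refine eq_intSum (g := fun n => abPrefix (σ.onWord w) (σ.pos w n)) (by simp [abPrefix_zero])
    (fun n => ?_) n
  rw [σ.pos_succ, abPrefix_eq, intSum_add_natCast, σ.sum_block (fun b => Pi.single b (1 : ℝ))]
  congr 1
  ext c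
  simp [Pi.single_apply, Matrix.mulVec, dotProduct]

end abPrefix

/-! ### Decay of the powers of an endomorphism -/

theorem tendsto_zero_of_le_mul_add {u b : ℕ → ℝ} {q : ℝ} (hu : ∀ k, 0 ≤ u k) (hq0 : 0 ≤ q)
    (hq : q < 1) (h : ∀ k, u (k + 1) ≤ q * u k + b k) (hb : Tendsto b atTop (𝓝 0)) :
    Tendsto u atTop (𝓝 0) := by
  rw [Metric.tendsto_atTop]
  intro ε hε
  have hb' := (hb.eventually (gt_mem_nhds (show (0 : ℝ) < ε / 2 * (1 - q) by
    have : 0 < 1 - q := by linarith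
    positivity)))
  obtain ⟨n, hn⟩ := eventually_atTop.1 hb'
  have h1 : ∀ m, u (n + m) ≤ q ^ m * u n + ε / 2 := by
    intro m
    induction m with
    | zero => simp; linarith
    | succ m ih =>
      have := h (n + m)
      have h2 := hn (n + m) (by omega)
      have h3 := mul_le_mul_of_nonneg_left ih hq0
      rw [← add_assoc, pow_succ]
      nlinarith
  have h2 : Tendsto (fun m => q ^ m * u n) atTop (𝓝 0) := by
    simpa using (tendsto_pow_atTop_nhds_zero_of_lt_one hq0 hq).mul_const (u n)
  obtain ⟨m, hm⟩ := eventually_atTop.1 (h2.eventually (gt_mem_nhds (half_pos hε)))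
  refine ⟨n + m, fun k hk => ?_⟩
  obtain ⟨r, rfl⟩ := Nat.exists_eq_add_of_le hk
  have h3 := h1 (m + r)
  have h4 := hm (m + r) (by omega)
  rw [← add_assoc] at h3
  rw [Real.dist_eq, sub_zero, abs_of_nonneg (hu _)]
  linarith

/-- A vector that is killed by a product of factors `T - z` with `‖z‖ < r` grows more slowly than
`r ^ k` under the iteration of `T`. -/
theorem tendsto_pow_apply_of_prod {E : Type*} [NormedAddCommGroup E] [NormedSpace ℂ E]
    (T : Module.End ℂ E) {r : ℝ} (hr : 0 < r) (s : Multiset ℂ) :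
    ∀ v : E, (∀ z ∈ s, ‖z‖ < r) →
      Polynomial.aeval T (s.map fun z => Polynomial.X - Polynomial.C z).prod v = 0 →
      Tendsto (fun k : ℕ => ‖(T ^ k) v‖ / r ^ k) atTop (𝓝 0) := by
  induction s using Multiset.induction_on with
  | empty =>
    intro v _ hv
    have hv0 : v = 0 := by simpa using hv
    simp [hv0]
  | cons z s ih =>
    intro v hs hv
    rw [Multiset.map_cons, Multiset.prod_cons, mul_comm, map_mul, Module.End.mul_apply] at hv
    have h1 := ih _ (fun z hz => hs z (Multiset.mem_cons_of_mem hz)) hv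
    have hz := hs z (Multiset.mem_cons_self z s)
    refine tendsto_zero_of_le_mul_add (q := ‖z‖ / r) (fun k => by positivity) (by positivity)
      ((div_lt_one hr).2 hz) (b := fun k => ‖(T ^ k)
        ((Polynomial.aeval T (Polynomial.X - Polynomial.C z)) v)‖ / r ^ k / r) (fun k => ?_)
      (by simpa using h1.div_const r)
    have h2 : (T ^ (k + 1)) v = z • (T ^ k) v +
        (T ^ k) ((Polynomial.aeval T (Polynomial.X - Polynomial.C z)) v) := by
      rw [pow_succ, Module.End.mul_apply]
      simp [Algebra.algebraMap_eq_smul_one]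
    rw [h2, pow_succ]
    calc _ ≤ (‖z‖ * ‖(T ^ k) v‖ + ‖(T ^ k) ((Polynomial.aeval T
          (Polynomial.X - Polynomial.C z)) v)‖) / (r ^ k * r) := by
          gcongr
          exact (norm_add_le _ _).trans (by rw [norm_smul])
      _ = _ := by field_simp

section Perron
variable {A : Type*} [Fintype A] [DecidableEq A]

/-- The incidence matrix with real entries, as an endomorphism. -/
noncomputable def toEnd (M : Matrix A A ℕ) : (A → ℝ) →ₗ[ℝ] (A → ℝ) :=
  Matrix.toLin' (M.map (Nat.cast : ℕ → ℝ))

theorem toEnd_apply (M : Matrix A A ℕ) (x : A → ℝ) (b : A) :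
    toEnd M x b = ∑ a, (M b a : ℝ) * x a := by
  simp [toEnd, Matrix.mulVec, dotProduct]

theorem toEnd_mul (M N : Matrix A A ℕ) (x : A → ℝ) : toEnd (M * N) x = toEnd M (toEnd N x) := by
  unfold toEnd
  rw [← LinearMap.comp_apply, ← Matrix.toLin'_mul]
  congr 2
  exact Matrix.map_mul (f := Nat.castRingHom ℝ)

theorem toEnd_pow (M : Matrix A A ℕ) (k : ℕ) : toEnd (M ^ k) = toEnd M ^ k := by
  induction k with
  | zero =>
    rw [pow_zero, pow_zero]
    ext x b
    simp [toEnd_apply, Matrix.one_apply, Pi.single_apply]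
  | succ k ih =>
    rw [pow_succ, pow_succ, ← ih]
    ext1
    ext1
    simp [toEnd_mul]

theorem toEnd_mono (M : Matrix A A ℕ) {x y : A → ℝ} (h : x ≤ y) : toEnd M x ≤ toEnd M y := by
  intro b
  rw [toEnd_apply, toEnd_apply]
  exact Finset.sum_le_sum fun a _ => mul_le_mul_of_nonneg_left (h a) (Nat.cast_nonneg _)

theorem toEnd_pos {M : Matrix A A ℕ} (hM : ∀ i j, 0 < M i j) {x : A → ℝ} (hx : 0 ≤ x)
    (hx0 : x ≠ 0) (b : A) : 0 < toEnd M x b := by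
  obtain ⟨a, ha⟩ := Function.ne_iff.1 hx0
  rw [toEnd_apply]
  refine Finset.sum_pos' (fun a _ => mul_nonneg (Nat.cast_nonneg _) (hx a))
    ⟨a, Finset.mem_univ _, mul_pos (Nat.cast_pos.2 (hM b a)) (lt_of_le_of_ne (hx a) ha.symm)⟩

/-- Iteration of the inequality `c y ≤ M y`. -/
theorem toEnd_growth {M : Matrix A A ℕ} {y : A → ℝ} {c : ℝ} (hc : 0 ≤ c)
    (h : c • y ≤ toEnd M y) (k : ℕ) : c ^ k • y ≤ (toEnd M ^ k) y := by
  induction k with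
  | zero => simp
  | succ k ih =>
    rw [pow_succ' (toEnd M), Module.End.mul_apply]
    refine le_trans ?_ (toEnd_mono M ih)
    rw [map_smul, pow_succ, mul_smul]
    intro a
    exact mul_le_mul_of_nonneg_left (h a) (by positivity)

/-- The growth of a vector that is killed by `q(M)` is bounded by the roots of `q`. -/
theorem tendsto_pow_apply_of_aeval {M : Matrix A A ℕ} {q : Polynomial ℝ} {r : ℝ} (hq : q.Monic)
    (hroots : ∀ z : ℂ, Polynomial.aeval z q = 0 → ‖z‖ < r) (hr0 : 0 < r) (y : A → ℝ)
    (hy : Polynomial.aeval (toEnd M) q y = 0) (a : A) :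
    Tendsto (fun k => |(toEnd M ^ k) y a| / r ^ k) atTop (𝓝 0) := by
  set T : Module.End ℂ (A → ℂ) := Matrix.toLin' (M.map (Nat.cast : ℕ → ℂ)) with hT
  have h0 : ∀ (y : A → ℝ) k, (T ^ k) (fun a => (y a : ℂ)) = fun a => ((toEnd M ^ k) y a : ℂ) := by
    intro y k
    induction k with
    | zero => simp
    | succ k ih =>
      rw [pow_succ', pow_succ', Module.End.mul_apply, Module.End.mul_apply, ih]
      ext b
      rw [toEnd_apply]
      simp [hT, Matrix.mulVec, dotProduct]
  have h2 : Polynomial.aeval T (q.map (algebraMap ℝ ℂ)) (fun a => (y a : ℂ)) =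
      fun a => (Polynomial.aeval (toEnd M) q y a : ℂ) := by
    ext a
    rw [Polynomial.aeval_map_algebraMap, Polynomial.aeval_eq_sum_range,
      Polynomial.aeval_eq_sum_range, LinearMap.sum_apply, LinearMap.sum_apply]
    simp [h0]
  have hmon := hq.map (algebraMap ℝ ℂ)
  have h1 := tendsto_pow_apply_of_prod T hr0 (q.map (algebraMap ℝ ℂ)).roots (fun a => (y a : ℂ))
    (fun z hz => hroots z (by
      have := Polynomial.isRoot_of_mem_roots hz
      rwa [Polynomial.IsRoot, Polynomial.eval_map_algebraMap] at this)) (by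
      rw [← (IsAlgClosed.splits _).eq_prod_roots_of_monic hmon, h2, hy]
      ext; simp)
  refine squeeze_zero (fun k => by positivity) (fun k => ?_) h1
  gcongr
  rw [h0]
  refine le_trans ?_ (norm_le_pi_norm _ a)
  simp

/-- A vector cannot grow faster than the spectral radius allows. -/
theorem tendsto_toEnd_pow_div {M : Matrix A A ℕ} {β r : ℝ}
    (hM : ∀ z ∈ spectrum ℂ (M.map (Nat.cast : ℕ → ℂ)), ‖z‖ ≤ β) (hr0 : 0 < r) (hr : β < r)
    (y : A → ℝ) (a : A) : Tendsto (fun k => |(toEnd M ^ k) y a| / r ^ k) atTop (𝓝 0) := by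
  refine tendsto_pow_apply_of_aeval (LinearMap.charpoly_monic (toEnd M)) (fun z hz => ?_) hr0 y
    (by rw [LinearMap.aeval_self_charpoly, LinearMap.zero_apply]) a
  refine lt_of_le_of_lt (hM z (Matrix.mem_spectrum_iff_isRoot_charpoly.2 ?_)) hr
  have h : (M.map (Nat.cast : ℕ → ℂ)) = (M.map (Nat.cast : ℕ → ℝ)).map (algebraMap ℝ ℂ) := by
    ext; simp
  rw [h, Matrix.charpoly_map, Polynomial.IsRoot, Polynomial.eval_map_algebraMap,
    ← Matrix.charpoly_toLin']
  exact hz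

/-- A nonnegative vector `x` with `β x ≤ M x`, where `β` is the spectral radius, is an eigenvector.
Otherwise the strict inequality, made uniform by a positive power of `M`, gives a vector that grows
faster than the spectral radius allows. -/
theorem toEnd_eq_of_smul_le {M : Matrix A A ℕ} {β : ℝ} (hβ : 0 < β)
    (hprim : IsPrimitiveMatrix M)
    (hM : ∀ z ∈ spectrum ℂ (M.map (Nat.cast : ℕ → ℂ)), ‖z‖ ≤ β) {x : A → ℝ} (hx : 0 ≤ x)
    (hx0 : x ≠ 0) (h : β • x ≤ toEnd M x) : toEnd M x = β • x := by
  obtain ⟨n, -, hn⟩ := hprim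
  by_contra hne
  have hz : 0 ≤ toEnd M x - β • x := sub_nonneg.2 h
  have hz0 : toEnd M x - β • x ≠ 0 := sub_ne_zero.2 hne
  set y := toEnd (M ^ n) x with hy
  have hypos : ∀ b, 0 < y b := toEnd_pos hn hx hx0
  have hgap : ∀ b, 0 < toEnd M y b - β * y b := by
    intro b
    have h1 := toEnd_pos hn hz hz0 b
    have h2 : toEnd (M ^ n) (toEnd M x) = toEnd M y := by
      rw [hy, ← toEnd_mul, ← toEnd_mul, pow_mul_comm']
    rw [map_sub, h2, map_smul] at h1
    simpa using h1
  obtain ⟨a, -⟩ := Function.ne_iff.1 hx0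
  -- the smallest relative gap of the strict inequality `β y < M y`
  obtain ⟨a₀, -, ha₀⟩ := Finset.exists_min_image Finset.univ
    (fun b => (toEnd M y b - β * y b) / y b) ⟨a, Finset.mem_univ _⟩
  set ε := (toEnd M y a₀ - β * y a₀) / y a₀ with hε
  have hεpos : 0 < ε := div_pos (hgap a₀) (hypos a₀)
  have h1 : (β + ε) • y ≤ toEnd M y := by
    intro b
    have := (le_div_iff₀ (hypos b)).1 (ha₀ b (Finset.mem_univ _))
    simp only [Pi.smul_apply, smul_eq_mul]
    linarith
  have h2 := tendsto_toEnd_pow_div hM (r := β + ε) (by positivity) (by linarith) y a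
  have h3 : ∀ k, y a ≤ |(toEnd M ^ k) y a| / (β + ε) ^ k := by
    intro k
    rw [le_div_iff₀ (by positivity)]
    refine le_trans ?_ (le_abs_self _)
    have := toEnd_growth (by positivity) h1 k a
    simpa [mul_comm] using this
  exact absurd (ge_of_tendsto' h2 h3) (not_le.2 (hypos a))

theorem IsPrimitiveMatrix.transpose {M : Matrix A A ℕ} (h : IsPrimitiveMatrix M) :
    IsPrimitiveMatrix M.transpose := by
  obtain ⟨n, h1, hn⟩ := h
  exact ⟨n, h1, fun i j => by rw [← Matrix.transpose_pow]; exact hn j i⟩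

/-- A left eigenvector with positive entries, for a given eigenvalue. -/
def IsLeftPerron (M : Matrix A A ℕ) (β : ℝ) (l : A → ℝ) : Prop :=
  (∀ a, 0 < l a) ∧ ∀ a, ∑ b, l b * (M b a : ℝ) = β * l a

theorem abs_toEnd_le (M : Matrix A A ℕ) (x : A → ℝ) (b : A) : |toEnd M x b| ≤ toEnd M |x| b := by
  rw [toEnd_apply, toEnd_apply]
  refine (Finset.abs_sum_le_sum_abs _ _).trans (Finset.sum_le_sum fun a _ => ?_)
  rw [abs_mul, Nat.abs_cast, Pi.abs_apply]

/-- A nonnegative eigenvector of a primitive matrix is positive. -/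
theorem pos_of_nonneg_eigenvector {M : Matrix A A ℕ} (hprim : IsPrimitiveMatrix M) {β : ℝ}
    (hβ : 0 < β) {x : A → ℝ} (hx : 0 ≤ x) (hx0 : x ≠ 0) (h : toEnd M x = β • x) (b : A) :
    0 < x b := by
  obtain ⟨n, -, hn⟩ := hprim
  have h1 : ∀ k, (toEnd M ^ k) x = β ^ k • x := by
    intro k
    induction k with
    | zero => simp
    | succ k ih => rw [pow_succ', Module.End.mul_apply, ih, map_smul, h, smul_smul, pow_succ]
  have h2 := toEnd_pos hn hx hx0 b
  rw [toEnd_pow, h1] at h2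
  exact pos_of_mul_pos_right h2 (by positivity)

/-- The left Perron eigenvector is `|v|`, where `v` is any left eigenvector for `β`. -/
theorem exists_isLeftPerron {M : Matrix A A ℕ} {β : ℝ} (hβ0 : 0 < β) (hprim : IsPrimitiveMatrix M)
    (hβ : IsPerronEigenvalue M β) : ∃ l, IsLeftPerron M β l := by
  obtain ⟨x, hx⟩ := hβ.1.exists_hasEigenvector
  have h1 : (M.map (Nat.cast : ℕ → ℝ) - β • 1).mulVec x = 0 := by
    have := hx.apply_eq_smul
    rw [Matrix.toLin'_apply] at this
    rw [Matrix.sub_mulVec, this, Matrix.smul_mulVec, Matrix.one_mulVec, sub_self]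
  have h2 := Matrix.exists_mulVec_eq_zero_iff.1 ⟨x, hx.2, h1⟩
  obtain ⟨v, hv0, hv⟩ := Matrix.exists_vecMul_eq_zero_iff.2 h2
  have hv1 : toEnd M.transpose v = β • v := by
    rw [Matrix.vecMul_sub, sub_eq_zero, Matrix.vecMul_smul, Matrix.vecMul_one] at hv
    rw [← hv, ← Matrix.mulVec_transpose]
    rfl
  have hM : ∀ z ∈ spectrum ℂ (M.transpose.map (Nat.cast : ℕ → ℂ)), ‖z‖ ≤ β := by
    intro z hz
    refine hβ.2 z ?_
    rw [Matrix.mem_spectrum_iff_isRoot_charpoly] at hz ⊢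
    rwa [Matrix.transpose_map, Matrix.charpoly_transpose] at hz
  have hv2 : |v| ≠ 0 := by simpa using hv0
  have h3 : toEnd M.transpose |v| = β • |v| := by
    refine toEnd_eq_of_smul_le hβ0 hprim.transpose hM (abs_nonneg v) hv2 fun b => ?_
    have := abs_toEnd_le M.transpose v b
    rw [hv1] at this
    simpa [abs_mul, abs_of_pos hβ0] using this
  refine ⟨|v|, pos_of_nonneg_eigenvector hprim.transpose hβ0 (abs_nonneg v) hv2 h3, fun a => ?_⟩
  have := congrFun h3 a
  rw [toEnd_apply] at this
  simpa [mul_comm] using this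

namespace IsLeftPerron
variable {M : Matrix A A ℕ} {β : ℝ} {l : A → ℝ}

theorem sum_mul_toEnd (hl : IsLeftPerron M β l) (x : A → ℝ) :
    ∑ b, l b * toEnd M x b = β * ∑ a, l a * x a := by
  simp_rw [toEnd_apply, Finset.mul_sum]
  rw [Finset.sum_comm]
  refine Finset.sum_congr rfl fun a _ => ?_
  rw [← mul_assoc, ← hl.2 a, Finset.sum_mul]
  exact Finset.sum_congr rfl fun b _ => by ring

theorem pow (hl : IsLeftPerron M β l) (k : ℕ) : IsLeftPerron (M ^ k) (β ^ k) l := by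
  refine ⟨hl.1, ?_⟩
  induction k with
  | zero => intro a; simp [Matrix.one_apply]
  | succ k ih =>
    intro a
    simp_rw [pow_succ, Matrix.mul_apply, Nat.cast_sum, Finset.mul_sum]
    rw [Finset.sum_comm]
    push_cast
    simp_rw [← mul_assoc, ← Finset.sum_mul, ih]
    rw [mul_assoc, ← hl.2 a, Finset.mul_sum]
    exact Finset.sum_congr rfl fun b _ => by ring

/-- A vector `x` with `β x ≤ M x` is an eigenvector: pair the inequality with the left eigenvector. -/
theorem eq_of_le (hl : IsLeftPerron M β l) {x : A → ℝ} (h : β • x ≤ toEnd M x) :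
    toEnd M x = β • x := by
  have h1 : ∑ b, l b * (toEnd M x b - β * x b) = 0 := by
    simp_rw [mul_sub, Finset.sum_sub_distrib]
    rw [hl.sum_mul_toEnd, Finset.mul_sum, sub_eq_zero]
    exact Finset.sum_congr rfl fun b _ => by ring
  ext b
  have h2 := (Finset.sum_eq_zero_iff_of_nonneg fun b _ =>
    mul_nonneg (hl.1 b).le (sub_nonneg.2 (h b))).1 h1 b (Finset.mem_univ b)
  have h3 := (mul_eq_zero.1 h2).resolve_left (hl.1 b).ne'
  simpa using sub_eq_zero.1 h3

/-- An eigenvector for the Perron eigenvalue does not pair to `0` with the left eigenvector. -/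
theorem eq_zero_of_eigenvector (hl : IsLeftPerron M β l) (hβ : 0 < β) (hprim : IsPrimitiveMatrix M)
    {z : A → ℝ} (hz : toEnd M z = β • z) (h0 : ∑ a, l a * z a = 0) : z = 0 := by
  have habs : toEnd M |z| = β • |z| := by
    refine hl.eq_of_le fun b => ?_
    have := abs_toEnd_le M z b
    rw [hz] at this
    simpa [abs_mul, abs_of_pos hβ] using this
  -- the eigenvector `|y| + y` is nonnegative, so it vanishes or is positive
  have key : ∀ y : A → ℝ, toEnd M y = β • y → toEnd M |y| = β • |y| → ∑ a, l a * y a = 0 →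
      ∀ a, y a ≤ 0 := by
    intro y hy hy' hy0 a
    by_contra ha
    rw [not_le] at ha
    have h1 : ∀ b, 0 < (|y| + y) b := by
      refine pos_of_nonneg_eigenvector hprim hβ (fun b => ?_) (fun h => ?_)
        (by rw [map_add, hy, hy', smul_add])
      · have := neg_abs_le (y b)
        simp only [Pi.add_apply, Pi.abs_apply, Pi.zero_apply]; linarith
      · have h2 := congrFun h a
        simp only [Pi.add_apply, Pi.abs_apply, Pi.zero_apply] at h2
        have := abs_nonneg (y a)
        linarith
    have h2 : ∀ b, 0 < y b := by
      intro b
      by_contra hb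
      have h3 := h1 b
      simp only [Pi.add_apply, Pi.abs_apply, abs_of_nonpos (not_lt.1 hb)] at h3
      linarith
    have h3 : 0 < ∑ b, l b * y b :=
      Finset.sum_pos (fun b _ => mul_pos (hl.1 b) (h2 b)) ⟨a, Finset.mem_univ _⟩
    exact h3.ne' hy0
  ext a
  refine le_antisymm (key z hz habs h0 a) ?_
  have := key (-z) (by rw [map_neg, hz, smul_neg]) (by rwa [abs_neg]) (by simpa using h0) a
  simpa using this

/-- The powers of the transposed matrix, rescaled, converge to a projection onto the line of the
left Perron vector. After division by `l` the matrix becomes stochastic, and a positive power of it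
contracts the oscillation of a vector. -/
theorem exists_tendsto (hl : IsLeftPerron M β l) (hβ : 0 < β) (hprim : IsPrimitiveMatrix M)
    (x : A → ℝ) : ∃ c, ∀ a,
      Tendsto (fun j => (∑ b, ((M ^ j) b a : ℝ) * x b) / β ^ j) atTop (𝓝 (c * l a)) := by
  rcases isEmpty_or_nonempty A with hA | ⟨⟨a₀⟩⟩
  · exact ⟨0, fun a => (hA.false a).elim⟩
  obtain ⟨n, hn1, hn⟩ := hprim
  set z : ℕ → A → ℝ := fun j a => (∑ b, ((M ^ j) b a : ℝ) * x b) / (β ^ j * l a) with hz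
  -- the entries of the stochastic matrix
  set p : ℕ → A → A → ℝ := fun k a b => ((M ^ k) b a : ℝ) * l b / (β ^ k * l a) with hp
  have hp0 : ∀ k a b, 0 ≤ p k a b := fun k a b =>
    div_nonneg (mul_nonneg (Nat.cast_nonneg _) (hl.1 b).le)
      (mul_nonneg (by positivity) (hl.1 a).le)
  have hp1 : ∀ k a, ∑ b, p k a b = 1 := by
    intro k a
    simp only [hp]
    rw [← Finset.sum_div, div_eq_one_iff_eq (mul_pos (by positivity) (hl.1 a)).ne',
      ← (hl.pow k).2 a]
    exact Finset.sum_congr rfl fun b _ => by ring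
  have hstep : ∀ j k a, z (j + k) a = ∑ b, p k a b * z j b := by
    intro j k a
    simp only [hz, hp]
    rw [div_eq_iff (mul_pos (by positivity) (hl.1 a)).ne', Finset.sum_mul]
    simp_rw [pow_add, Matrix.mul_apply, Nat.cast_sum, Finset.sum_mul]
    rw [Finset.sum_comm]
    refine Finset.sum_congr rfl fun b _ => ?_
    have h1 := (hl.1 a).ne'
    have h2 := (hl.1 b).ne'
    field_simp
    rw [Finset.mul_sum]
    exact Finset.sum_congr rfl fun c _ => by push_cast; ring
  obtain ⟨q, -, hq⟩ := Finset.exists_min_image (Finset.univ : Finset (A × A))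
    (fun q => p n q.1 q.2) ⟨(a₀, a₀), Finset.mem_univ _⟩
  set δ := p n q.1 q.2
  have hδ : 0 < δ := div_pos (mul_pos (Nat.cast_pos.2 (hn _ _)) (hl.1 _))
    (mul_pos (by positivity) (hl.1 _))
  have hδ1 : δ ≤ 1 := by
    rw [← hp1 n q.1]
    exact Finset.single_le_sum (f := fun b => p n q.1 b) (fun b _ => hp0 _ _ _)
      (Finset.mem_univ q.2)
  have havg : ∀ j k lo hi, (∀ a, lo ≤ z j a ∧ z j a ≤ hi) →
      ∀ a, lo ≤ z (j + k) a ∧ z (j + k) a ≤ hi := by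
    intro j k lo hi h a
    rw [hstep]
    constructor
    · calc lo = ∑ b, p k a b * lo := by rw [← Finset.sum_mul, hp1, one_mul]
        _ ≤ _ := Finset.sum_le_sum fun b _ => mul_le_mul_of_nonneg_left (h b).1 (hp0 _ _ _)
    · calc _ ≤ ∑ b, p k a b * hi :=
          Finset.sum_le_sum fun b _ => mul_le_mul_of_nonneg_left (h b).2 (hp0 _ _ _)
        _ = hi := by rw [← Finset.sum_mul, hp1, one_mul]
  -- `n` steps shrink the range of the values, as every average gives `a₀` at least the weight `δ`
  have hcontr : ∀ j lo hi, (∀ a, lo ≤ z j a ∧ z j a ≤ hi) →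
      ∃ lo' hi', hi' - lo' ≤ (1 - δ) * (hi - lo) ∧
        ∀ a, lo' ≤ z (j + n) a ∧ z (j + n) a ≤ hi' := by
    intro j lo hi h
    refine ⟨lo + δ * (z j a₀ - lo), hi - δ * (hi - z j a₀), by linarith, fun a => ?_⟩
    have hδa : δ ≤ p n a a₀ := hq (a, a₀) (Finset.mem_univ _)
    rw [hstep]
    constructor
    · have h1 : p n a a₀ * (z j a₀ - lo) ≤ ∑ b, p n a b * (z j b - lo) :=
        Finset.single_le_sum (f := fun b => p n a b * (z j b - lo))
          (fun b _ => mul_nonneg (hp0 _ _ _) (sub_nonneg.2 (h b).1)) (Finset.mem_univ a₀)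
      have h2 : ∑ b, p n a b * (z j b - lo) = (∑ b, p n a b * z j b) - lo := by
        simp_rw [mul_sub]
        rw [Finset.sum_sub_distrib, ← Finset.sum_mul, hp1, one_mul]
      have h3 := mul_le_mul_of_nonneg_right hδa (sub_nonneg.2 (h a₀).1)
      linarith
    · have h1 : p n a a₀ * (hi - z j a₀) ≤ ∑ b, p n a b * (hi - z j b) :=
        Finset.single_le_sum (f := fun b => p n a b * (hi - z j b))
          (fun b _ => mul_nonneg (hp0 _ _ _) (sub_nonneg.2 (h b).2)) (Finset.mem_univ a₀)
      have h2 : ∑ b, p n a b * (hi - z j b) = hi - (∑ b, p n a b * z j b) := by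
        simp_rw [mul_sub]
        rw [Finset.sum_sub_distrib, ← Finset.sum_mul, hp1, one_mul]
      have h3 := mul_le_mul_of_nonneg_right hδa (sub_nonneg.2 (h a₀).2)
      linarith
  obtain ⟨K, hK⟩ : ∃ K, ∀ a, -K ≤ z 0 a ∧ z 0 a ≤ K := by
    refine ⟨∑ a, |z 0 a|, fun a => abs_le.1 ?_⟩
    exact Finset.single_le_sum (f := fun a => |z 0 a|) (fun _ _ => abs_nonneg _)
      (Finset.mem_univ a)
  have hiter : ∀ i : ℕ, ∃ lo hi, hi - lo ≤ (1 - δ) ^ i * (K - -K) ∧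
      ∀ a, lo ≤ z (i * n) a ∧ z (i * n) a ≤ hi := by
    intro i
    induction i with
    | zero => exact ⟨-K, K, by simp, by simpa using hK⟩
    | succ i ih =>
      obtain ⟨lo, hi, h1, h2⟩ := ih
      obtain ⟨lo', hi', h3, h4⟩ := hcontr _ _ _ h2
      refine ⟨lo', hi', h3.trans ?_, by rwa [Nat.succ_mul]⟩
      rw [pow_succ', mul_assoc]
      exact mul_le_mul_of_nonneg_left h1 (by linarith)
  have hclose : ∀ ε > 0, ∃ N lo, ∀ j ≥ N, ∀ a, |z j a - lo| ≤ ε := by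
    intro ε hε
    have ht : Tendsto (fun i : ℕ => (1 - δ) ^ i * (K - -K)) atTop (𝓝 0) := by
      simpa using (tendsto_pow_atTop_nhds_zero_of_lt_one (r := 1 - δ) (by linarith)
        (by linarith)).mul_const (K - -K)
    obtain ⟨i, hi⟩ := (ht.eventually (gt_mem_nhds hε)).exists
    obtain ⟨lo, hi', h1, h2⟩ := hiter i
    refine ⟨i * n, lo, fun j hj a => ?_⟩
    obtain ⟨k, rfl⟩ := Nat.exists_eq_add_of_le hj
    have := havg _ k _ _ h2 a
    rw [abs_le]
    constructor <;> linarith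
  have hcau : CauchySeq fun j => z j a₀ := by
    rw [Metric.cauchySeq_iff']
    intro ε hε
    obtain ⟨N, lo, h⟩ := hclose (ε / 3) (by positivity)
    refine ⟨N, fun j hj => ?_⟩
    have h1 := abs_le.1 (h j hj a₀)
    have h2 := abs_le.1 (h N le_rfl a₀)
    rw [Real.dist_eq, abs_lt]
    constructor <;> linarith
  obtain ⟨c, hc⟩ := cauchySeq_tendsto_of_complete hcau
  refine ⟨c, fun a => ?_⟩
  have hza : Tendsto (fun j => z j a) atTop (𝓝 c) := by
    rw [Metric.tendsto_atTop] at hc ⊢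
    intro ε hε
    obtain ⟨N, lo, h⟩ := hclose (ε / 4) (by positivity)
    obtain ⟨N', h'⟩ := hc (ε / 4) (by positivity)
    refine ⟨max N N', fun j hj => ?_⟩
    have h1 := abs_le.1 (h j (le_of_max_le_left hj) a)
    have h2 := abs_le.1 (h j (le_of_max_le_left hj) a₀)
    have h3 := abs_lt.1 (h' j (le_of_max_le_right hj))
    rw [Real.dist_eq, abs_lt]
    constructor <;> linarith
  refine (hza.mul_const (l a)).congr fun j => ?_
  simp only [hz]
  have := (hl.1 a).ne'
  field_simp

end IsLeftPerron
end Perron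

/-! ### The contracting projection -/

/-- A linear map that vanishes on the kernel of `f` factors through `f`. -/
theorem exists_linearMap_comp_eq {K X Y Z : Type*} [Field K] [AddCommGroup X] [Module K X]
    [AddCommGroup Y] [Module K Y] [AddCommGroup Z] [Module K Z] (f : X →ₗ[K] Y) (g : X →ₗ[K] Z)
    (h : ∀ x, f x = 0 → g x = 0) : ∃ k : Y →ₗ[K] Z, ∀ x, k (f x) = g x := by
  obtain ⟨s, hs⟩ := f.rangeRestrict.exists_rightInverse_of_surjective f.range_rangeRestrict
  obtain ⟨k, hk⟩ := LinearMap.exists_extend (g ∘ₗ s)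
  refine ⟨k, fun x => ?_⟩
  have h1 := LinearMap.congr_fun hk (f.rangeRestrict x)
  have h2 := LinearMap.congr_fun hs (f.rangeRestrict x)
  have h3 : g (s (f.rangeRestrict x) - x) = 0 := by
    refine h _ ?_
    rw [map_sub, sub_eq_zero]
    exact congrArg Subtype.val h2
  rw [map_sub, sub_eq_zero] at h3
  rw [← h3]
  exact h1

/-- A linear map that restricts to a surjection of a lattice has determinant `±1`. -/
theorem abs_det_eq_one_of_lattice {E : Type*} [NormedAddCommGroup E] [NormedSpace ℝ E]
    [FiniteDimensional ℝ E] (L : Submodule ℤ E) [DiscreteTopology L] [IsZLattice ℝ L]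
    (G : E →ₗ[ℝ] E) (h1 : ∀ x ∈ L, G x ∈ L) (h2 : ∀ x ∈ L, ∃ y ∈ L, G y = x) :
    |LinearMap.det G| = 1 := by
  have := ZLattice.module_free ℝ L
  have := ZLattice.module_finite ℝ L
  set f : L →ₗ[ℤ] L := (G.restrictScalars ℤ).restrict h1 with hf
  have hsurj : Function.Surjective f := by
    rintro ⟨x, hx⟩
    obtain ⟨y, hy, rfl⟩ := h2 x hx
    exact ⟨⟨y, hy⟩, rfl⟩
  have hunit : IsUnit f := (Module.End.isUnit_iff f).2
    ⟨IsNoetherian.injective_of_surjective_endomorphism f hsurj, hsurj⟩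
  have hdet := LinearMap.isUnit_det f hunit
  let b := Module.Free.chooseBasis ℤ L
  have hmat : LinearMap.toMatrix (b.ofZLatticeBasis ℝ L) (b.ofZLatticeBasis ℝ L) G =
      (LinearMap.toMatrix b b f).map (Int.castRingHom ℝ) := by
    ext i j
    rw [LinearMap.toMatrix_apply, Matrix.map_apply, LinearMap.toMatrix_apply,
      Module.Basis.ofZLatticeBasis_apply]
    exact b.ofZLatticeBasis_repr_apply ℝ L (f (b j)) i
  rw [← LinearMap.det_toMatrix (b.ofZLatticeBasis ℝ L), hmat, ← RingHom.mapMatrix_apply,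
    ← RingHom.map_det, LinearMap.det_toMatrix]
  rcases Int.isUnit_iff.1 hdet with h | h <;> simp [h]

section
variable {A : Type*} [Fintype A] [DecidableEq A]

/-- The group of the vectors with integer entries. -/
def intVec (A : Type*) : AddSubgroup (A → ℝ) where
  carrier := {x | ∃ n : A → ℤ, x = fun a => (n a : ℝ)}
  add_mem' := by
    rintro _ _ ⟨m, rfl⟩ ⟨n, rfl⟩
    exact ⟨m + n, by ext; simp⟩
  zero_mem' := ⟨0, by ext; simp⟩
  neg_mem' := by
    rintro _ ⟨m, rfl⟩
    exact ⟨-m, by ext; simp⟩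

theorem toEnd_mem_intVec (M : Matrix A A ℕ) {x : A → ℝ} (hx : x ∈ intVec A) :
    toEnd M x ∈ intVec A := by
  obtain ⟨n, rfl⟩ := hx
  exact ⟨fun b => ∑ a, (M b a : ℤ) * n a, by ext b; rw [toEnd_apply]; push_cast; rfl⟩

theorem aeval_mem_intVec (M : Matrix A A ℕ) (p : Polynomial ℤ) {x : A → ℝ} (hx : x ∈ intVec A) :
    Polynomial.aeval (toEnd M) p x ∈ intVec A := by
  induction p using Polynomial.induction_on' with
  | add p q hp hq =>
    rw [map_add, LinearMap.add_apply]
    exact add_mem hp hq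
  | monomial n c =>
    rw [Polynomial.aeval_monomial, Module.End.mul_apply, Module.algebraMap_end_apply]
    refine zsmul_mem ?_ c
    induction n with
    | zero => simpa using hx
    | succ n ih =>
      rw [pow_succ', Module.End.mul_apply]
      exact toEnd_mem_intVec M ih

omit [DecidableEq A] in
theorem finite_intVec_bounded (r : ℝ) : {x : A → ℝ | x ∈ intVec A ∧ ∀ a, |x a| ≤ r}.Finite := by
  have hf : (Set.univ.pi fun _ : A => Set.Icc (-⌈r⌉) ⌈r⌉).Finite :=
    Set.Finite.pi fun _ => Set.finite_Icc _ _
  refine (hf.image fun (n : A → ℤ) a => (n a : ℝ)).subset ?_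
  rintro _ ⟨⟨n, rfl⟩, hr⟩
  refine ⟨n, fun a _ => ?_, rfl⟩
  have h1 : ((|n a| : ℤ) : ℝ) ≤ (⌈r⌉ : ℤ) := by
    push_cast; exact (hr a).trans (Int.le_ceil r)
  exact abs_le.1 (Int.cast_le.1 h1)

/-- What is needed of the projection `V` of `ℝ^A` onto the contracting space: it intertwines the
incidence matrix with a map `N`, the powers of `N` tend to `0`, the determinant of `N` is `±β⁻¹`,
and those images of integer vectors that lie close to the kernel of the left eigenvector `l` form
a locally finite set. -/
structure IsContractingProjection {F : Type*} [NormedAddCommGroup F] [NormedSpace ℝ F]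
    (M : Matrix A A ℕ) (β : ℝ) (l : A → ℝ) (V : (A → ℝ) →ₗ[ℝ] F) (N : F →ₗ[ℝ] F) : Prop where
  surjective : Function.Surjective V
  comm : ∀ x, N (V x) = V (toEnd M x)
  decay : ∀ y, Tendsto (fun k => (N ^ k) y) atTop (𝓝 0)
  det : |LinearMap.det N| * β = 1
  finite : ∀ r, {y | ∃ x ∈ intVec A, y = V x ∧ ‖V x‖ ≤ r ∧ |∑ a, l a * x a| ≤ r}.Finite

variable {M : Matrix A A ℕ} {β : ℝ} {l : A → ℝ}

/-- The Perron eigenvalue is a simple root of the characteristic polynomial: by the pairing with the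
left eigenvector its generalized eigenspace is a line. -/
theorem eval_ne_zero_of_charpoly_eq (hl : IsLeftPerron M β l) (hβ0 : 0 < β)
    (hprim : IsPrimitiveMatrix M) (hβ : Module.End.HasEigenvalue (toEnd M) β)
    {p q : Polynomial ℝ} (hpq : (toEnd M).charpoly = (Polynomial.X - Polynomial.C β) * q * p) :
    p.eval β ≠ 0 := by
  intro hp
  obtain ⟨r, hr⟩ := hβ.exists_hasEigenvector
  have hr1 : toEnd M r = β • r := hr.apply_eq_smul
  have hr0 : ∑ a, l a * r a ≠ 0 := fun h => hr.2 (hl.eq_zero_of_eigenvector hβ0 hprim hr1 h)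
  have h1 : ∀ k : ℕ, ∀ z, ((toEnd M - β • 1) ^ k) z = 0 → toEnd M z = β • z := by
    intro k
    induction k with
    | zero => intro z hz; simp only [pow_zero, Module.End.one_apply] at hz; simp [hz]
    | succ k ih =>
      intro z hz
      rw [pow_succ, Module.End.mul_apply] at hz
      have h2 := ih _ hz
      have h3 := hl.eq_zero_of_eigenvector hβ0 hprim h2 (by
        have := hl.sum_mul_toEnd z
        simp only [LinearMap.sub_apply, Pi.sub_apply, mul_sub, Finset.sum_sub_distrib, this]
        rw [Finset.mul_sum, sub_eq_zero]
        exact Finset.sum_congr rfl fun b _ => by simp; ring)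
      exact sub_eq_zero.1 h3
  have h2 : Module.End.maxGenEigenspace (toEnd M) β ≤ Submodule.span ℝ {r} := by
    intro z hz
    obtain ⟨k, hk⟩ := (Module.End.mem_maxGenEigenspace _ _ _).1 hz
    have hz1 := h1 k z hk
    rw [Submodule.mem_span_singleton]
    refine ⟨(∑ a, l a * z a) / ∑ a, l a * r a, ?_⟩
    symm
    rw [← sub_eq_zero]
    refine hl.eq_zero_of_eigenvector hβ0 hprim ?_ ?_
    · rw [map_sub, map_smul, hz1, hr1, smul_sub, smul_comm]
    · simp only [Pi.sub_apply, mul_sub, Finset.sum_sub_distrib, Pi.smul_apply, smul_eq_mul]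
      rw [sub_eq_zero]
      simp_rw [mul_left_comm (l _)]
      rw [← Finset.mul_sum, div_mul_cancel₀ _ hr0]
  have h3 : Module.finrank ℝ (Module.End.maxGenEigenspace (toEnd M) β) ≤ 1 :=
    (Submodule.finrank_mono h2).trans (finrank_span_singleton hr.2).le
  rw [LinearMap.finrank_maxGenEigenspace_eq] at h3
  have h4 : 2 ≤ (toEnd M).charpoly.rootMultiplicity β := by
    rw [Polynomial.le_rootMultiplicity_iff (LinearMap.charpoly_monic _).ne_zero, hpq, pow_two]
    obtain ⟨s, hs⟩ := Polynomial.dvd_iff_isRoot.2 hp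
    exact ⟨q * s, by rw [hs]; ring⟩
  omega

/-- The projection along `ker ((M - β) P(M))` is a projection onto the contracting space. The
determinant and the local finiteness come from the lattice that the integer vectors span under
`x ↦ (V x, l · x)`, a map with the kernel `ker P(M)`. -/
theorem exists_isContractingProjection {F : Type*} [NormedAddCommGroup F] [NormedSpace ℝ F]
    [FiniteDimensional ℝ F] {P : Polynomial ℤ} {V : (A → ℝ) →ₗ[ℝ] F}
    (hprim : IsPrimitiveMatrix M) (hβ : IsPerronEigenvalue M β) (hpisot : IsUnitPisot β)
    (hP : (M.map (Nat.cast : ℕ → ℚ)).charpoly = minpoly ℚ β * P.map (Int.castRingHom ℚ))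
    (hV : IsProjectionAlong V (projKernel M β P)) (hl : IsLeftPerron M β l) :
    ∃ N : F →ₗ[ℝ] F, IsContractingProjection M β l V N := by
  classical
  have hβ1 : 1 < β := hpisot.1.2.1
  have hβ0 : 0 < β := by linarith
  have hint : IsIntegral ℤ β := hpisot.1.1
  set T := toEnd M with hT
  -- the polynomials with real coefficients
  set m := minpoly ℤ β
  have hm : minpoly ℚ β = m.map (algebraMap ℤ ℚ) :=
    minpoly.isIntegrallyClosed_eq_field_fractions' ℚ hint
  set pi : Polynomial ℝ := m.map (Int.castRingHom ℝ) with hpi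
  have hpiQ : (minpoly ℚ β).map (algebraMap ℚ ℝ) = pi := by
    rw [hm, Polynomial.map_map, hpi]
    congr 1
  set p : Polynomial ℝ := P.map (Int.castRingHom ℝ) with hp
  have hpQ : (P.map (Int.castRingHom ℚ)).map (algebraMap ℚ ℝ) = p := by
    rw [Polynomial.map_map, hp]
    congr 1
  have hchar : T.charpoly = pi * p := by
    rw [hT, toEnd, Matrix.charpoly_toLin', ← hpiQ, ← hpQ, ← Polynomial.map_mul, ← hP,
      ← Matrix.charpoly_map]
    congr 1
  have hpiroot : pi.IsRoot β := by
    rw [Polynomial.IsRoot, ← hpiQ, Polynomial.eval_map_algebraMap, minpoly.aeval]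
  have hpimonic : pi.Monic := by
    rw [hpi]; exact (minpoly.monic hint).map _
  set q := pi /ₘ (Polynomial.X - Polynomial.C β) with hq
  have hfac : (Polynomial.X - Polynomial.C β) * q = pi :=
    Polynomial.mul_divByMonic_eq_iff_isRoot.2 hpiroot
  have hqmonic : q.Monic := Polynomial.Monic.of_mul_monic_left (Polynomial.monic_X_sub_C β)
    (by rw [hfac]; exact hpimonic)
  have hsep : pi.Separable := by
    rw [← hpiQ]
    exact (minpoly.irreducible (hint.tower_top (A := ℚ))).separable.map
  have hqroots : ∀ z : ℂ, Polynomial.aeval z q = 0 → ‖z‖ < 1 := by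
    intro z hz
    refine hpisot.1.2.2 z ?_ ?_
    · rw [← Polynomial.aeval_map_algebraMap ℝ, hpiQ, ← hfac, map_mul, hz, mul_zero]
    · rintro rfl
      have h1 : q.IsRoot β := by
        have : Polynomial.aeval (algebraMap ℝ ℂ β) q = 0 := hz
        rw [Polynomial.aeval_algebraMap_apply] at this
        simpa using this
      obtain ⟨s, hs⟩ := Polynomial.dvd_iff_isRoot.2 h1
      have h2 : (Polynomial.X - Polynomial.C β) * (Polynomial.X - Polynomial.C β) ∣ pi :=
        ⟨s, by rw [← hfac, hs, mul_assoc]⟩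
      exact Polynomial.not_isUnit_X_sub_C β (hsep.squarefree _ h2)
  have hpβ : p.eval β ≠ 0 :=
    eval_ne_zero_of_charpoly_eq hl hβ0 hprim hβ.1 (p := p) (q := q) (by rw [hfac, ← hchar])
  have hmul : ∀ (f g : Polynomial ℝ) x,
      Polynomial.aeval T (f * g) x = Polynomial.aeval T f (Polynomial.aeval T g x) := by
    intro f g x; rw [map_mul, Module.End.mul_apply]
  have hX : ∀ x, Polynomial.aeval T (Polynomial.X - Polynomial.C β) x = T x - β • x := by
    intro x; simp [Algebra.algebraMap_eq_smul_one]
  have hcomm : ∀ (f : Polynomial ℝ) x,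
      Polynomial.aeval T f (T x) = T (Polynomial.aeval T f x) := by
    intro f x
    have h1 := hmul f Polynomial.X x
    have h2 := hmul Polynomial.X f x
    rw [mul_comm] at h1
    rw [h1, Polynomial.aeval_X] at h2
    exact h2
  have hcommk : ∀ (f : Polynomial ℝ) (k : ℕ) x,
      Polynomial.aeval T f ((T ^ k) x) = (T ^ k) (Polynomial.aeval T f x) := by
    intro f k x
    induction k with
    | zero => simp
    | succ k ih => rw [pow_succ', Module.End.mul_apply, hcomm, ih, Module.End.mul_apply]
  -- the kernel of `V`
  set Q : Polynomial ℝ := (Polynomial.X - Polynomial.C β) * p with hQ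
  have hker : ∀ x, V x = 0 ↔ Polynomial.aeval T Q x = 0 := by
    intro x
    have h1 : Matrix.toLin' (Polynomial.aeval (M.map (Nat.cast : ℕ → ℝ)) P) =
        Polynomial.aeval T p := by
      have h2 := Polynomial.aeval_algHom_apply (Matrix.toLinAlgEquiv' (R := ℝ) (n := A)).toAlgHom
        (M.map (Nat.cast : ℕ → ℝ)) p
      have h3 : Polynomial.aeval (M.map (Nat.cast : ℕ → ℝ)) p =
          Polynomial.aeval (M.map (Nat.cast : ℕ → ℝ)) P := by
        rw [hp]; exact Polynomial.aeval_map_algebraMap ℝ _ P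
      rw [h3] at h2
      exact h2.symm
    rw [← LinearMap.mem_ker, hV.1, projKernel, LinearMap.mem_ker, Matrix.toLin'_mul,
      LinearMap.comp_apply, h1, hQ, hmul, hX, map_sub, map_smul, Matrix.toLin'_one]
    rfl
  -- integer polynomials
  have hZ : ∀ (f : Polynomial ℤ), Polynomial.aeval T (f.map (Int.castRingHom ℝ)) =
      Polynomial.aeval T f := fun f => Polynomial.aeval_map_algebraMap ℝ T f
  have hpint : ∀ x ∈ intVec A, Polynomial.aeval T p x ∈ intVec A := by
    intro x hx; rw [hp, hZ]; exact aeval_mem_intVec M P hx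
  have hsurj : Function.Surjective V := by
    rw [← LinearMap.range_eq_top]
    apply Submodule.eq_top_of_finrank_eq
    have h1 := LinearMap.finrank_range_add_finrank_ker V
    have h2 := hV.2
    rw [← hV.1] at h2
    omega
  obtain ⟨N, hN⟩ := exists_linearMap_comp_eq V (V ∘ₗ T) fun x hx => by
    rw [LinearMap.comp_apply, hker, hcomm, (hker x).1 hx, map_zero]
  have hN' : ∀ x, N (V x) = V (T x) := hN
  have hNk : ∀ (k : ℕ) x, (N ^ k) (V x) = V ((T ^ k) x) := by
    intro k x
    induction k with
    | zero => simp
    | succ k ih => rw [pow_succ', pow_succ', Module.End.mul_apply, Module.End.mul_apply, ih, hN']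
  -- the projection along the kernel of `p(T)`, with the expanding coordinate added
  set L : (A → ℝ) →ₗ[ℝ] ℝ := ∑ a, l a • LinearMap.proj a with hL
  have hLapp : ∀ x, L x = ∑ a, l a * x a := by intro x; simp [hL]
  have hLT : ∀ x, L (T x) = β * L x := by
    intro x; rw [hLapp, hLapp]; exact hl.sum_mul_toEnd x
  have hLaeval : ∀ (f : Polynomial ℝ) x, L (Polynomial.aeval T f x) = f.eval β * L x := by
    intro f x
    induction f using Polynomial.induction_on' with
    | add f g hf hg => rw [map_add, LinearMap.add_apply, map_add, hf, hg, Polynomial.eval_add]; ring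
    | monomial n c =>
      have h1 : L ((T ^ n) x) = β ^ n * L x := by
        induction n with
        | zero => simp
        | succ n ih => rw [pow_succ', Module.End.mul_apply, hLT, ih]; ring
      rw [Polynomial.aeval_monomial, Module.End.mul_apply, Module.algebraMap_end_apply, map_smul,
        h1, Polynomial.eval_monomial, smul_eq_mul, mul_assoc]
  set Λ : (A → ℝ) →ₗ[ℝ] F × ℝ := V.prod L with hΛ
  have hΛ0 : ∀ x, Λ x = 0 ↔ Polynomial.aeval T p x = 0 := by
    intro x
    constructor
    · intro h
      have h1 : V x = 0 := congrArg Prod.fst h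
      have h2 : L x = 0 := congrArg Prod.snd h
      rw [hker, hQ, hmul, hX, sub_eq_zero] at h1
      refine hl.eq_zero_of_eigenvector hβ0 hprim h1 ?_
      rw [← hLapp, hLaeval, h2, mul_zero]
    · intro h
      refine Prod.ext ?_ ?_
      · change V x = 0
        rw [hker, hQ, hmul, h, map_zero]
      · change L x = 0
        have h1 := hLaeval p x
        rw [h, map_zero] at h1
        exact (mul_eq_zero.1 h1.symm).resolve_left hpβ
  -- `p(T) x` depends linearly on `Λ x`, hence is bounded in terms of it
  obtain ⟨Ψ, hΨ⟩ := exists_linearMap_comp_eq Λ (Polynomial.aeval T p) fun x hx => (hΛ0 x).1 hx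
  obtain ⟨C, hC0, hC⟩ := (LinearMap.toContinuousLinearMap Ψ).bound
  have hfinite : ∀ r, {y | ∃ x ∈ intVec A, y = Λ x ∧ ‖Λ x‖ ≤ r}.Finite := by
    intro r
    -- `Λ x` is determined by `p(T) x`, a bounded integer vector
    obtain ⟨Φ, hΦ⟩ := exists_linearMap_comp_eq (Polynomial.aeval T p) Λ fun x hx => (hΛ0 x).2 hx
    refine ((finite_intVec_bounded (A := A) (C * r)).image Φ).subset ?_
    rintro _ ⟨x, hx, rfl, hr⟩
    refine ⟨Polynomial.aeval T p x, ⟨hpint x hx, fun a => ?_⟩, hΦ x⟩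
    have h1 : ‖Ψ (Λ x)‖ ≤ C * ‖Λ x‖ := hC _
    rw [hΨ] at h1
    refine le_trans ?_ (h1.trans (mul_le_mul_of_nonneg_left hr hC0.le))
    exact norm_le_pi_norm (Polynomial.aeval T p x) a
  refine ⟨N, hsurj, hN', ?_, ?_, ?_⟩
  · -- `V = K ∘ Q(T)`, and the powers of `T` tend to `0` on the range of `Q(T)`
    intro y
    obtain ⟨x, rfl⟩ := hsurj y
    obtain ⟨K, hK⟩ := exists_linearMap_comp_eq (Polynomial.aeval T Q) V fun x hx => (hker x).2 hx
    have hKc : Continuous K := LinearMap.continuous_of_finiteDimensional K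
    have h1 : Polynomial.aeval T q (Polynomial.aeval T Q x) = 0 := by
      rw [← hmul, hQ, ← mul_assoc, mul_comm q, hfac, ← hchar, LinearMap.aeval_self_charpoly,
        LinearMap.zero_apply]
    have h2 : Tendsto (fun k => (T ^ k) (Polynomial.aeval T Q x)) atTop (𝓝 0) := by
      rw [tendsto_pi_nhds]
      intro a
      have := tendsto_pow_apply_of_aeval hqmonic hqroots one_pos _ h1 a
      simp only [one_pow, div_one] at this
      exact (tendsto_zero_iff_abs_tendsto_zero _).2 this
    have h3 := (hKc.tendsto 0).comp h2
    rw [map_zero] at h3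
    refine h3.congr fun k => ?_
    rw [Function.comp_apply, ← hcommk, hK, hNk]
  · -- `N` and `β` together act on the lattice of the images of the integer vectors
    set Γ : Submodule ℤ (F × ℝ) := AddSubgroup.toIntSubmodule ((intVec A).map Λ.toAddMonoidHom)
      with hΓ
    have hmemΓ : ∀ y, y ∈ Γ ↔ ∃ x ∈ intVec A, Λ x = y := fun y => Iff.rfl
    have hdisc : DiscreteTopology Γ := by
      refine discreteTopology_of_isOpen_singleton_zero ?_
      have hfin : {y : Γ | ‖(y : F × ℝ)‖ ≤ 1}.Finite := by
        refine Set.Finite.of_finite_image (f := ((↑) : Γ → F × ℝ)) ((hfinite 1).subset ?_)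
          Subtype.val_injective.injOn
        rintro _ ⟨⟨y, x, hx, rfl⟩, hy, rfl⟩
        exact ⟨x, hx, rfl, hy⟩
      have hopen : IsOpen ({y : Γ | ‖(y : F × ℝ)‖ < 1} \ ({y : Γ | ‖(y : F × ℝ)‖ ≤ 1} \ {0})) :=
        (isOpen_lt (continuous_subtype_val.norm) continuous_const).sdiff
          (hfin.subset Set.sdiff_subset).isClosed
      convert hopen using 1
      ext y
      constructor
      · rintro rfl
        simp
      · rintro ⟨h1, h2⟩
        by_contra h3
        exact h2 ⟨le_of_lt (show ‖(y : F × ℝ)‖ < 1 from h1), h3⟩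
    have hspan : Submodule.span ℝ (Γ : Set (F × ℝ)) = ⊤ := by
      have hΛsurj : Function.Surjective Λ := by
        obtain ⟨r, hr⟩ := hβ.1.exists_hasEigenvector
        have hr1 : T r = β • r := hr.apply_eq_smul
        have hr0 : L r ≠ 0 := fun h =>
          hr.2 (hl.eq_zero_of_eigenvector hβ0 hprim hr1 (by rw [← hLapp, h]))
        have hVr : V r = 0 := by
          rw [hker, hQ, mul_comm, hmul, hX, hr1, sub_self, map_zero]
        rintro ⟨y, t⟩
        obtain ⟨x, rfl⟩ := hsurj y
        refine ⟨x + ((t - L x) / L r) • r, Prod.ext ?_ ?_⟩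
        · change V _ = _
          rw [map_add, map_smul, hVr, smul_zero, add_zero]
        · change L _ = _
          rw [map_add, map_smul, smul_eq_mul, div_mul_cancel₀ _ hr0]
          ring
      rw [eq_top_iff]
      rintro y -
      obtain ⟨x, rfl⟩ := hΛsurj y
      have h1 : x = ∑ a, x a • (Pi.single a (1 : ℝ) : A → ℝ) := by
        ext b; simp [Finset.sum_apply, Pi.single_apply]
      rw [h1, map_sum]
      refine Submodule.sum_mem _ fun a _ => ?_
      rw [map_smul]
      refine Submodule.smul_mem _ _ (Submodule.subset_span ((hmemΓ _).2 ⟨_, ?_, rfl⟩))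
      exact ⟨Pi.single a 1, by ext b; simp [Pi.single_apply]⟩
    have : IsZLattice ℝ Γ := ⟨hspan⟩
    have hG : ∀ x, (N.prodMap (β • LinearMap.id : ℝ →ₗ[ℝ] ℝ)) (Λ x) = Λ (T x) := by
      intro x
      refine Prod.ext (hN' x) ?_
      change β • L x = L (T x)
      rw [hLT, smul_eq_mul]
    have hdet := abs_det_eq_one_of_lattice Γ (N.prodMap (β • LinearMap.id)) ?_ ?_
    · rw [LinearMap.det_prodMap, LinearMap.det_smul] at hdet
      simpa [abs_mul, abs_of_pos hβ0] using hdet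
    · rintro _ ⟨x, hx, rfl⟩
      exact (hmemΓ _).2 ⟨T x, toEnd_mem_intVec M hx, (hG x).symm⟩
    · -- the constant term `±1` makes multiplication by `T` invertible modulo `ker p(T)`
      rintro _ ⟨x, hx, rfl⟩
      set c : ℤ := m.coeff 0 with hc
      have hcc : c * c = 1 := by
        have h1 : (minpoly ℚ β).coeff 0 = (c : ℚ) := by rw [hm, Polynomial.coeff_map]; rfl
        have h2 := hpisot.2
        rw [h1] at h2
        rcases h2 with h | h
        · have : c = 1 := by exact_mod_cast h
          rw [this]; norm_num
        · have : c = -1 := by exact_mod_cast h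
          rw [this]; norm_num
      set y := Polynomial.aeval T m.divX x with hy
      have hyint : y ∈ intVec A := aeval_mem_intVec M _ hx
      have h1 : Polynomial.aeval T p (T y + c • x) = 0 := by
        have h2 : T y + c • x = Polynomial.aeval T m x := by
          conv_rhs => rw [← Polynomial.divX_mul_X_add m]
          rw [map_add, mul_comm, map_mul, Polynomial.aeval_X, LinearMap.add_apply,
            Module.End.mul_apply, Polynomial.aeval_C]
          rfl
        rw [h2, ← hZ, ← hmul, mul_comm, ← hchar, LinearMap.aeval_self_charpoly,
          LinearMap.zero_apply]
      rw [← hΛ0, map_add, map_zsmul] at h1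
      refine ⟨Λ (-(c • y)), (hmemΓ _).2 ⟨_, neg_mem (zsmul_mem hyint c), rfl⟩, ?_⟩
      rw [hG, map_neg, map_zsmul, map_neg, map_zsmul, eq_neg_of_add_eq_zero_left h1, smul_neg,
        neg_neg, smul_smul, hcc, one_smul]
      rfl
  · intro r
    refine ((hfinite r).image Prod.fst).subset ?_
    rintro _ ⟨x, hx, rfl, h1, h2⟩
    refine ⟨Λ x, ⟨x, hx, rfl, ?_⟩, rfl⟩
    refine max_le h1 ?_
    change |L x| ≤ r
    rwa [hLapp]

end

/-! ### The subshift -/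

section shift
variable {A : Type*}

@[simp] theorem shiftPow_zero (w : ℤ → A) : shiftPow 0 w = w := by
  funext i; simp [shiftPow]

theorem shiftPow_shiftPow (m n : ℤ) (w : ℤ → A) :
    shiftPow m (shiftPow n w) = shiftPow (n + m) w := by
  funext i; simp only [shiftPow]; congr 1; ring

theorem continuous_shiftPow [TopologicalSpace A] (n : ℤ) :
    Continuous (shiftPow n : (ℤ → A) → ℤ → A) :=
  continuous_pi fun i => continuous_apply (i + n)

theorem abPrefix_congr_abs [DecidableEq A] {w w' : ℤ → A} {t : ℤ}
    (h : ∀ i, |i| ≤ |t| → w i = w' i) : abPrefix w t = abPrefix w' t := by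
  rcases le_total 0 t with ht | ht
  · have := abPrefix_congr ht fun i hi hi' => h i (by rw [abs_of_nonneg hi, abs_of_nonneg ht]; omega)
    simpa [abPrefix_zero] using this
  · have := abPrefix_congr ht fun i hi hi' => h i (by rw [abs_of_neg hi', abs_of_nonpos ht]; omega)
    simpa [abPrefix_zero] using this

theorem continuous_abPrefix [DecidableEq A] [TopologicalSpace A] [DiscreteTopology A] (n : ℤ) :
    Continuous fun w : ℤ → A => abPrefix w n := by
  unfold abPrefix
  refine Continuous.sub (continuous_finsetSum _ fun i _ => ?_) (continuous_finsetSum _ fun i _ => ?_)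
  all_goals
    exact (continuous_of_discreteTopology (f := fun a : A => (Pi.single a 1 : A → ℝ))).comp
      (continuous_apply i)

/-- The words that agree with `w` on `[-L, L]` form a neighbourhood of `w`. -/
theorem eventually_agree [TopologicalSpace A] [DiscreteTopology A] (w : ℤ → A) (L : ℤ) :
    ∀ᶠ v in 𝓝 w, ∀ i, |i| ≤ L → v i = w i := by
  have ho : IsOpen ((Set.Icc (-L) L).pi fun j => ({w j} : Set A)) :=
    isOpen_set_pi (Set.finite_Icc _ _) fun _ _ => isOpen_discrete _
  filter_upwards [ho.mem_nhds fun j _ => rfl] with v hv i hi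
  exact hv i (abs_le.1 hi)

end shift

namespace Substitution
variable {A : Type*} [Finite A] [TopologicalSpace A] [DiscreteTopology A] (σ : Substitution A)

theorem isCompact_subshift : IsCompact σ.subshift := by
  refine (isClosed_sInter fun K hK => ?_).isCompact
  exact hK.2.1.isClosed

variable {σ} {u : ℤ → A}

omit [Finite A] [TopologicalSpace A] [DiscreteTopology A] in
theorem shiftPow_mem_of_image_eq {K : Set (ℤ → A)} (hK : shift '' K = K) (n : ℤ) {w : ℤ → A}
    (hw : w ∈ K) : shiftPow n w ∈ K := by
  induction n using Int.induction_on with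
  | zero => simpa using hw
  | succ k ih =>
    rw [← shiftPow_shiftPow, ← hK]
    exact ⟨_, ih, rfl⟩
  | pred k ih =>
    rw [← hK] at ih
    obtain ⟨v, hv, hv'⟩ := ih
    rw [sub_eq_add_neg, ← shiftPow_shiftPow, ← hv', shift, shiftPow_shiftPow]
    simpa using hv

/-- The subshift is the closure of the orbit of a fixed point that it contains. -/
theorem subshift_eq_closure (hu : u ∈ σ.subshift) (hfix : σ.onWord u = u) :
    σ.subshift = closure (Set.range fun n : ℤ => shiftPow n u) := by
  refine Set.Subset.antisymm ?_ ?_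
  · refine Set.sInter_subset_of_mem ⟨(Set.range_nonempty _).closure, isClosed_closure.isCompact,
      ?_, ?_⟩
    · refine Set.MapsTo.closure ?_ σ.continuous_onWord
      rintro _ ⟨n, rfl⟩
      exact ⟨σ.pos u n, by simp only [σ.onWord_shiftPow, hfix]⟩
    · have h1 := (continuous_shiftPow (A := A) 1).isClosedMap.closure_image_eq_of_continuous
        (continuous_shiftPow 1) (Set.range fun n : ℤ => shiftPow n u)
      have h2 : (shiftPow 1 '' Set.range fun n : ℤ => shiftPow n u) =
          Set.range fun n : ℤ => shiftPow n u := by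
        ext w
        constructor
        · rintro ⟨_, ⟨n, rfl⟩, rfl⟩
          exact ⟨n + 1, (shiftPow_shiftPow _ _ _).symm⟩
        · rintro ⟨n, rfl⟩
          exact ⟨_, ⟨n - 1, rfl⟩, by simp [shiftPow_shiftPow]⟩
      rw [h2] at h1
      exact h1.symm
  · refine Set.subset_sInter fun K hK => closure_minimal ?_ hK.2.1.isClosed
    rintro _ ⟨n, rfl⟩
    exact shiftPow_mem_of_image_eq hK.2.2.2 n (Set.mem_sInter.1 hu K hK)

omit [Finite A] [DiscreteTopology A] in
theorem shiftPow_mem_subshift {w : ℤ → A} (hw : w ∈ σ.subshift) (n : ℤ) :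
    shiftPow n w ∈ σ.subshift := by
  rw [subshift, Set.mem_sInter] at hw ⊢
  exact fun K hK => shiftPow_mem_of_image_eq hK.2.2.2 n (hw K hK)

/-- Every word of the orbit closure of a fixed point of `τ` is a shift of the image of a word of
this closure, where the shift is shorter than the first block. -/
theorem exists_eq_shiftPow_onWord (τ : Substitution A) (hfix : τ.onWord u = u) {w : ℤ → A}
    (hw : w ∈ closure (Set.range fun n : ℤ => shiftPow n u)) :
    ∃ w' ∈ closure (Set.range fun n : ℤ => shiftPow n u),
      ∃ j < (τ.img (w' 0)).length, w = shiftPow j (τ.onWord w') := by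
  set Ω := closure (Set.range fun n : ℤ => shiftPow n u)
  have hcl : IsClosed (⋃ a : A, ⋃ j : Fin (τ.img a).length,
      (fun w' => shiftPow ((j : ℕ) : ℤ) (τ.onWord w')) '' (Ω ∩ {w' | w' 0 = a})) := by
    refine isClosed_iUnion_of_finite fun a => isClosed_iUnion_of_finite fun j => ?_
    refine IsCompact.isClosed (IsCompact.image ?_
      ((continuous_shiftPow _).comp τ.continuous_onWord))
    exact (isClosed_closure.inter (isClosed_singleton.preimage (continuous_apply (0 : ℤ)))).isCompact
  have hsub : (Set.range fun n : ℤ => shiftPow n u) ⊆ ⋃ a : A, ⋃ j : Fin (τ.img a).length,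
      (fun w' => shiftPow ((j : ℕ) : ℤ) (τ.onWord w')) '' (Ω ∩ {w' | w' 0 = a}) := by
    rintro _ ⟨m, rfl⟩
    obtain ⟨n, j, hj, rfl⟩ := τ.exists_pos_add u m
    refine Set.mem_iUnion.2 ⟨u n, Set.mem_iUnion.2 ⟨⟨j, hj⟩, shiftPow n u,
      ⟨subset_closure ⟨n, rfl⟩, by simp [shiftPow]⟩, ?_⟩⟩
    simp only [τ.onWord_shiftPow, hfix, shiftPow_shiftPow]
  obtain ⟨a, ha⟩ := Set.mem_iUnion.1 (closure_minimal hsub hcl hw)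
  obtain ⟨j, w', ⟨hw', rfl⟩, rfl⟩ := Set.mem_iUnion.1 ha
  exact ⟨w', hw', j, j.2, rfl⟩

end Substitution

/-! ### The map to the contracting space -/

/-- The standing assumptions: `u` is a fixed point of the proper primitive substitution `σ`, `l` is
the left Perron eigenvector of its incidence matrix, and `V` is the projection onto the contracting
space, on which the incidence matrix acts as `N`. -/
structure PisotSetting {A : Type*} [Fintype A] [DecidableEq A] [TopologicalSpace A]
    {F : Type*} [NormedAddCommGroup F] [NormedSpace ℝ F] (σ : Substitution A) (β : ℝ) (l : A → ℝ)
    (u : ℤ → A) (V : (A → ℝ) →ₗ[ℝ] F) (N : F →ₗ[ℝ] F) : Prop where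
  prim : IsPrimitiveMatrix σ.incidence
  one_lt : 1 < β
  perron : IsLeftPerron σ.incidence β l
  proper : σ.IsProper
  mem : u ∈ σ.subshift
  fixed : σ.onWord u = u
  proj : IsContractingProjection σ.incidence β l V N

/-- The powers of a contracting linear map tend to `0` uniformly on the unit ball. -/
theorem exists_norm_pow_le {F : Type*} [NormedAddCommGroup F] [NormedSpace ℝ F]
    [FiniteDimensional ℝ F] {N : F →ₗ[ℝ] F} (hN : ∀ y, Tendsto (fun k => (N ^ k) y) atTop (𝓝 0))
    {ε : ℝ} (hε : 0 < ε) : ∃ K, ∀ k ≥ K, ∀ y, ‖(N ^ k) y‖ ≤ ε * ‖y‖ := by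
  let b := Module.finBasis ℝ F
  obtain ⟨C, hC0, hC⟩ : ∃ C > 0, ∀ y, ∀ i, |b.repr y i| ≤ C * ‖y‖ := by
    obtain ⟨C, hC0, hC⟩ := (b.equivFunL : F →L[ℝ] Fin (Module.finrank ℝ F) → ℝ).bound
    exact ⟨C, hC0, fun y i => (norm_le_pi_norm (b.equivFunL y) i).trans (hC y)⟩
  have h1 : Tendsto (fun k => ∑ i, C * ‖(N ^ k) (b i)‖) atTop (𝓝 0) := by
    have : Tendsto (fun k => ∑ i, C * ‖(N ^ k) (b i)‖) atTop
        (𝓝 (∑ i : Fin (Module.finrank ℝ F), C * ‖(0 : F)‖)) :=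
      tendsto_finsetSum _ fun i _ => ((hN (b i)).norm.const_mul C)
    simpa using this
  obtain ⟨K, hK⟩ := eventually_atTop.1 (h1.eventually (gt_mem_nhds hε))
  refine ⟨K, fun k hk y => ?_⟩
  calc ‖(N ^ k) y‖ = ‖∑ i, b.repr y i • (N ^ k) (b i)‖ := by
        conv_lhs => rw [← b.sum_repr y, map_sum]
        simp_rw [map_smul]
    _ ≤ ∑ i, ‖y‖ * (C * ‖(N ^ k) (b i)‖) := by
        refine norm_sum_le_of_le _ fun i _ => ?_
        rw [norm_smul, Real.norm_eq_abs]
        calc _ ≤ C * ‖y‖ * ‖(N ^ k) (b i)‖ := by gcongr; exact hC y i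
          _ = _ := by ring
    _ = ‖y‖ * ∑ i, C * ‖(N ^ k) (b i)‖ := by rw [Finset.mul_sum]
    _ ≤ ε * ‖y‖ := by
        rw [mul_comm]
        exact mul_le_mul_of_nonneg_right (hK k hk).le (norm_nonneg _)

/-- The words `σ^k(a)` grow at least like `β ^ k`. -/
theorem IsLeftPerron.exists_le_length_pow {A : Type*} [Fintype A] [DecidableEq A]
    {σ : Substitution A} {β : ℝ} {l : A → ℝ} (hl : IsLeftPerron σ.incidence β l) (hβ : 1 < β) :
    ∃ c > 0, ∀ k a, c * β ^ k ≤ ((σ.pow k).img a).length := by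
  rcases isEmpty_or_nonempty A with hA | hA
  · exact ⟨1, one_pos, fun k a => (hA.false a).elim⟩
  obtain ⟨a₁, -, h1⟩ := Finset.exists_min_image Finset.univ l Finset.univ_nonempty
  have hs : 0 < ∑ b, l b := Finset.sum_pos (fun b _ => hl.1 b) Finset.univ_nonempty
  refine ⟨l a₁ / ∑ b, l b, div_pos (hl.1 _) hs, fun k a => ?_⟩
  rw [div_mul_eq_mul_div, div_le_iff₀ hs]
  calc l a₁ * β ^ k ≤ l a * β ^ k := by
        gcongr; exact h1 a (Finset.mem_univ _)
    _ = ∑ b, l b * ((σ.incidence ^ k) b a : ℝ) := by rw [(hl.pow k).2 a, mul_comm]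
    _ ≤ ∑ b, (∑ c, l c) * ((σ.incidence ^ k) b a : ℝ) := by
        gcongr with b
        exact Finset.single_le_sum (fun c _ => (hl.1 c).le) (Finset.mem_univ b)
    _ = _ := by
        rw [← Finset.mul_sum, Substitution.length_img, Substitution.incidence_pow, mul_comm]
        push_cast; rfl

namespace PisotSetting
variable {A : Type*} [Fintype A] [DecidableEq A] [TopologicalSpace A]
  {F : Type*} [NormedAddCommGroup F] [NormedSpace ℝ F]
  {σ : Substitution A} {β : ℝ} {l : A → ℝ} {u : ℤ → A} {V : (A → ℝ) →ₗ[ℝ] F} {N : F →ₗ[ℝ] F}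

theorem exists_le_length (h : PisotSetting σ β l u V N) (m : ℕ) :
    ∃ K, ∀ k ≥ K, ∀ a, m ≤ ((σ.pow k).img a).length := by
  obtain ⟨c, hc, hlen⟩ := h.perron.exists_le_length_pow h.one_lt
  have h1 : Tendsto (fun k : ℕ => c * β ^ k) atTop atTop :=
    (tendsto_pow_atTop_atTop_of_one_lt h.one_lt).const_mul_atTop hc
  obtain ⟨K, hK⟩ := eventually_atTop.1 (h1.eventually_ge_atTop (m : ℝ))
  exact ⟨K, fun k hk a => by exact_mod_cast (hK k hk).trans (hlen k a)⟩

theorem fixed_pow (h : PisotSetting σ β l u V N) (k : ℕ) : (σ.pow k).onWord u = u :=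
  σ.onWord_pow_fixed h.fixed k

/-- The fixed point is uniformly recurrent. As `σ` is proper, the two letters around the origin
occur at every boundary between two blocks `σ(a)`, hence their images under a power `σ^k` occur at
every boundary between two blocks `σ^(k+1)(a)`. -/
theorem exists_return (h : PisotSetting σ β l u V N) (m : ℕ) :
    ∃ L : ℕ, ∀ n : ℤ, ∃ k, n ≤ k ∧ k ≤ n + L ∧ ∀ i : ℤ, |i| ≤ m → u (k + i) = u i := by
  obtain ⟨K, hK⟩ := h.exists_le_length (m + 1)
  have hlen := hK K le_rfl
  refine ⟨∑ a, ((σ.pow (K + 1)).img a).length, fun n => ?_⟩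
  obtain ⟨q, j, hj, rfl⟩ := (σ.pow (K + 1)).exists_pos_add u n
  refine ⟨(σ.pow (K + 1)).pos u (q + 1), ?_, ?_, fun i hi => ?_⟩
  · rw [Substitution.pos_succ]; omega
  · have := Finset.single_le_sum (f := fun a => ((σ.pow (K + 1)).img a).length)
      (fun _ _ => Nat.zero_le _) (Finset.mem_univ (u q))
    rw [Substitution.pos_succ]
    have h2 : (((σ.pow (K + 1)).img (u q)).length : ℤ) ≤
      ((∑ a, ((σ.pow (K + 1)).img a).length : ℕ) : ℤ) := by exact_mod_cast this
    omega
  · set τ := σ.pow K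
    have hpos : (σ.pow (K + 1)).pos u (q + 1) = τ.pos u (σ.pos u (q + 1)) := by
      have := τ.pos_comp σ u (q + 1)
      rwa [h.fixed] at this
    rw [hpos]
    set k := σ.pos u (q + 1) with hk
    have h0 : shiftPow (τ.pos u k) u = τ.onWord (shiftPow k u) := by
      rw [τ.onWord_shiftPow, h.fixed_pow]
    have h1 : u (τ.pos u k + i) = τ.onWord (shiftPow k u) i := by
      rw [← h0, shiftPow, add_comm]
    rw [h1]
    conv_rhs => rw [← h.fixed_pow K]
    refine τ.onWord_congr (k := 0) (m := -1) (n := 1) (by simp) (by norm_num) (by norm_num)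
      (fun i hi hi' => ?_) i ?_ ?_
    · have hi2 : i = -1 ∨ i = 0 := by omega
      rcases hi2 with rfl | rfl
      · have := σ.onWord_pos_sub_one_eq h.proper u u (q + 1) 0
        rw [h.fixed, σ.pos_zero, zero_sub] at this
        rw [shiftPow, ← this]
        congr 1; ring
      · have := σ.onWord_pos_eq h.proper u u (q + 1) 0
        rw [h.fixed, σ.pos_zero] at this
        rw [shiftPow, ← this, zero_add]
    · have h2 := τ.pos_succ (shiftPow k u) (-1)
      have h3 := hlen (shiftPow k u (-1))
      rw [neg_add_cancel, τ.pos_zero] at h2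
      have := (abs_le.1 hi).1
      omega
    · have h2 := τ.pos_succ (shiftPow k u) 0
      have h3 := hlen (shiftPow k u 0)
      rw [zero_add, τ.pos_zero] at h2
      have := (abs_le.1 hi).2
      omega

omit [TopologicalSpace A] in
theorem toEnd_pow_abPrefix (k : ℕ) (w : ℤ → A) (n : ℤ) :
    (toEnd σ.incidence ^ k) (abPrefix w n) =
      abPrefix ((σ.pow k).onWord w) ((σ.pow k).pos w n) := by
  rw [← toEnd_pow, ← σ.incidence_pow]
  exact mulVec_abPrefix (σ.pow k) w n

theorem comm_pow (h : PisotSetting σ β l u V N) (k : ℕ) (x : A → ℝ) :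
    (N ^ k) (V x) = V ((toEnd σ.incidence ^ k) x) := by
  induction k with
  | zero => simp
  | succ k ih =>
    rw [pow_succ', pow_succ', Module.End.mul_apply, Module.End.mul_apply, ih, h.proj.comm]

omit [TopologicalSpace A] in
theorem norm_abPrefix_natCast_le (V : (A → ℝ) →ₗ[ℝ] F) (w : ℤ → A) (j : ℕ) :
    ‖V (abPrefix w j)‖ ≤ j * ∑ a, ‖V (Pi.single a 1)‖ := by
  induction j with
  | zero => simp [abPrefix_zero]
  | succ j ih =>
    rw [Nat.cast_succ, abPrefix_succ, map_add]
    refine (norm_add_le _ _).trans ?_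
    have := Finset.single_le_sum (f := fun a => ‖V (Pi.single a 1)‖)
      (fun _ _ => norm_nonneg _) (Finset.mem_univ (w j))
    push_cast
    linarith

/-- The projected broken line is bounded: up to a bounded error it is the image of a shorter part
of itself under a strict contraction. -/
theorem exists_norm_abPrefix_le [FiniteDimensional ℝ F] (h : PisotSetting σ β l u V N) :
    ∃ C, ∀ n, ‖V (abPrefix u n)‖ ≤ C := by
  obtain ⟨K, hK⟩ := exists_norm_pow_le h.proj.decay (ε := 1 / 2) (by norm_num)
  have hhalf := hK K le_rfl
  set τ := σ.pow K
  set B : ℝ := (∑ a, (τ.img a).length : ℕ) * ∑ a, ‖V (Pi.single a 1)‖ with hB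
  have hB0 : 0 ≤ B := by positivity
  have hstep : ∀ n, ∃ n', |n'| ≤ |n| ∧
      ‖V (abPrefix u n)‖ ≤ 1 / 2 * ‖V (abPrefix u n')‖ + B := by
    intro n
    obtain ⟨q, j, hj, rfl⟩ := τ.exists_pos_add u n
    refine ⟨q, ?_, ?_⟩
    · rcases le_or_gt 0 q with hq | hq
      · have := τ.le_pos u hq
        rw [abs_of_nonneg hq, abs_of_nonneg (by omega)]
        omega
      · have h1 := τ.pos_succ u q
        have h2 := τ.pos_le u (n := q + 1) (by omega)
        rw [abs_of_neg hq, abs_of_neg (by omega)]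
        omega
    · rw [abPrefix_add, map_add]
      refine (norm_add_le _ _).trans (add_le_add ?_ ?_)
      · have h1 := toEnd_pow_abPrefix (σ := σ) K u q
        rw [h.fixed_pow] at h1
        rw [← h1, ← h.comm_pow]
        exact hhalf _
      · refine (norm_abPrefix_natCast_le V _ j).trans ?_
        rw [hB]
        gcongr
        exact hj.le.trans (Finset.single_le_sum (f := fun a => (τ.img a).length)
          (fun _ _ => Nat.zero_le _) (Finset.mem_univ _))
  refine ⟨2 * B, fun n => ?_⟩
  -- take the largest value for indices of absolute value at most `|n|`
  obtain ⟨m, hm, hmax⟩ := Finset.exists_max_image (Finset.Icc (-|n|) |n|)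
    (fun m => ‖V (abPrefix u m)‖) ⟨0, by simp⟩
  obtain ⟨m', hm', hle⟩ := hstep m
  have h1 := hmax m' (by
    rw [Finset.mem_Icc] at hm ⊢
    exact abs_le.1 (hm'.trans (abs_le.2 hm)))
  have h2 := hmax n (by rw [Finset.mem_Icc]; exact ⟨neg_abs_le n, le_abs_self n⟩)
  linarith

/-- Bounded sums along a uniformly recurrent word depend continuously on the position (the theorem
of Gottschalk and Hedlund): if the sums nearly attain their supremum and their infimum on a certain
subword, they do so at each of its occurrences, and every long window contains one. -/
theorem exists_abs_sub_le (h : PisotSetting σ β l u V N) (g : (A → ℝ) →ₗ[ℝ] ℝ) {C : ℝ}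
    (hC : ∀ n, |g (abPrefix u n)| ≤ C) {ε : ℝ} (hε : 0 < ε) :
    ∃ L : ℤ, ∀ n m, (∀ i, |i| ≤ L → u (n + i) = u (m + i)) →
      |g (abPrefix u n) - g (abPrefix u m)| ≤ ε := by
  set f : ℤ → ℝ := fun n => g (abPrefix u n) with hf
  have hbdd : BddAbove (Set.range f) := ⟨C, by rintro _ ⟨n, rfl⟩; exact (abs_le.1 (hC n)).2⟩
  have hbdd' : BddBelow (Set.range f) := ⟨-C, by rintro _ ⟨n, rfl⟩; exact (abs_le.1 (hC n)).1⟩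
  obtain ⟨_, ⟨k₀, rfl⟩, hk₀⟩ := exists_lt_of_lt_csSup (Set.range_nonempty f)
    (show sSup (Set.range f) - ε / 2 < sSup (Set.range f) by linarith)
  obtain ⟨_, ⟨k₁, rfl⟩, hk₁⟩ := exists_lt_of_csInf_lt (Set.range_nonempty f)
    (show sInf (Set.range f) < sInf (Set.range f) + ε / 2 by linarith)
  obtain ⟨r, hr₀, hr₁⟩ : ∃ r : ℕ, |k₀| ≤ r ∧ |k₁| ≤ r :=
    ⟨k₀.natAbs + k₁.natAbs, by push_cast; have := abs_nonneg k₁; omega,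
      by push_cast; have := abs_nonneg k₀; omega⟩
  obtain ⟨L, hL⟩ := h.exists_return r
  have hsum : ∀ n m t : ℤ, (∀ i, |i| ≤ |t| → u (n + i) = u (m + i)) →
      f (n + t) - f n = f (m + t) - f m := by
    intro n m t hnm
    have h1 : abPrefix (shiftPow n u) t = abPrefix (shiftPow m u) t :=
      abPrefix_congr_abs fun i hi => by
        simp only [shiftPow]; rw [add_comm i, add_comm i]; exact hnm i hi
    simp only [hf, abPrefix_add, map_add, h1, add_sub_cancel_left]
  -- near an occurrence of the subword the sum is close to its supremum
  have hnear : ∀ k, (∀ i : ℤ, |i| ≤ r → u (k + i) = u i) →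
      sSup (Set.range f) - ε ≤ f (k + k₀) := by
    intro k hk
    have h1 := hsum k 0 k₀ fun i hi => by rw [hk i (hi.trans hr₀), zero_add]
    have h2 := hsum k 0 k₁ fun i hi => by rw [hk i (hi.trans hr₁), zero_add]
    rw [zero_add] at h1 h2
    have h3 := csInf_le hbdd' ⟨k + k₁, rfl⟩
    linarith
  refine ⟨L + r, fun n m hnm => ?_⟩
  obtain ⟨k, hk1, hk2, hk⟩ := hL n
  have h1 := hnear k hk
  have h2 := hnear (m + (k - n)) fun i hi => by
    rw [← hk i hi]
    have := hnm (k - n + i) (by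
      have := abs_le.1 hi
      rw [abs_le]; omega)
    rw [add_assoc, ← this]
    congr 1; ring
  have h3 := hsum n m (k - n + k₀) fun i hi => hnm i (hi.trans (by
    have := abs_le.1 hr₀
    rw [abs_le]; omega))
  have h4 := le_csSup hbdd ⟨k + k₀, rfl⟩
  have h5 := le_csSup hbdd ⟨m + (k - n) + k₀, rfl⟩
  have e1 : n + (k - n + k₀) = k + k₀ := by ring
  have e2 : m + (k - n + k₀) = m + (k - n) + k₀ := by ring
  rw [e1, e2] at h3
  change |f n - f m| ≤ ε
  rw [abs_le]
  constructor <;> linarith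

variable [FiniteDimensional ℝ F]

/-- Nearby shifts of `u` have nearby points of the projected broken line. -/
theorem exists_norm_sub_le (h : PisotSetting σ β l u V N) {ε : ℝ} (hε : 0 < ε) :
    ∃ L : ℤ, ∀ n m, (∀ i, |i| ≤ L → u (n + i) = u (m + i)) →
      ‖V (abPrefix u n) - V (abPrefix u m)‖ ≤ ε := by
  let b := Module.finBasis ℝ F
  obtain ⟨C, hC⟩ := h.exists_norm_abPrefix_le
  set S := 1 + ∑ i, ‖b i‖ with hS
  have hS0 : 0 < S := by positivity
  have key : ∀ i, ∃ L : ℤ, ∀ n m, (∀ i, |i| ≤ L → u (n + i) = u (m + i)) →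
      |b.coord i (V (abPrefix u n)) - b.coord i (V (abPrefix u m))| ≤ ε / S := by
    intro i
    obtain ⟨D, hD0, hD⟩ := (LinearMap.toContinuousLinearMap (b.coord i)).bound
    exact h.exists_abs_sub_le (b.coord i ∘ₗ V) (C := D * C)
      (fun n => (hD _).trans (mul_le_mul_of_nonneg_left (hC n) hD0.le)) (div_pos hε hS0)
  choose L hL using key
  refine ⟨∑ i, |L i|, fun n m hnm => ?_⟩
  have h1 : ∀ i, |b.repr (V (abPrefix u n) - V (abPrefix u m)) i| ≤ ε / S := by
    intro i
    have := hL i n m fun j hj => hnm j (hj.trans ((le_abs_self _).trans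
      (Finset.single_le_sum (f := fun i => |L i|) (fun _ _ => abs_nonneg _) (Finset.mem_univ i))))
    simpa using this
  calc _ = ‖∑ i, b.repr (V (abPrefix u n) - V (abPrefix u m)) i • b i‖ := by rw [b.sum_repr]
    _ ≤ ∑ i, ε / S * ‖b i‖ := by
        refine norm_sum_le_of_le _ fun i _ => ?_
        rw [norm_smul]
        exact mul_le_mul_of_nonneg_right (h1 i) (norm_nonneg _)
    _ = ε / S * ∑ i, ‖b i‖ := by rw [Finset.mul_sum]
    _ ≤ ε / S * S := by gcongr; linarith
    _ = ε := div_mul_cancel₀ _ hS0.ne'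

variable [DiscreteTopology A]

omit [FiniteDimensional ℝ F] in
theorem subshift_eq (h : PisotSetting σ β l u V N) :
    σ.subshift = closure (Set.range fun n : ℤ => shiftPow n u) :=
  Substitution.subshift_eq_closure h.mem h.fixed

/-- The limit in the definition of `φ` exists on the whole subshift. -/
theorem tendsto_rauzyMap (h : PisotSetting σ β l u V N) {w : ℤ → A} (hw : w ∈ σ.subshift) :
    (comap (fun n : ℤ => shiftPow n u) (𝓝 w)).NeBot ∧
    Tendsto (fun n : ℤ => V (abPrefix u n)) (comap (fun n : ℤ => shiftPow n u) (𝓝 w))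
      (𝓝 (rauzyMap V u w)) := by
  have hne : (comap (fun n : ℤ => shiftPow n u) (𝓝 w)).NeBot := by
    rw [comap_neBot_iff_frequently]
    rw [h.subshift_eq, mem_closure_iff_frequently] at hw
    exact hw
  refine ⟨hne, tendsto_nhds_limUnder ?_⟩
  have hcauchy : Cauchy (map (fun n : ℤ => V (abPrefix u n))
      (comap (fun n : ℤ => shiftPow n u) (𝓝 w))) := by
    rw [Metric.cauchy_iff]
    refine ⟨hne.map _, fun ε hε => ?_⟩
    obtain ⟨L, hL⟩ := h.exists_norm_sub_le (half_pos hε)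
    refine ⟨_, image_mem_map (preimage_mem_comap (eventually_agree w L)), ?_⟩
    rintro _ ⟨n, hn, rfl⟩ _ ⟨m, hm, rfl⟩
    rw [dist_eq_norm]
    refine (hL n m fun i hi => ?_).trans_lt (half_lt_self hε)
    have h1 := hn i hi
    have h2 := hm i hi
    simp only [shiftPow] at h1 h2
    rw [add_comm n, add_comm m, h1, h2]
  exact CompleteSpace.complete hcauchy

theorem norm_sub_rauzyMap_le (h : PisotSetting σ β l u V N) {ε : ℝ} (hε : 0 < ε) :
    ∃ L : ℤ, ∀ w ∈ σ.subshift, ∀ n, (∀ i, |i| ≤ L → shiftPow n u i = w i) →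
      ‖V (abPrefix u n) - rauzyMap V u w‖ ≤ ε := by
  obtain ⟨L, hL⟩ := h.exists_norm_sub_le hε
  refine ⟨L, fun w hw n hn => ?_⟩
  obtain ⟨hne, ht⟩ := h.tendsto_rauzyMap hw
  refine le_of_tendsto (ht.const_sub (V (abPrefix u n))).norm ?_
  filter_upwards [preimage_mem_comap (eventually_agree w L)] with m hm
  refine hL n m fun i hi => ?_
  have h1 := hn i hi
  have h2 := hm i hi
  simp only [shiftPow] at h1 h2
  rw [add_comm n, add_comm m, h1, h2]

theorem rauzyMap_shiftPow_fixed (h : PisotSetting σ β l u V N) (n : ℤ) :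
    rauzyMap V u (shiftPow n u) = V (abPrefix u n) := by
  symm
  rw [← sub_eq_zero, ← norm_le_zero_iff]
  refine le_of_forall_pos_le_add fun ε hε => ?_
  obtain ⟨L, hL⟩ := h.norm_sub_rauzyMap_le hε
  rw [zero_add]
  exact hL _ (Substitution.shiftPow_mem_subshift h.mem n) n fun i _ => rfl

theorem continuousOn_rauzyMap (h : PisotSetting σ β l u V N) :
    ContinuousOn (rauzyMap V u) σ.subshift := by
  intro w hw
  rw [ContinuousWithinAt, Metric.tendsto_nhds]
  intro ε hε
  obtain ⟨L, hL⟩ := h.norm_sub_rauzyMap_le (show 0 < ε / 3 by positivity)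
  filter_upwards [self_mem_nhdsWithin, mem_nhdsWithin_of_mem_nhds (eventually_agree w L)]
    with v hv hvw
  have hv' := hv
  rw [h.subshift_eq, mem_closure_iff_frequently] at hv'
  obtain ⟨_, ⟨n, rfl⟩, hn⟩ := (hv'.and_eventually (eventually_agree v L)).exists
  have h1 := hL v hv n hn
  have h2 := hL w hw n fun i hi => (hn i hi).trans (hvw i hi)
  rw [dist_eq_norm]
  calc _ = ‖(V (abPrefix u n) - rauzyMap V u w) - (V (abPrefix u n) - rauzyMap V u v)‖ := by
        congr 1; abel
    _ ≤ ε / 3 + ε / 3 := (norm_sub_le _ _).trans (add_le_add h2 h1)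
    _ < ε := by linarith

theorem rauzyMap_shiftPow (h : PisotSetting σ β l u V N) {w : ℤ → A} (hw : w ∈ σ.subshift)
    (n : ℤ) : rauzyMap V u (shiftPow n w) = rauzyMap V u w + V (abPrefix w n) := by
  have hV : Continuous V := LinearMap.continuous_of_finiteDimensional V
  refine Set.EqOn.of_subset_closure (s := Set.range fun n : ℤ => shiftPow n u) ?_
    (h.continuousOn_rauzyMap.comp (continuous_shiftPow n).continuousOn
      fun w hw => Substitution.shiftPow_mem_subshift hw n)
    (h.continuousOn_rauzyMap.add (hV.comp (continuous_abPrefix n)).continuousOn)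
    (h.subshift_eq ▸ subset_closure) h.subshift_eq.le hw
  rintro _ ⟨m, rfl⟩
  simp only [Function.comp_apply, Pi.add_apply]
  rw [shiftPow_shiftPow, h.rauzyMap_shiftPow_fixed, h.rauzyMap_shiftPow_fixed, abPrefix_add,
    map_add]

omit [FiniteDimensional ℝ F] in
theorem onWord_pow_mem (h : PisotSetting σ β l u V N) {w : ℤ → A} (hw : w ∈ σ.subshift) (k : ℕ) :
    (σ.pow k).onWord w ∈ σ.subshift := by
  rw [h.subshift_eq] at hw ⊢
  refine Set.MapsTo.closure ?_ (σ.pow k).continuous_onWord hw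
  rintro _ ⟨n, rfl⟩
  exact ⟨(σ.pow k).pos u n, by simp only [Substitution.onWord_shiftPow, h.fixed_pow]⟩

theorem rauzyMap_onWord_pow (h : PisotSetting σ β l u V N) {w : ℤ → A} (hw : w ∈ σ.subshift)
    (k : ℕ) : rauzyMap V u ((σ.pow k).onWord w) = (N ^ k) (rauzyMap V u w) := by
  have hN : Continuous (N ^ k) := LinearMap.continuous_of_finiteDimensional _
  refine Set.EqOn.of_subset_closure (s := Set.range fun n : ℤ => shiftPow n u) ?_
    (h.continuousOn_rauzyMap.comp (σ.pow k).continuous_onWord.continuousOn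
      fun w hw => h.onWord_pow_mem hw k)
    (hN.comp_continuousOn h.continuousOn_rauzyMap)
    (h.subshift_eq ▸ subset_closure) h.subshift_eq.le hw
  rintro _ ⟨m, rfl⟩
  have h1 := toEnd_pow_abPrefix (σ := σ) k u m
  rw [h.fixed_pow] at h1
  simp only [Function.comp_apply]
  rw [Substitution.onWord_shiftPow, h.fixed_pow, h.rauzyMap_shiftPow_fixed,
    h.rauzyMap_shiftPow_fixed, h.comm_pow, h1]

omit [FiniteDimensional ℝ F] in
theorem exists_eq_shiftPow_onWord_pow (h : PisotSetting σ β l u V N) {w : ℤ → A}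
    (hw : w ∈ σ.subshift) (k : ℕ) : ∃ w' ∈ σ.subshift,
      ∃ j < ((σ.pow k).img (w' 0)).length, w = shiftPow j ((σ.pow k).onWord w') := by
  rw [h.subshift_eq] at hw ⊢
  exact Substitution.exists_eq_shiftPow_onWord _ (h.fixed_pow k) hw

end PisotSetting

/-! ### The subdivision of the pieces -/

/-- If the measure of a finite union is at least the sum of the measures, then the sets are pairwise
disjoint up to null sets. -/
theorem aedisjoint_of_sum_measureReal_le {X ι : Type*} [MeasurableSpace X] {μ : Measure X}
    [Fintype ι] {s : ι → Set X} (hs : ∀ i, MeasurableSet (s i)) (hfin : ∀ i, μ (s i) ≠ ⊤)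
    (h : ∑ i, μ.real (s i) ≤ μ.real (⋃ i, s i)) : Pairwise fun i j => AEDisjoint μ (s i) (s j) := by
  classical
  intro i j hij
  set t := ⋃ k ∈ Finset.univ.erase i, s k with ht
  have htm : MeasurableSet t := Finset.measurableSet_biUnion _ fun k _ => hs k
  have htfin : μ t ≠ ⊤ := (measure_biUnion_lt_top (Finset.finite_toSet _)
    fun k _ => (hfin k).lt_top).ne
  have hunion : ⋃ k, s k = s i ∪ t := by
    ext x
    simp only [ht, Set.mem_iUnion, Set.mem_union, Finset.mem_erase, Finset.mem_univ, and_true]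
    constructor
    · rintro ⟨k, hk⟩
      by_cases hki : k = i
      · exact Or.inl (hki ▸ hk)
      · exact Or.inr ⟨k, hki, hk⟩
    · rintro (hx | ⟨k, -, hk⟩)
      · exact ⟨i, hx⟩
      · exact ⟨k, hk⟩
  have h1 := measureReal_union_add_inter (μ := μ) (s := s i) htm (hfin i) htfin
  have h2 := measureReal_biUnion_finset_le (μ := μ) (Finset.univ.erase i) s
  rw [hunion, ← Finset.add_sum_erase _ _ (Finset.mem_univ i)] at h
  have h3 : μ.real (s i ∩ t) ≤ 0 := by
    rw [← ht] at h2
    linarith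
  have h4 : μ (s i ∩ t) = 0 := by
    exact (measureReal_eq_zero_iff
      (ne_top_of_le_ne_top htfin (measure_mono Set.inter_subset_right))).1
      (le_antisymm h3 measureReal_nonneg)
  refine measure_mono_null (Set.inter_subset_inter_right _ ?_) h4
  exact Set.subset_biUnion_of_mem (u := s) (Finset.mem_coe.2 (Finset.mem_erase.2
    ⟨hij.symm, Finset.mem_univ j⟩))

section Occ
variable {A : Type*}

/-- The abelianization of a finite word. -/
noncomputable def abList [DecidableEq A] (L : List A) : A → ℝ :=
  (L.map fun a => Pi.single a (1 : ℝ)).sum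

/-- The occurrences of the letter `b` in the words `τ(a)`: pairs of a letter `a` and a position in
the word `τ(a)`. -/
abbrev Occ (τ : Substitution A) (b : A) : Type _ :=
  {p : (a : A) × Fin (τ.img a).length // (τ.img p.1)[p.2] = b}

variable [Fintype A] [DecidableEq A]

/-- A sum over the occurrences of `b`, of terms that depend on the letter `a` of `τ(a)` only. -/
theorem sum_occ {G : Type*} [AddCommMonoid G] (τ : Substitution A) (b : A) (g : A → G) :
    ∑ p : Occ τ b, g p.1.1 = ∑ a, τ.incidence b a • g a := by
  have h := Finset.sum_subtype_of_mem
    (s := Finset.univ.filter fun p : (a : A) × Fin (τ.img a).length => (τ.img p.1)[p.2] = b)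
    (p := fun p => (τ.img p.1)[p.2] = b) (fun p => g p.1) (fun p hp => (Finset.mem_filter.1 hp).2)
  have h2 : (Finset.univ.filter fun p : (a : A) × Fin (τ.img a).length =>
      (τ.img p.1)[p.2] = b).subtype (fun p => (τ.img p.1)[p.2] = b) = Finset.univ := by
    ext x; simpa using x.2
  rw [h2] at h
  refine h.trans ?_
  rw [Finset.sum_filter, ← Finset.univ_sigma_univ, Finset.sum_sigma]
  refine Finset.sum_congr rfl fun a _ => ?_
  have h3 := Substitution.sum_map_eq_sum_count (τ.img a) (fun c => if c = b then g a else 0)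
  rw [← sum_range_getElem (τ.img a) _ (fun j => if h : j < (τ.img a).length then
      if (τ.img a)[j] = b then g a else 0 else 0) (fun j hj => by simp [hj]),
    Finset.sum_range] at h3
  simp only [Fin.is_lt, dite_true] at h3
  refine h3.trans ?_
  rw [Finset.sum_eq_single b]
  · simp [Substitution.incidence]
  · intro c _ hc; simp [hc]
  · simp

omit [Fintype A] in
theorem abPrefix_onWord (τ : Substitution A) (w : ℤ → A) {j : ℕ} (hj : j ≤ (τ.img (w 0)).length) :
    abPrefix (τ.onWord w) j = abList ((τ.img (w 0)).take j) := by
  rw [abPrefix_eq, intSum_natCast, abList, ← sum_range_getElem _ _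
    fun i : ℕ => (Pi.single (τ.onWord w i) 1 : A → ℝ)]
  · rw [List.length_take, min_eq_left hj]
  · intro i hi
    rw [List.length_take, lt_min_iff] at hi
    have := τ.onWord_pos_add w 0 hi.2
    rw [τ.pos_zero, zero_add] at this
    rw [this, List.getElem_take]

theorem abList_img (τ : Substitution A) (a : A) :
    abList (τ.img a) = toEnd τ.incidence (Pi.single a 1) := by
  rw [abList, Substitution.sum_map_eq_sum_count]
  ext b
  rw [toEnd_apply]
  simp [Finset.sum_apply, Pi.single_apply, Substitution.incidence]

end Occ

namespace Substitution
variable {A : Type*} (σ : Substitution A)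

theorem pow_one : σ.pow 1 = σ := by
  cases σ
  simp [pow, comp]

end Substitution

section piece
variable {A : Type*} [Fintype A] [DecidableEq A] [TopologicalSpace A]
  {F : Type*} [NormedAddCommGroup F] [NormedSpace ℝ F]

/-- The part of the piece `R_b` that comes from an occurrence of `b` in a word `σ^k(a)`: a
contracted copy of `R_a`. -/
noncomputable def subpiece (σ : Substitution A) (V : (A → ℝ) →ₗ[ℝ] F) (N : F →ₗ[ℝ] F) (u : ℤ → A)
    (k : ℕ) {b : A} (p : Occ (σ.pow k) b) : Set F :=
  (fun x => (N ^ k) x + V (abList (((σ.pow k).img p.1.1).take p.1.2))) '' piece σ V u p.1.1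

variable {σ : Substitution A} {β : ℝ} {l : A → ℝ} {u : ℤ → A} {V : (A → ℝ) →ₗ[ℝ] F} {N : F →ₗ[ℝ] F}
variable [FiniteDimensional ℝ F] [DiscreteTopology A]

namespace PisotSetting

theorem fractal_eq_iUnion (σ : Substitution A) (V : (A → ℝ) →ₗ[ℝ] F) (u : ℤ → A) :
    fractal σ V u = ⋃ a, piece σ V u a := by
  ext x
  simp only [fractal, piece, Set.mem_image, Set.mem_iUnion, Set.mem_ofPred_eq]
  constructor
  · rintro ⟨w, hw, rfl⟩
    exact ⟨w 0, w, ⟨hw, rfl⟩, rfl⟩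
  · rintro ⟨a, w, ⟨hw, -⟩, rfl⟩
    exact ⟨w, hw, rfl⟩

theorem piece_subset_fractal (σ : Substitution A) (V : (A → ℝ) →ₗ[ℝ] F) (u : ℤ → A) (a : A) :
    piece σ V u a ⊆ fractal σ V u :=
  (fractal_eq_iUnion σ V u).symm ▸ Set.subset_iUnion (piece σ V u) a

theorem isCompact_piece (h : PisotSetting σ β l u V N) (a : A) : IsCompact (piece σ V u a) := by
  refine IsCompact.image_of_continuousOn ?_ (h.continuousOn_rauzyMap.mono fun w hw => hw.1)
  have hcl : IsClosed {w : ℤ → A | w 0 = a} := isClosed_eq (continuous_apply 0) continuous_const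
  exact σ.isCompact_subshift.inter_right hcl

theorem isCompact_fractal (h : PisotSetting σ β l u V N) : IsCompact (fractal σ V u) :=
  σ.isCompact_subshift.image_of_continuousOn h.continuousOn_rauzyMap

/-- The pieces satisfy the set equation of the substitution `σ^k`. -/
theorem piece_eq_iUnion (h : PisotSetting σ β l u V N) (k : ℕ) (b : A) :
    piece σ V u b = ⋃ p : Occ (σ.pow k) b, subpiece σ V N u k p := by
  have key : ∀ w ∈ σ.subshift, ∀ j < ((σ.pow k).img (w 0)).length,
      rauzyMap V u (shiftPow j ((σ.pow k).onWord w)) =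
        (N ^ k) (rauzyMap V u w) + V (abList (((σ.pow k).img (w 0)).take j)) := by
    intro w hw j hj
    rw [h.rauzyMap_shiftPow (h.onWord_pow_mem hw k), h.rauzyMap_onWord_pow hw,
      abPrefix_onWord _ _ hj.le]
  have key2 : ∀ (w : ℤ → A) (j : ℕ) (hj : j < ((σ.pow k).img (w 0)).length),
      shiftPow (j : ℤ) ((σ.pow k).onWord w) 0 = ((σ.pow k).img (w 0))[j] := by
    intro w j hj
    have := (σ.pow k).onWord_pos_add w 0 hj
    rw [Substitution.pos_zero] at this
    exact this
  ext x
  simp only [Set.mem_iUnion, subpiece, Set.mem_image]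
  constructor
  · rintro ⟨w, ⟨hw, rfl⟩, rfl⟩
    obtain ⟨w', hw', j, hj, rfl⟩ := h.exists_eq_shiftPow_onWord_pow hw k
    exact ⟨⟨⟨w' 0, ⟨j, hj⟩⟩, (key2 w' j hj).symm⟩, rauzyMap V u w', ⟨w', ⟨hw', rfl⟩, rfl⟩,
      (key w' hw' j hj).symm⟩
  · rintro ⟨⟨⟨a, j, hj⟩, hb⟩, _, ⟨w, ⟨hw, hwa⟩, rfl⟩, rfl⟩
    obtain rfl : w 0 = a := hwa
    refine ⟨shiftPow j ((σ.pow k).onWord w),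
      ⟨Substitution.shiftPow_mem_subshift (h.onWord_pow_mem hw k) _, ?_⟩, key w hw j hj⟩
    rw [key2 w j hj]
    exact hb

theorem subpiece_subset (h : PisotSetting σ β l u V N) (k : ℕ) {b : A} (p : Occ (σ.pow k) b) :
    subpiece σ V N u k p ⊆ piece σ V u b := by
  rw [h.piece_eq_iUnion k b]
  exact Set.subset_iUnion (fun p : Occ (σ.pow k) b => subpiece σ V N u k p) p

omit [FiniteDimensional ℝ F] [DiscreteTopology A] in
theorem det_ne_zero (h : PisotSetting σ β l u V N) (k : ℕ) : LinearMap.det (N ^ k) ≠ 0 := by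
  have h1 := h.proj.det
  rw [map_pow]
  refine pow_ne_zero k fun h0 => ?_
  rw [h0] at h1
  simp at h1

omit [FiniteDimensional ℝ F] [DiscreteTopology A] in
theorem abs_det_pow (h : PisotSetting σ β l u V N) (k : ℕ) :
    |LinearMap.det (N ^ k)| * β ^ k = 1 := by
  rw [map_pow, abs_pow, ← mul_pow, h.proj.det, one_pow]

omit [DiscreteTopology A] in
theorem exists_homeomorph (h : PisotSetting σ β l u V N) (k : ℕ) (t : F) :
    ∃ e : F ≃ₜ F, ∀ x, e x = (N ^ k) x + t :=
  ⟨((N ^ k).equivOfDetNeZero (h.det_ne_zero k)).toContinuousLinearEquiv.toHomeomorph.trans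
    (Homeomorph.addRight t), fun _ => rfl⟩

/-- Every piece contains a contracted copy of every other piece. -/
theorem exists_occ_pow (h : PisotSetting σ β l u V N) :
    ∃ k, ∀ a b, ∃ p : Occ (σ.pow k) b, p.1.1 = a := by
  obtain ⟨n, -, hn⟩ := h.prim
  refine ⟨n, fun a b => ?_⟩
  have h1 := hn b a
  rw [← σ.incidence_pow, Substitution.incidence_pos_iff] at h1
  obtain ⟨i, hi, h2⟩ := List.getElem_of_mem h1
  exact ⟨⟨⟨a, ⟨i, hi⟩⟩, h2⟩, rfl⟩

/-- For large `k` the parts of the pieces that come from `σ^k` are small. -/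
theorem exists_dist_lt (h : PisotSetting σ β l u V N) {ε : ℝ} (hε : 0 < ε) :
    ∃ k, ∀ b, ∀ p : Occ (σ.pow k) b, ∀ x ∈ subpiece σ V N u k p, ∀ y ∈ subpiece σ V N u k p,
      dist x y < ε := by
  obtain ⟨C, hC⟩ := h.isCompact_fractal.isBounded.exists_norm_le
  have hC0 : 0 ≤ C := (norm_nonneg _).trans (hC _ ⟨u, h.mem, rfl⟩)
  obtain ⟨K, hK⟩ := exists_norm_pow_le h.proj.decay (ε := ε / (2 * C + 1)) (by positivity)
  refine ⟨K, fun b p => ?_⟩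
  rintro _ ⟨x, hx, rfl⟩ _ ⟨y, hy, rfl⟩
  have hx' := hC x (piece_subset_fractal _ _ _ _ hx)
  have hy' := hC y (piece_subset_fractal _ _ _ _ hy)
  rw [dist_eq_norm, add_sub_add_right_eq_sub, ← map_sub]
  refine (hK K le_rfl (x - y)).trans_lt ?_
  calc ε / (2 * C + 1) * ‖x - y‖ ≤ ε / (2 * C + 1) * (2 * C) := by
        gcongr
        linarith [norm_sub_le x y]
    _ < ε / (2 * C + 1) * (2 * C + 1) := by
        gcongr
        linarith
    _ = ε := div_mul_cancel₀ _ (by positivity)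

/-! ### The pieces have interior points -/

/-- The projections of the integer vectors are dense: every point is the image under `N^K` of a point
that has such a projection at a bounded distance, and `N^K` contracts this distance. -/
theorem exists_intVec_norm_sub_lt (h : PisotSetting σ β l u V N) (y : F) {ε : ℝ} (hε : 0 < ε) :
    ∃ x ∈ intVec A, ‖V x - y‖ < ε := by
  set S := ∑ a, ‖V (Pi.single a 1)‖ with hS
  have hS0 : 0 ≤ S := by positivity
  obtain ⟨K, hK⟩ := exists_norm_pow_le h.proj.decay (ε := ε / (S + 1)) (by positivity)
  obtain ⟨y', rfl⟩ := ((N ^ K).equivOfDetNeZero (h.det_ne_zero K)).surjective y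
  obtain ⟨x, rfl⟩ := h.proj.surjective y'
  have hfloor : (fun a => (⌊x a⌋ : ℝ)) ∈ intVec A := ⟨fun a => ⌊x a⌋, rfl⟩
  refine ⟨(toEnd σ.incidence ^ K) fun a => (⌊x a⌋ : ℝ), ?_, ?_⟩
  · rw [← toEnd_pow]
    exact toEnd_mem_intVec _ hfloor
  · rw [← h.comm_pow]
    change ‖(N ^ K) _ - (N ^ K) _‖ < ε
    rw [← map_sub, ← map_sub]
    have h1 : ‖V ((fun a => (⌊x a⌋ : ℝ)) - x)‖ ≤ S := by
      have h2 : (fun a => (⌊x a⌋ : ℝ)) - x =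
          ∑ a, ((⌊x a⌋ : ℝ) - x a) • (Pi.single a (1 : ℝ) : A → ℝ) := by
        ext b; simp [Finset.sum_apply, Pi.single_apply]
      rw [h2, map_sum]
      refine norm_sum_le_of_le _ fun a _ => ?_
      rw [map_smul, norm_smul]
      refine mul_le_of_le_one_left (norm_nonneg _) ?_
      rw [Real.norm_eq_abs, abs_le]
      constructor <;> linarith [Int.floor_le (x a), Int.lt_floor_add_one (x a)]
    refine (hK K le_rfl _).trans_lt ?_
    calc _ ≤ ε / (S + 1) * S := by gcongr
      _ < ε / (S + 1) * (S + 1) := by gcongr; linarith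
      _ = ε := div_mul_cancel₀ _ (by positivity)

omit [FiniteDimensional ℝ F] [DiscreteTopology A] in
/-- Every height is attained by the broken line up to a bounded error. -/
theorem exists_abs_sub_abPrefix_le (h : PisotSetting σ β l u V N) :
    ∃ C, ∀ t : ℝ, ∃ n, |t - ∑ a, l a * abPrefix u n a| ≤ C := by
  have hA : (Finset.univ : Finset A).Nonempty := ⟨u 0, Finset.mem_univ _⟩
  obtain ⟨a₁, -, ha₁⟩ := Finset.exists_min_image Finset.univ l hA
  set m := l a₁
  have hm0 : 0 < m := h.perron.1 a₁
  set f : ℤ → ℝ := fun n => ∑ a, l a * abPrefix u n a with hf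
  have hf0 : f 0 = 0 := by simp [hf, abPrefix_zero]
  have hfs : ∀ n, f (n + 1) = f n + l (u n) := by
    intro n
    simp [hf, abPrefix_succ, mul_add, Finset.sum_add_distrib, Pi.single_apply]
  have hstep : ∀ (n : ℤ) (j : ℕ), f n + j * m ≤ f (n + j) := by
    intro n j
    induction j with
    | zero => simp
    | succ j ih =>
      have := hfs (n + j)
      have h2 := ha₁ (u (n + j)) (Finset.mem_univ _)
      push_cast
      rw [← add_assoc, this]
      linarith
  refine ⟨∑ a, l a, fun t => ?_⟩
  have hbdd : ∃ b : ℤ, ∀ n, f n ≤ t → n ≤ b := by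
    refine ⟨⌈|t| / m⌉, fun n hn => ?_⟩
    rcases le_total n 0 with h0 | h0
    · exact h0.trans (Int.ceil_nonneg (by positivity))
    · lift n to ℕ using h0
      have h1 := hstep 0 n
      rw [hf0, zero_add, zero_add] at h1
      have h2 : (n : ℝ) ≤ |t| / m := by
        rw [le_div_iff₀ hm0]
        linarith [le_abs_self t]
      exact_mod_cast h2.trans (Int.le_ceil _)
  have hne : ∃ n, f n ≤ t := by
    obtain ⟨j, hj⟩ := exists_nat_ge (|t| / m)
    refine ⟨-j, ?_⟩
    have h1 := hstep (-j) j
    rw [neg_add_cancel, hf0] at h1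
    rw [div_le_iff₀ hm0] at hj
    linarith [neg_abs_le t]
  obtain ⟨n, hn, hmax⟩ := Int.exists_greatest_of_bdd hbdd hne
  refine ⟨n, ?_⟩
  have h1 : t < f (n + 1) := by
    by_contra hc
    have := hmax _ (not_lt.1 hc)
    omega
  rw [hfs] at h1
  have h2 := Finset.single_le_sum (f := l) (fun a _ => (h.perron.1 a).le) (Finset.mem_univ (u n))
  change |t - f n| ≤ _
  rw [abs_of_nonneg (by linarith)]
  linarith

/-- The projections of all integer vectors lie in the translates of the fractal by the vectors of a
locally finite set. By density these translates cover the space, so that by Baire's theorem the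
fractal has an interior point. -/
theorem exists_nonempty_interior_piece (h : PisotSetting σ β l u V N) :
    ∃ a, (interior (piece σ V u a)).Nonempty := by
  obtain ⟨C, hC⟩ := h.exists_abs_sub_abPrefix_le
  obtain ⟨D, hD⟩ := h.exists_norm_abPrefix_le
  set Y : Set F := {y | ∃ x ∈ intVec A, y = V x ∧ |∑ a, l a * x a| ≤ C} with hY
  have hint : (intVec A : Set (A → ℝ)).Countable := by
    have : (intVec A : Set (A → ℝ)) = Set.range fun (n : A → ℤ) a => (n a : ℝ) := by
      ext x
      exact ⟨fun ⟨n, hn⟩ => ⟨n, hn.symm⟩, fun ⟨n, hn⟩ => ⟨n, hn.symm⟩⟩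
    rw [this]
    exact Set.countable_range _
  have hYc : Countable Y := by
    refine ((hint.image V).mono ?_).to_subtype
    rintro _ ⟨x, hx, rfl, -⟩
    exact ⟨x, hx, rfl⟩
  have hcl : ∀ q : A × Y, IsClosed ((fun x => x + (q.2 : F)) '' piece σ V u q.1) := fun q =>
    ((h.isCompact_piece q.1).image (continuous_id.add continuous_const)).isClosed
  have hlat : ∀ x ∈ intVec A, ∃ y ∈ Y, ‖y‖ ≤ ‖V x‖ + D ∧
      ∃ a, V x ∈ (fun z => z + y) '' piece σ V u a := by
    intro x hx
    obtain ⟨n, hn⟩ := hC (∑ a, l a * x a)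
    refine ⟨V (x - abPrefix u n), ⟨x - abPrefix u n, sub_mem hx ?_, rfl, ?_⟩, ?_, u n,
      V (abPrefix u n), ⟨shiftPow n u, ⟨Substitution.shiftPow_mem_subshift h.mem n, ?_⟩,
      h.rauzyMap_shiftPow_fixed n⟩, ?_⟩
    · exact exists_int_abPrefix u n
    · simpa [mul_sub, Finset.sum_sub_distrib] using hn
    · rw [map_sub]
      exact (norm_sub_le _ _).trans (add_le_add le_rfl (hD n))
    · simp [shiftPow]
    · simp [map_sub]
  have huniv : ⋃ q : A × Y, (fun x => x + (q.2 : F)) '' piece σ V u q.1 = Set.univ := by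
    rw [Set.eq_univ_iff_forall]
    intro y₀
    set r := max C (‖y₀‖ + 1 + D) with hr
    set Yr : Set F := {y | y ∈ Y ∧ ‖y‖ ≤ ‖y₀‖ + 1 + D} with hYr
    have hfin : Yr.Finite := by
      refine (h.proj.finite r).subset ?_
      rintro _ ⟨⟨x, hx, rfl, h1⟩, h2⟩
      exact ⟨x, hx, rfl, h2.trans (le_max_right _ _), h1.trans (le_max_left _ _)⟩
    have hcl2 : IsClosed (⋃ y ∈ Yr, ⋃ a, (fun x => x + y) '' piece σ V u a) :=
      hfin.isClosed_biUnion fun y hy => isClosed_iUnion_of_finite fun a => hcl (a, ⟨y, hy.1⟩)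
    have hmem : y₀ ∈ closure (⋃ y ∈ Yr, ⋃ a, (fun x => x + y) '' piece σ V u a) := by
      rw [Metric.mem_closure_iff]
      intro ε hε
      obtain ⟨x, hx, hlt⟩ := h.exists_intVec_norm_sub_lt y₀ (lt_min hε one_pos)
      obtain ⟨y, hy, hyn, a, ha⟩ := hlat x hx
      refine ⟨V x, Set.mem_biUnion (x := y) ⟨hy, ?_⟩ (Set.mem_iUnion.2 ⟨a, ha⟩), ?_⟩
      · have h1 : ‖V x‖ ≤ ‖y₀‖ + 1 := by
          have := norm_le_norm_add_norm_sub' (V x) y₀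
          linarith [hlt.le.trans (min_le_right ε 1)]
        linarith
      · rw [dist_comm, dist_eq_norm]
        exact hlt.trans_le (min_le_left _ _)
    rw [hcl2.closure_eq] at hmem
    obtain ⟨y, hy, hmem⟩ := Set.mem_iUnion₂.1 hmem
    obtain ⟨a, ha⟩ := Set.mem_iUnion.1 hmem
    exact Set.mem_iUnion.2 ⟨(a, ⟨y, hy.1⟩), ha⟩
  obtain ⟨⟨a, y⟩, hq⟩ := nonempty_interior_of_iUnion_of_closed hcl huniv
  refine ⟨a, ?_⟩
  have := (Homeomorph.addRight (y : F)).image_interior (piece σ V u a)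
  change (interior (Homeomorph.addRight (y : F) '' piece σ V u a)).Nonempty at hq
  rw [← this] at hq
  exact Set.image_nonempty.1 hq

theorem interior_subpiece_nonempty (h : PisotSetting σ β l u V N) (k : ℕ) {b : A}
    (p : Occ (σ.pow k) b) (hp : (interior (piece σ V u p.1.1)).Nonempty) :
    (interior (subpiece σ V N u k p)).Nonempty := by
  obtain ⟨e, he⟩ := h.exists_homeomorph k
    (V (abList (((σ.pow k).img p.1.1).take p.1.2)))
  rw [subpiece, ← funext he, ← e.image_interior]
  exact hp.image e

theorem nonempty_interior_piece (h : PisotSetting σ β l u V N) (b : A) :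
    (interior (piece σ V u b)).Nonempty := by
  obtain ⟨a, ha⟩ := h.exists_nonempty_interior_piece
  obtain ⟨k, hk⟩ := h.exists_occ_pow
  obtain ⟨p, rfl⟩ := hk a b
  exact (h.interior_subpiece_nonempty k p ha).mono (interior_mono (h.subpiece_subset k p))

theorem closure_interior_piece (h : PisotSetting σ β l u V N) (b : A) :
    closure (interior (piece σ V u b)) = piece σ V u b := by
  refine Set.Subset.antisymm
    ((h.isCompact_piece b).isClosed.closure_subset_iff.2 interior_subset) fun x hx => ?_
  rw [Metric.mem_closure_iff]
  intro ε hε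
  obtain ⟨k, hk⟩ := h.exists_dist_lt hε
  rw [h.piece_eq_iUnion k b] at hx
  obtain ⟨p, hp⟩ := Set.mem_iUnion.1 hx
  obtain ⟨y, hy⟩ := h.interior_subpiece_nonempty k p (h.nonempty_interior_piece _)
  exact ⟨y, interior_mono (h.subpiece_subset k p) hy, hk b p x hp y (interior_subset hy)⟩

/-! ### Measures of the pieces -/

variable [MeasureSpace F] [BorelSpace F] [(volume : Measure F).IsAddHaarMeasure]

omit [FiniteDimensional ℝ F] [NormedSpace ℝ F] in
theorem volume_image_add_right (t : F) (s : Set F) :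
    volume ((fun x => x + t) '' s) = volume s := by
  rw [Set.image_add_right, measure_preimage_add_right]

theorem volume_image_pow_add (k : ℕ) (t : F) (s : Set F) :
    volume ((fun x => (N ^ k) x + t) '' s) =
      ENNReal.ofReal |LinearMap.det (N ^ k)| * volume s := by
  rw [← Measure.addHaar_image_linearMap, ← volume_image_add_right t ((N ^ k) '' s),
    Set.image_image]

theorem measureReal_image_pow_add (k : ℕ) (t : F) (s : Set F) :
    volume.real ((fun x => (N ^ k) x + t) '' s) =
      |LinearMap.det (N ^ k)| * volume.real s := by
  rw [measureReal_def, volume_image_pow_add, ENNReal.toReal_mul,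
    ENNReal.toReal_ofReal (abs_nonneg _), measureReal_def]

/-- If the numbers `x b` behave like measures that are subadditive under the subdivision of the
pieces, then they are additive: they satisfy `β^k x ≤ M^k x`, and equality holds by the pairing with
the left eigenvector. -/
theorem sum_subdivision_eq (h : PisotSetting σ β l u V N) (k : ℕ) {x : A → ℝ}
    (hx : ∀ b, x b ≤ ∑ p : Occ (σ.pow k) b, |LinearMap.det (N ^ k)| * x p.1.1) (b : A) :
    ∑ p : Occ (σ.pow k) b, |LinearMap.det (N ^ k)| * x p.1.1 = x b := by
  have hdet := h.abs_det_pow k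
  have hβ : 0 < β ^ k := pow_pos (by linarith [h.one_lt]) k
  have hsum : ∀ b, ∑ p : Occ (σ.pow k) b, |LinearMap.det (N ^ k)| * x p.1.1 =
      |LinearMap.det (N ^ k)| * toEnd (σ.incidence ^ k) x b := by
    intro b
    rw [← Finset.mul_sum, sum_occ, toEnd_apply, σ.incidence_pow]
    simp [nsmul_eq_mul]
  have h1 : β ^ k • x ≤ toEnd (σ.incidence ^ k) x := by
    intro b
    have h2 := mul_le_mul_of_nonneg_left (hx b) hβ.le
    rw [hsum, ← mul_assoc, mul_comm (β ^ k) |_|, hdet, one_mul] at h2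
    simpa [mul_comm] using h2
  rw [hsum, (h.perron.pow k).eq_of_le h1]
  simp only [Pi.smul_apply, smul_eq_mul]
  rw [← mul_assoc, hdet, one_mul]

theorem volume_piece_ne_top (h : PisotSetting σ β l u V N) (a : A) :
    volume (piece σ V u a) ≠ ⊤ := (h.isCompact_piece a).measure_lt_top.ne

theorem isCompact_subpiece (h : PisotSetting σ β l u V N) (k : ℕ) {b : A} (p : Occ (σ.pow k) b) :
    IsCompact (subpiece σ V N u k p) :=
  (h.isCompact_piece _).image
    ((LinearMap.continuous_of_finiteDimensional (N ^ k)).add continuous_const)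

/-- The parts of a piece are disjoint up to null sets. -/
theorem aedisjoint_subpiece (h : PisotSetting σ β l u V N) (k : ℕ) (b : A) :
    Pairwise fun p q : Occ (σ.pow k) b =>
      AEDisjoint volume (subpiece σ V N u k p) (subpiece σ V N u k q) := by
  refine aedisjoint_of_sum_measureReal_le
    (fun p => (h.isCompact_subpiece k p).isClosed.measurableSet)
    (fun p => (h.isCompact_subpiece k p).measure_lt_top.ne) ?_
  rw [← h.piece_eq_iUnion k b]
  have h1 := h.sum_subdivision_eq k (x := fun a => volume.real (piece σ V u a)) ?_ b
  · rw [← h1]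
    refine Finset.sum_le_sum fun p _ => ?_
    rw [subpiece, measureReal_image_pow_add]
  · intro b
    rw [h.piece_eq_iUnion k b]
    refine (measureReal_iUnion_fintype_le _).trans (Finset.sum_le_sum fun p _ => ?_)
    rw [subpiece, measureReal_image_pow_add]

theorem null_of_null_image (h : PisotSetting σ β l u V N) (k : ℕ) (t : F) {s : Set F}
    (hs : volume ((fun x => (N ^ k) x + t) '' s) = 0) : volume s = 0 := by
  rw [volume_image_pow_add] at hs
  refine (mul_eq_zero.1 hs).resolve_left ?_
  rw [ENNReal.ofReal_eq_zero, not_le]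
  exact abs_pos.2 (h.det_ne_zero k)

theorem aedisjoint_of_image (h : PisotSetting σ β l u V N) (k : ℕ) (t : F) {s s' : Set F}
    (hs : AEDisjoint volume ((fun x => (N ^ k) x + t) '' s) ((fun x => (N ^ k) x + t) '' s')) :
    AEDisjoint volume s s' :=
  h.null_of_null_image k t (measure_mono_null (Set.image_inter_subset _ _ _) hs)

/-- The words `σ(a)` have a common first letter `a₀`, so that one piece contains copies of all the
pieces, by one and the same affine map. These copies are disjoint up to null sets. -/
theorem aedisjoint_piece (h : PisotSetting σ β l u V N) :
    Pairwise fun a b => AEDisjoint volume (piece σ V u a) (piece σ V u b) := by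
  intro a b hab
  obtain ⟨a₀, ha₀⟩ := h.proper.1
  have hocc : ∀ c, ((σ.pow 1).img c)[0]'((σ.pow 1).length_img_pos c) = a₀ := by
    intro c
    have h2 := ha₀ c
    rw [List.head?_eq_getElem?, List.getElem?_eq_getElem (σ.length_img_pos _),
      Option.some_inj] at h2
    simpa only [σ.pow_one] using h2
  let p : A → Occ (σ.pow 1) a₀ := fun c => ⟨⟨c, ⟨0, (σ.pow 1).length_img_pos c⟩⟩, hocc c⟩
  have hp : ∀ c, subpiece σ V N u 1 (p c) = (fun x => (N ^ 1) x + 0) '' piece σ V u c := by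
    intro c
    simp [subpiece, p, abList]
  have h1 := h.aedisjoint_subpiece 1 a₀ (i := p a) (j := p b)
    (fun hc => hab (congrArg (fun q : Occ (σ.pow 1) a₀ => q.1.1) hc))
  simp only [hp] at h1
  exact h.aedisjoint_of_image 1 0 h1

/-- The words `σ(a)` have a common last letter, so that one piece contains copies of all the
translated pieces `R_a + V e_a`, by one and the same affine map. -/
theorem aedisjoint_translate (h : PisotSetting σ β l u V N) :
    Pairwise fun a b => AEDisjoint volume ((fun x => x + V (Pi.single a 1)) '' piece σ V u a)
      ((fun x => x + V (Pi.single b 1)) '' piece σ V u b) := by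
  intro a b hab
  obtain ⟨b₀, hb₀⟩ := h.proper.2
  have hlen : ∀ c, ((σ.pow 1).img c).length - 1 < ((σ.pow 1).img c).length := fun c =>
    Nat.sub_one_lt ((σ.pow 1).length_img_pos c).ne'
  have hocc : ∀ c, ((σ.pow 1).img c)[((σ.pow 1).img c).length - 1]'(hlen c) = b₀ := by
    intro c
    have h2 := hb₀ c
    rw [← σ.pow_one, List.getLast?_eq_getElem?, List.getElem?_eq_getElem (hlen c),
      Option.some_inj] at h2
    exact h2
  let p : A → Occ (σ.pow 1) b₀ := fun c => ⟨⟨c, ⟨_, hlen c⟩⟩, hocc c⟩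
  have hp : ∀ c, subpiece σ V N u 1 (p c) = (fun x => (N ^ 1) x + -V (Pi.single b₀ 1)) ''
      ((fun x => x + V (Pi.single c 1)) '' piece σ V u c) := by
    intro c
    have h1 : abList (((σ.pow 1).img c).take (((σ.pow 1).img c).length - 1)) +
        Pi.single b₀ 1 = toEnd σ.incidence (Pi.single c 1) := by
      have h2 : ((σ.pow 1).img c).take (((σ.pow 1).img c).length - 1) ++ [b₀] =
          (σ.pow 1).img c := by
        conv_rhs => rw [← List.take_append_drop (((σ.pow 1).img c).length - 1) ((σ.pow 1).img c)]
        rw [List.drop_eq_getElem_cons (hlen c), hocc, List.drop_of_length_le (by omega)]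
      have h3 : toEnd σ.incidence (Pi.single c 1) = abList ((σ.pow 1).img c) := by
        rw [σ.pow_one, abList_img]
      rw [h3]
      conv_rhs => rw [← h2]
      simp [abList]
    rw [Set.image_image]
    simp only [subpiece, p]
    congr 1
    funext x
    rw [map_add, _root_.pow_one, h.proj.comm, ← h1, map_add]
    abel
  have h1 := h.aedisjoint_subpiece 1 b₀ (i := p a) (j := p b)
    (fun hc => hab (congrArg (fun q : Occ (σ.pow 1) b₀ => q.1.1) hc))
  simp only [hp] at h1
  exact h.aedisjoint_of_image 1 _ h1

/-- A piece is the closure of its interior, so that disjointness up to null sets is disjointness in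
the interior. -/
theorem disjoint_interior_piece (h : PisotSetting σ β l u V N) {a b : A} (hab : a ≠ b) :
    Disjoint (interior (piece σ V u a)) (piece σ V u b) := by
  rw [← h.closure_interior_piece b]
  refine Disjoint.closure_right ?_ isOpen_interior
  rw [Set.disjoint_iff_inter_eq_empty]
  by_contra hne
  have hpos := (isOpen_interior.inter isOpen_interior).measure_pos volume
    (Set.nonempty_iff_ne_empty.2 hne)
  exact hpos.ne' (measure_mono_null (Set.inter_subset_inter interior_subset interior_subset)
    (h.aedisjoint_piece hab))

/-- The boundary of `R_b` is covered by the boundaries of its parts. For a large power of the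
substitution one of the parts lies in the interior of `R_b` and is not needed for the cover, which
is only possible if the boundaries are null sets. -/
theorem volume_frontier_piece (h : PisotSetting σ β l u V N) (b : A) :
    volume (frontier (piece σ V u b)) = 0 := by
  set f : A → ℝ := fun a => volume.real (frontier (piece σ V u a)) with hf
  have hfr : ∀ a, volume (frontier (piece σ V u a)) ≠ ⊤ := fun a =>
    ne_top_of_le_ne_top (h.volume_piece_ne_top a)
      (measure_mono (h.isCompact_piece a).isClosed.frontier_subset)
  have hsub : ∀ (k : ℕ) b (p : Occ (σ.pow k) b), volume.real (frontier (subpiece σ V N u k p)) =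
      |LinearMap.det (N ^ k)| * f p.1.1 := by
    intro k b p
    obtain ⟨e, he⟩ := h.exists_homeomorph k (V (abList (((σ.pow k).img p.1.1).take p.1.2)))
    rw [subpiece, ← funext he, ← e.image_frontier, funext he, measureReal_image_pow_add]
  have hsubfin : ∀ (k : ℕ) b (p : Occ (σ.pow k) b),
      volume (frontier (subpiece σ V N u k p)) ≠ ⊤ := fun k b p =>
    ne_top_of_le_ne_top (h.isCompact_subpiece k p).measure_lt_top.ne
      (measure_mono (h.isCompact_subpiece k p).isClosed.frontier_subset)
  have hcover : ∀ (k : ℕ) b, f b ≤ ∑ p : Occ (σ.pow k) b,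
      volume.real (frontier (subpiece σ V N u k p) \ interior (piece σ V u b)) := by
    intro k b
    refine le_trans (measureReal_mono (fun x hx => ?_) ?_) (measureReal_iUnion_fintype_le _)
    · rw [(h.isCompact_piece b).isClosed.frontier_eq] at hx
      have hx1 := hx.1
      rw [h.piece_eq_iUnion k b] at hx1
      obtain ⟨p, hp⟩ := Set.mem_iUnion.1 hx1
      refine Set.mem_iUnion.2 ⟨p, ?_, hx.2⟩
      rw [(h.isCompact_subpiece k p).isClosed.frontier_eq]
      exact ⟨hp, fun hi => hx.2 (interior_mono (h.subpiece_subset k p) hi)⟩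
    · refine ne_top_of_le_ne_top (h.volume_piece_ne_top b) (measure_mono ?_)
      exact Set.iUnion_subset fun p => Set.sdiff_subset.trans
        ((h.isCompact_subpiece k p).isClosed.frontier_subset.trans (h.subpiece_subset k p))
  have hle : ∀ (k : ℕ) b, ∀ p : Occ (σ.pow k) b,
      volume.real (frontier (subpiece σ V N u k p) \ interior (piece σ V u b)) ≤
        |LinearMap.det (N ^ k)| * f p.1.1 := fun k b p => by
    rw [← hsub]
    exact measureReal_mono Set.sdiff_subset (hsubfin k b p)
  have heq : ∀ (k : ℕ) b, ∑ p : Occ (σ.pow k) b, |LinearMap.det (N ^ k)| * f p.1.1 = f b :=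
    fun k => h.sum_subdivision_eq k fun b =>
      (hcover k b).trans (Finset.sum_le_sum fun p _ => hle k b p)
  have hf0 : ∀ a, 0 ≤ f a := fun a => measureReal_nonneg
  have hzero : ∀ (k : ℕ) b (p : Occ (σ.pow k) b), |LinearMap.det (N ^ k)| * f p.1.1 ≤ 0 →
      f p.1.1 = 0 := fun k b p hp => by
    have h1 := abs_pos.2 (h.det_ne_zero k)
    exact le_antisymm (nonpos_of_mul_nonpos_right hp h1) (hf0 _)
  -- a part inside the interior of `R_b` contributes nothing to the cover but its measure to `heq`
  obtain ⟨a', ha'⟩ : ∃ a', f a' = 0 := by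
    obtain ⟨x, hx⟩ := h.nonempty_interior_piece b
    obtain ⟨ε, hε, hball⟩ := Metric.isOpen_iff.1 isOpen_interior x hx
    obtain ⟨k, hk⟩ := h.exists_dist_lt hε
    have hx1 := interior_subset hx
    rw [h.piece_eq_iUnion k b] at hx1
    obtain ⟨p, hp⟩ := Set.mem_iUnion.1 hx1
    have hp0 : frontier (subpiece σ V N u k p) \ interior (piece σ V u b) = ∅ := by
      rw [Set.sdiff_eq_empty]
      refine (h.isCompact_subpiece k p).isClosed.frontier_subset.trans fun y hy => hball ?_
      exact hk b p y hy x hp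
    refine ⟨p.1.1, hzero k b p ?_⟩
    have h1 := hcover k b
    rw [← heq k b, ← Finset.add_sum_erase _ _ (Finset.mem_univ p),
      ← Finset.add_sum_erase _ _ (Finset.mem_univ p), hp0, measureReal_empty, zero_add] at h1
    have h2 := Finset.sum_le_sum fun q (_ : q ∈ Finset.univ.erase p) => hle k b q
    linarith
  -- the vector `f` is an eigenvector of a positive matrix, so that one zero entry forces all
  obtain ⟨k, hk⟩ := h.exists_occ_pow
  obtain ⟨p, hp⟩ := hk b a'
  have h1 := heq k a'
  rw [ha'] at h1
  have h2 := (Finset.sum_eq_zero_iff_of_nonneg fun q _ =>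
    mul_nonneg (abs_nonneg _) (hf0 _)).1 h1 p (Finset.mem_univ p)
  have h3 := hzero k a' p h2.le
  rw [hp] at h3
  exact (measureReal_eq_zero_iff (hfr b)).1 h3

end PisotSetting
end piece

/-! ### Unique ergodicity -/

section ergodic
variable {A : Type*}

/-- The sum of `g` along the part of the orbit of `τ(w)` that belongs to the block `τ(w_0)`. -/
noncomputable def blockSum (τ : Substitution A) (g : (ℤ → A) → ℝ) (w : ℤ → A) : ℝ :=
  ∑ j ∈ Finset.range (τ.img (w 0)).length, g (shiftPow j (τ.onWord w))

/-- The sum over an orbit segment that consists of blocks. -/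
theorem intSum_pos (τ : Substitution A) (g : (ℤ → A) → ℝ) (w : ℤ → A) (n : ℤ) :
    intSum (fun i => g (shiftPow i (τ.onWord w))) (τ.pos w n) =
      intSum (fun m => blockSum τ g (shiftPow m w)) n := by
  refine eq_intSum (g := fun n => intSum (fun i => g (shiftPow i (τ.onWord w))) (τ.pos w n))
    (by simp) (fun n => ?_) n
  rw [τ.pos_succ, intSum_add_natCast]
  congr 1
  simp only [blockSum, τ.onWord_shiftPow, shiftPow_shiftPow]
  simp [shiftPow]

theorem blockSum_eq_intSum (τ : Substitution A) (g : (ℤ → A) → ℝ) (w : ℤ → A) :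
    blockSum τ g w = intSum (fun i => g (shiftPow i (τ.onWord w))) (τ.pos w 1) := by
  rw [intSum_pos]
  have := intSum_succ (fun m => blockSum τ g (shiftPow m w)) 0
  simpa using this.symm

/-- A block of `τ ∘ ρ` consists of blocks of `τ`. -/
theorem blockSum_comp (τ ρ : Substitution A) (g : (ℤ → A) → ℝ) (w : ℤ → A) :
    blockSum (τ.comp ρ) g w = ∑ m ∈ Finset.range (ρ.img (w 0)).length,
      blockSum τ g (shiftPow m (ρ.onWord w)) := by
  rw [blockSum_eq_intSum, τ.onWord_comp, τ.pos_comp, intSum_pos]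
  have := ρ.pos_succ w 0
  rw [ρ.pos_zero, zero_add, zero_add] at this
  rw [this, intSum_natCast]

/-- The block sums of a function of the letter `w_0` are given by the transposed incidence matrix. -/
theorem blockSum_letter [Fintype A] [DecidableEq A] (τ : Substitution A) (x : A → ℝ) (w : ℤ → A) :
    blockSum τ (fun v => x (v 0)) w = ∑ b, (τ.incidence b (w 0) : ℝ) * x b := by
  have := τ.sum_block x w 0
  simp only [τ.pos_zero, zero_add, nsmul_eq_mul] at this
  rw [← this]
  simp [blockSum, shiftPow]

theorem shiftPow_natCast (n : ℕ) : (shiftPow (n : ℤ) : (ℤ → A) → ℤ → A) = shift^[n] := by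
  induction n with
  | zero => funext w; simp
  | succ n ih =>
    rw [Function.iterate_succ', ← ih]
    funext w
    simp [shift, shiftPow_shiftPow]

/-- If the sums of `g` along the orbits grow sublinearly and uniformly, then `g` has integral `0` for
every invariant probability measure. -/
theorem integral_eq_zero_of_sublinear [MeasurableSpace A] {Ω : Set (ℤ → A)}
    {μ : Measure (ℤ → A)} (hμ : IsInvariantProb Ω μ) {g : (ℤ → A) → ℝ} (hg : Measurable g) {B : ℝ}
    (hB : ∀ w, |g w| ≤ B)
    (h : ∀ ε > 0, ∃ C, ∀ w ∈ Ω, ∀ n : ℕ, |∑ i ∈ Finset.range n, g (shiftPow i w)| ≤ ε * n + C) :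
    ∫ w, g w ∂μ = 0 := by
  have : IsProbabilityMeasure μ := hμ.1
  have hshift : Measurable (shift : (ℤ → A) → ℤ → A) :=
    measurable_pi_lambda _ fun i => measurable_pi_apply (i + 1)
  have hmp : MeasurePreserving (shift : (ℤ → A) → ℤ → A) μ μ := ⟨hshift, hμ.2.2⟩
  have hcomp : ∀ i : ℕ, ∫ w, g (shiftPow i w) ∂μ = ∫ w, g w ∂μ := by
    intro i
    have h1 := hmp.iterate i
    conv_rhs => rw [← h1.map_eq]
    rw [integral_map h1.measurable.aemeasurable hg.aestronglyMeasurable, shiftPow_natCast]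
  have hint : ∀ i : ℕ, Integrable (fun w => g (shiftPow i w)) μ := by
    intro i
    have h1 := (hmp.iterate i).measurable
    rw [← shiftPow_natCast] at h1
    exact Integrable.of_bound (hg.comp h1).aestronglyMeasurable B
      (Eventually.of_forall fun w => hB _)
  have hae : ∀ᵐ w ∂μ, w ∈ Ω := by
    rw [ae_iff]; exact hμ.2.1
  rw [← abs_eq_zero]
  refine le_antisymm (le_of_forall_pos_le_add fun ε hε => ?_) (abs_nonneg _)
  obtain ⟨C, hC⟩ := h (ε / 2) (half_pos hε)
  have hn : ∀ n : ℕ, n * |∫ w, g w ∂μ| ≤ ε / 2 * n + C := by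
    intro n
    have h1 : (n : ℝ) * ∫ w, g w ∂μ = ∫ w, ∑ i ∈ Finset.range n, g (shiftPow i w) ∂μ := by
      rw [integral_finsetSum _ fun i _ => hint i]
      simp [hcomp]
    calc n * |∫ w, g w ∂μ| = ‖∫ w, ∑ i ∈ Finset.range n, g (shiftPow i w) ∂μ‖ := by
          rw [← h1, norm_mul]; simp
      _ ≤ (ε / 2 * n + C) * μ.real Set.univ :=
          norm_integral_le_of_norm_le_const (hae.mono fun w hw => hC w hw n)
      _ = _ := by simp
  obtain ⟨n, hn'⟩ := exists_nat_gt (C / (ε / 2))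
  have hn1 := hn (n + 1)
  rw [div_lt_iff₀ (half_pos hε)] at hn'
  push_cast at hn1
  have hpos : (0 : ℝ) < n + 1 := by positivity
  rw [zero_add]
  by_contra hc
  rw [not_le] at hc
  have := mul_lt_mul_of_pos_left hc hpos
  nlinarith

end ergodic

namespace PisotSetting
variable {A : Type*} [Fintype A] [DecidableEq A] [TopologicalSpace A]
  {F : Type*} [NormedAddCommGroup F] [NormedSpace ℝ F]
  {σ : Substitution A} {β : ℝ} {l : A → ℝ} {u : ℤ → A} {V : (A → ℝ) →ₗ[ℝ] F} {N : F →ₗ[ℝ] F}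
  [FiniteDimensional ℝ F] [DiscreteTopology A]

/-- Small sums over the blocks of `σ^k` lead to small sums along all orbits. -/
theorem exists_abs_sum_le (h : PisotSetting σ β l u V N) {g : (ℤ → A) → ℝ} {B ε : ℝ}
    (hB : ∀ w, |g w| ≤ B) (hε : 0 ≤ ε) (k : ℕ)
    (hblk : ∀ w, |blockSum (σ.pow k) g w| ≤ ε * ((σ.pow k).img (w 0)).length) :
    ∃ C, ∀ w ∈ σ.subshift, ∀ n : ℕ,
      |∑ i ∈ Finset.range n, g (shiftPow i w)| ≤ ε * n + C := by
  set τ := σ.pow k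
  set D : ℕ := ∑ a, (τ.img a).length with hD
  have hDle : ∀ a, (τ.img a).length ≤ D := fun a =>
    Finset.single_le_sum (f := fun a => (τ.img a).length) (fun _ _ => Nat.zero_le _)
      (Finset.mem_univ a)
  have hB0 : 0 ≤ B := (abs_nonneg _).trans (hB u)
  refine ⟨ε * D + 2 * (D * B), fun w hw n => ?_⟩
  obtain ⟨w', hw', j, hj, rfl⟩ := h.exists_eq_shiftPow_onWord_pow hw k
  set G : ℤ → ℝ := fun i => g (shiftPow i (τ.onWord w')) with hG
  have hpart : ∀ (m : ℤ) (r : ℕ), r ≤ D → |∑ i ∈ Finset.range r, G (m + i)| ≤ D * B := by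
    intro m r hr
    calc _ ≤ ∑ i ∈ Finset.range r, |G (m + i)| := Finset.abs_sum_le_sum_abs _ _
      _ ≤ ∑ i ∈ Finset.range r, B := Finset.sum_le_sum fun i _ => hB _
      _ = r * B := by simp
      _ ≤ D * B := by gcongr
  have h1 : ∑ i ∈ Finset.range n, g (shiftPow i (shiftPow j (τ.onWord w'))) =
      intSum G (j + n) - intSum G j := by
    rw [intSum_add_natCast, add_sub_cancel_left]
    simp only [shiftPow_shiftPow, hG]
  have h2 : |intSum G j| ≤ D * B := by
    have := hpart 0 j (hj.le.trans (hDle _))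
    rw [intSum_natCast]
    simpa using this
  obtain ⟨m, i, hi, hmi⟩ := τ.exists_pos_add w' (j + n)
  have hm0 : 0 ≤ m := by
    by_contra hc
    have h3 := τ.pos_le w' (n := m + 1) (by omega)
    rw [τ.pos_succ] at h3
    omega
  lift m to ℕ using hm0
  have h3 : |intSum G (τ.pos w' m)| ≤ ε * τ.pos w' m := by
    rw [hG, intSum_pos, intSum_natCast, Substitution.pos, intSum_natCast]
    push_cast
    rw [Finset.mul_sum]
    refine (Finset.abs_sum_le_sum_abs _ _).trans (Finset.sum_le_sum fun q _ => ?_)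
    have := hblk (shiftPow q w')
    simpa [shiftPow] using this
  have h4 : ((τ.pos w' m : ℤ) : ℝ) ≤ n + D := by
    have : τ.pos w' m ≤ ((n + D : ℕ) : ℤ) := by
      have := hj.le.trans (hDle _)
      push_cast; omega
    exact_mod_cast this
  have h5 := hpart (τ.pos w' m) i (hi.le.trans (hDle _))
  rw [h1, hmi, intSum_add_natCast]
  have h6 := mul_le_mul_of_nonneg_left h4 hε
  rw [abs_le] at *
  constructor <;> linarith

/-- As `σ` is proper, the words `σ^k(w)` near the block `σ^k(w_0)` depend on the letter `w_0` only,
and so do the sums of a local function over this block. -/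
theorem exists_blockSum_eq (h : PisotSetting σ β l u V N) {f : (ℤ → A) → ℝ} {L : ℕ}
    (hf : ∀ w w' : ℤ → A, (∀ i, |i| ≤ (L : ℤ) → w i = w' i) → f w = f w') :
    ∃ (K : ℕ) (x : A → ℝ), ∀ w, blockSum (σ.pow K) f w = x (w 0) := by
  obtain ⟨K, hK⟩ := h.exists_le_length (L + 1)
  have hlen := hK K le_rfl
  refine ⟨K + 1, fun a => blockSum (σ.pow (K + 1)) f fun _ => a, fun w => ?_⟩
  set w' : ℤ → A := fun _ => w 0 with hw'
  set τ := σ.pow K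
  set p : ℕ := (σ.img (w 0)).length with hp
  have hpos1 : σ.pos w 1 = p := by simpa using σ.pos_succ w 0
  have hpos1' : σ.pos w' 1 = p := by simpa [hw'] using σ.pos_succ w' 0
  have hagree : ∀ i, -1 ≤ i → i < (p : ℤ) + 1 → σ.onWord w i = σ.onWord w' i := by
    intro i hi hi'
    rcases lt_or_ge i 0 with h0 | h0
    · obtain rfl : i = -1 := by omega
      have := σ.onWord_pos_sub_one_eq h.proper w w' 0 0
      simpa using this
    · rcases lt_or_ge i p with h1 | h1
      · refine σ.onWord_congr (k := 0) (m := 0) (n := 1) (by simp) le_rfl zero_le_one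
          (fun j hj hj' => ?_) i (by simpa using h0) (by omega)
        obtain rfl : j = 0 := by omega
        rfl
      · obtain rfl : i = p := by omega
        have := σ.onWord_pos_eq h.proper w w' 1 1
        rwa [hpos1, hpos1'] at this
  have hpos : τ.pos (σ.onWord w) p = ((σ.pow (K + 1)).img (w 0)).length := by
    have h1 := τ.pos_comp σ w 1
    rw [hpos1] at h1
    rw [← h1]
    have := (σ.pow (K + 1)).pos_succ w 0
    rw [Substitution.pos_zero, zero_add, zero_add] at this
    exact this
  simp only [blockSum]
  refine Finset.sum_congr rfl fun j hj => hf _ _ fun i hi => ?_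
  rw [Finset.mem_range] at hj
  rw [σ.onWord_pow_succ, σ.onWord_pow_succ]
  change τ.onWord (σ.onWord w) (i + j) = τ.onWord (σ.onWord w') (i + j)
  have h1 := τ.pos_succ (σ.onWord w) (-1)
  have h2 := τ.pos_succ (σ.onWord w) p
  have h3 := hlen (σ.onWord w (-1))
  have h4 := hlen (σ.onWord w p)
  rw [neg_add_cancel, τ.pos_zero] at h1
  have hi' := abs_le.1 hi
  exact τ.onWord_congr (k := 0) (m := -1) (n := p + 1) (by simp) (by norm_num) (by positivity)
    hagree (i + j) (by omega) (by omega)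

variable [MeasurableSpace A] [DiscreteMeasurableSpace A]

/-- The integral of a local function is proportional to the integral of the letter function given by
the left Perron eigenvector, with a factor that does not depend on the invariant measure. -/
theorem exists_integral_eq (h : PisotSetting σ β l u V N) {f : (ℤ → A) → ℝ} {L : ℕ} {B : ℝ}
    (hf : ∀ w w' : ℤ → A, (∀ i, |i| ≤ (L : ℤ) → w i = w' i) → f w = f w')
    (hfm : Measurable f) (hB : ∀ w, |f w| ≤ B) :
    ∃ c : ℝ, ∀ μ : Measure (ℤ → A), IsInvariantProb σ.subshift μ →
      ∫ w, f w ∂μ = c * ∫ w, l (w 0) ∂μ := by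
  have hβ0 : 0 < β := by linarith [h.one_lt]
  obtain ⟨K, x, hx⟩ := h.exists_blockSum_eq hf
  obtain ⟨c, hc⟩ := h.perron.exists_tendsto hβ0 h.prim x
  obtain ⟨c₀, hc₀, hlen⟩ := h.perron.exists_le_length_pow h.one_lt
  have hlm : Measurable fun w : ℤ → A => l (w 0) :=
    (measurable_of_countable l).comp (measurable_pi_apply 0)
  have hlB : ∀ w : ℤ → A, |l (w 0)| ≤ ∑ a, l a := fun w => by
    rw [abs_of_pos (h.perron.1 _)]
    exact Finset.single_le_sum (f := l) (fun a _ => (h.perron.1 a).le) (Finset.mem_univ _)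
  -- the sums of this function over long blocks are small compared to their length
  set g : (ℤ → A) → ℝ := fun w => f w - c / β ^ K * l (w 0) with hg
  have hgm : Measurable g := hfm.sub (hlm.const_mul _)
  have hgB : ∀ w, |g w| ≤ B + |c / β ^ K| * ∑ a, l a := by
    intro w
    refine (abs_sub _ _).trans (add_le_add (hB w) ?_)
    rw [abs_mul]
    exact mul_le_mul_of_nonneg_left (hlB w) (abs_nonneg _)
  -- the sums over the blocks of `σ^(K+j)` are given by the `j`-th power of the incidence matrix
  have hblk : ∀ j w, blockSum (σ.pow (K + j)) g w =
      (∑ b, ((σ.incidence ^ j) b (w 0) : ℝ) * x b) - c * β ^ j * l (w 0) := by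
    intro j w
    have h1 : blockSum (σ.pow (K + j)) f w = ∑ b, ((σ.incidence ^ j) b (w 0) : ℝ) * x b := by
      rw [σ.pow_add, blockSum_comp, ← σ.incidence_pow, ← blockSum_letter]
      simp only [hx]
      rfl
    have h2 : blockSum (σ.pow (K + j)) (fun v => l (v 0)) w = β ^ (K + j) * l (w 0) := by
      rw [blockSum_letter, σ.incidence_pow, ← (h.perron.pow (K + j)).2 (w 0)]
      exact Finset.sum_congr rfl fun b _ => mul_comm _ _
    have h3 : blockSum (σ.pow (K + j)) g w = blockSum (σ.pow (K + j)) f w -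
        c / β ^ K * blockSum (σ.pow (K + j)) (fun v => l (v 0)) w := by
      simp only [blockSum, hg, Finset.sum_sub_distrib, Finset.mul_sum]
    rw [h3, h1, h2, pow_add]
    field_simp
  refine ⟨c / β ^ K, fun μ hμ => ?_⟩
  have : IsProbabilityMeasure μ := hμ.1
  have hzero : ∫ w, g w ∂μ = 0 := by
    refine integral_eq_zero_of_sublinear hμ hgm hgB fun ε hε => ?_
    have hev : ∀ᶠ j in atTop, ∀ a,
        |(∑ b, ((σ.incidence ^ j) b a : ℝ) * x b) / β ^ j - c * l a| < ε * c₀ := by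
      rw [eventually_all]
      intro a
      have := (Metric.tendsto_nhds.1 (hc a)) (ε * c₀) (by positivity)
      simpa only [Real.dist_eq] using this
    obtain ⟨j, hj⟩ := hev.exists
    refine h.exists_abs_sum_le hgB hε.le (K + j) fun w => ?_
    rw [hblk]
    have h1 := (hj (w 0)).le
    have hβj : 0 < β ^ j := pow_pos hβ0 j
    have h2 : (∑ b, ((σ.incidence ^ j) b (w 0) : ℝ) * x b) - c * β ^ j * l (w 0) =
        ((∑ b, ((σ.incidence ^ j) b (w 0) : ℝ) * x b) / β ^ j - c * l (w 0)) * β ^ j := by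
      field_simp
    rw [h2, abs_mul, abs_of_pos hβj]
    have h3 : β ^ j ≤ β ^ (K + j) := pow_le_pow_right₀ h.one_lt.le (by omega)
    calc _ ≤ ε * c₀ * β ^ j := mul_le_mul_of_nonneg_right h1 hβj.le
      _ ≤ ε * (c₀ * β ^ (K + j)) := by rw [mul_assoc]; gcongr
      _ ≤ _ := mul_le_mul_of_nonneg_left (hlen _ _) hε.le
  have hfi : Integrable f μ :=
    Integrable.of_bound hfm.aestronglyMeasurable B (Eventually.of_forall hB)
  have hli : Integrable (fun w : ℤ → A => l (w 0)) μ :=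
    Integrable.of_bound hlm.aestronglyMeasurable _ (Eventually.of_forall hlB)
  rw [integral_sub hfi (hli.const_mul _), integral_const_mul, sub_eq_zero] at hzero
  exact hzero

/-- The subshift is uniquely ergodic: the integrals of the indicator functions of cylinders are
determined, as they are proportional to that of the constant `1`. -/
theorem isInvariantProb_unique (h : PisotSetting σ β l u V N) {μ μ' : Measure (ℤ → A)}
    (hμ : IsInvariantProb σ.subshift μ) (hμ' : IsInvariantProb σ.subshift μ') : μ' = μ := by
  have : IsProbabilityMeasure μ := hμ.1
  have : IsProbabilityMeasure μ' := hμ'.1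
  -- the function `1` determines the integral of the letter function
  obtain ⟨c₁, hc₁⟩ := h.exists_integral_eq (f := fun _ => 1) (L := 0) (B := 1) (fun _ _ _ => rfl)
    measurable_const (fun _ => by simp)
  have hl : ∫ w, l (w 0) ∂μ' = ∫ w, l (w 0) ∂μ := by
    have h1 := hc₁ μ hμ
    have h2 := hc₁ μ' hμ'
    rw [integral_const, probReal_univ, one_smul] at h1 h2
    have hc : c₁ ≠ 0 := by
      rintro rfl
      simp at h1
    exact mul_left_cancel₀ hc (h2.symm.trans h1)
  refine ext_of_generate_finite (measurableCylinders fun _ : ℤ => A)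
    (generateFrom_measurableCylinders).symm (isPiSystem_measurableCylinders) (fun s hs => ?_)
    (by simp)
  have hsm : MeasurableSet s := MeasurableSet.of_mem_measurableCylinders hs
  obtain ⟨I, S, -, rfl⟩ := (mem_measurableCylinders _).1 hs
  have hmem : ∀ w w' : ℤ → A, (∀ i, |i| ≤ ((∑ i ∈ I, i.natAbs : ℕ) : ℤ) → w i = w' i) →
      (w ∈ cylinder I S ↔ w' ∈ cylinder I S) := by
    intro w w' hw
    have : I.restrict w = I.restrict w' := by
      funext i
      refine hw i ?_
      have := Finset.single_le_sum (f := Int.natAbs) (fun _ _ => Nat.zero_le _) i.2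
      rw [Int.abs_eq_natAbs]
      exact_mod_cast this
    rw [mem_cylinder, mem_cylinder, this]
  have hloc : ∀ w w' : ℤ → A, (∀ i, |i| ≤ ((∑ i ∈ I, i.natAbs : ℕ) : ℤ) → w i = w' i) →
      (cylinder I S).indicator (1 : (ℤ → A) → ℝ) w = (cylinder I S).indicator 1 w' := by
    intro w w' hw
    have := hmem w w' hw
    by_cases hw1 : w ∈ cylinder I S
    · rw [Set.indicator_of_mem hw1, Set.indicator_of_mem (this.1 hw1)]; rfl
    · rw [Set.indicator_of_notMem hw1, Set.indicator_of_notMem fun h => hw1 (this.2 h)]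
  have hbd : ∀ w : ℤ → A, |(cylinder I S).indicator (1 : (ℤ → A) → ℝ) w| ≤ 1 := by
    intro w
    by_cases hw1 : w ∈ cylinder I S
    · rw [Set.indicator_of_mem hw1]; simp
    · rw [Set.indicator_of_notMem hw1]; simp
  obtain ⟨c, hc⟩ := h.exists_integral_eq hloc (measurable_one.indicator hsm) hbd
  have h1 := hc μ hμ
  have h2 := hc μ' hμ'
  rw [integral_indicator_one hsm] at h1 h2
  rw [← measureReal_eq_measureReal_iff, h1, h2, hl]

end PisotSetting

/-! ### Domain exchanges -/

section exchange
variable {ι X : Type*}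

theorem exchangeMap_of_mem [Add X] {P : ι → Set X} (t : ι → X) {x : X} (hx : x ∈ exchangeDomain P)
    {a : ι} (ha : x ∈ P a) : exchangeMap P t x = x + t a := by
  have hx' : ∃! a, x ∈ P a := hx
  rw [exchangeMap, dif_pos hx', hx'.unique hx'.choose_spec.1 ha]

theorem measurableSet_exchangeDomain [Countable ι] [MeasurableSpace X] {P : ι → Set X}
    (hP : ∀ a, MeasurableSet (P a)) : MeasurableSet (exchangeDomain P) := by
  have : exchangeDomain P = ⋃ a, P a ∩ ⋂ (b) (_ : b ≠ a), (P b)ᶜ := by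
    ext x
    simp only [exchangeDomain, ExistsUnique, Set.mem_ofPred_eq, Set.mem_iUnion, Set.mem_inter_iff,
      Set.mem_iInter, Set.mem_compl_iff]
    exact exists_congr fun a => and_congr_right fun _ => forall_congr' fun b => not_imp_not.symm
  rw [this]
  exact MeasurableSet.iUnion fun a => (hP a).inter
    (MeasurableSet.iInter fun b => MeasurableSet.iInter fun _ => (hP b).compl)

theorem exchangeDomain_subset (P : ι → Set X) : exchangeDomain P ⊆ ⋃ a, P a := fun _ hx =>
  Set.mem_iUnion.2 hx.exists

theorem measure_iUnion_diff_exchangeDomain [Countable ι] [MeasurableSpace X] {μ : Measure X}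
    {P : ι → Set X} (h : Pairwise fun a b => AEDisjoint μ (P a) (P b)) :
    μ ((⋃ a, P a) \ exchangeDomain P) = 0 := by
  have hsub : (⋃ a, P a) \ exchangeDomain P ⊆ ⋃ (a) (b) (_ : a ≠ b), P a ∩ P b := by
    rintro x ⟨hx, hx'⟩
    obtain ⟨a, ha⟩ := Set.mem_iUnion.1 hx
    simp only [Set.mem_iUnion]
    by_contra hc
    push Not at hc
    refine hx' ⟨a, ha, fun b hb => ?_⟩
    by_contra hba
    exact hc a b (Ne.symm hba) ⟨ha, hb⟩
  refine measure_mono_null hsub ?_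
  exact measure_iUnion_null fun a => measure_iUnion_null fun b => measure_iUnion_null fun hab =>
    h hab

/-- A domain exchange preserves the measure of every set on which it is injective. -/
theorem measure_image_exchangeMap [Countable ι] [AddGroup X] [MeasurableSpace X]
    [MeasurableAdd X] {μ : Measure X} [μ.IsAddRightInvariant]
    {P : ι → Set X} (hP : ∀ a, MeasurableSet (P a)) (t : ι → X) {B : Set X} (hB : MeasurableSet B)
    (hBD : B ⊆ exchangeDomain P) (hinj : Set.InjOn (exchangeMap P t) B) :
    μ (exchangeMap P t '' B) = μ B := by
  have hU : B = ⋃ a, B ∩ P a := by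
    rw [← Set.inter_iUnion, Set.inter_eq_left.2 (hBD.trans (exchangeDomain_subset P))]
  have himg : ∀ a, exchangeMap P t '' (B ∩ P a) = (fun x => x + t a) '' (B ∩ P a) := fun a =>
    Set.image_congr fun x hx => exchangeMap_of_mem t (hBD hx.1) hx.2
  have hdisj : Pairwise (Function.onFun Disjoint fun a => B ∩ P a) := by
    intro a b hab
    rw [Function.onFun, Set.disjoint_left]
    exact fun x hx hx' => hab ((hBD hx.1).unique hx.2 hx'.2)
  have hdisj' : Pairwise (Function.onFun Disjoint fun a => exchangeMap P t '' (B ∩ P a)) :=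
    fun a b hab => by
    rw [Function.onFun, Set.disjoint_left]
    rintro _ ⟨x, hx, rfl⟩ ⟨y, hy, he⟩
    rw [hinj hy.1 hx.1 he] at hy
    exact Set.disjoint_left.1 (hdisj hab) hx hy
  conv_rhs => rw [hU, measure_iUnion hdisj fun a => hB.inter (hP a)]
  conv_lhs => rw [hU, Set.image_iUnion, measure_iUnion hdisj' fun a => by
    rw [himg, Set.image_add_right]
    exact (measurable_add_const _) (hB.inter (hP a))]
  exact tsum_congr fun a => by rw [himg, Set.image_add_right, measure_preimage_add_right]

end exchange

/-! ### The conjugacy -/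

namespace PisotSetting
variable {A : Type*} [Fintype A] [DecidableEq A] [TopologicalSpace A]
  {F : Type*} [NormedAddCommGroup F] [NormedSpace ℝ F]
  {σ : Substitution A} {β : ℝ} {l : A → ℝ} {u : ℤ → A} {V : (A → ℝ) →ₗ[ℝ] F} {N : F →ₗ[ℝ] F}
  [FiniteDimensional ℝ F] [DiscreteTopology A]

/-- The translated pieces `R_a + V e_a`. -/
noncomputable def translate (σ : Substitution A) (V : (A → ℝ) →ₗ[ℝ] F) (u : ℤ → A) (a : A) : Set F :=
  (fun x => x + V (Pi.single a 1)) '' piece σ V u a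

/-- The map `E` on the Rauzy fractal. -/
noncomputable def exchange (σ : Substitution A) (V : (A → ℝ) →ₗ[ℝ] F) (u : ℤ → A) : F → F :=
  exchangeMap (piece σ V u) fun a => V (Pi.single a 1)

theorem shift_mem_subshift {w : ℤ → A} (hw : w ∈ σ.subshift) : shift w ∈ σ.subshift :=
  Substitution.shiftPow_mem_subshift hw 1

theorem rauzyMap_shift (h : PisotSetting σ β l u V N) {w : ℤ → A} (hw : w ∈ σ.subshift) :
    rauzyMap V u (shift w) = rauzyMap V u w + V (Pi.single (w 0) 1) := by
  have h1 := h.rauzyMap_shiftPow hw 1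
  have h2 := abPrefix_succ w 0
  rw [abPrefix_zero, zero_add, zero_add] at h2
  rwa [h2] at h1

theorem mem_translate (h : PisotSetting σ β l u V N) {w : ℤ → A} (hw : w ∈ σ.subshift) :
    rauzyMap V u (shift w) ∈ translate σ V u (w 0) :=
  ⟨_, ⟨w, ⟨hw, rfl⟩, rfl⟩, (h.rauzyMap_shift hw).symm⟩

theorem fractal_eq_iUnion_translate (h : PisotSetting σ β l u V N) :
    fractal σ V u = ⋃ a, translate σ V u a := by
  ext x
  simp only [Set.mem_iUnion]
  constructor
  · rintro ⟨w, hw, rfl⟩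
    have h1 := h.mem_translate (Substitution.shiftPow_mem_subshift hw (-1))
    rw [shift, shiftPow_shiftPow, neg_add_cancel, shiftPow_zero] at h1
    exact ⟨_, h1⟩
  · rintro ⟨a, _, ⟨w, ⟨hw, rfl⟩, rfl⟩, rfl⟩
    exact ⟨shift w, shift_mem_subshift hw, h.rauzyMap_shift hw⟩

theorem mapsTo_exchange (h : PisotSetting σ β l u V N) :
    Set.MapsTo (exchange σ V u) (exchangeDomain (piece σ V u)) (fractal σ V u) := by
  intro x hx
  obtain ⟨a, ha⟩ := hx.exists
  rw [exchange, exchangeMap_of_mem _ hx ha, h.fractal_eq_iUnion_translate]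
  exact Set.mem_iUnion.2 ⟨a, x, ha, rfl⟩

theorem exchange_rauzyMap (h : PisotSetting σ β l u V N) {w : ℤ → A} (hw : w ∈ σ.subshift)
    (hD : rauzyMap V u w ∈ exchangeDomain (piece σ V u)) :
    rauzyMap V u (shift w) = exchange σ V u (rauzyMap V u w) := by
  rw [exchange, exchangeMap_of_mem _ hD ⟨w, ⟨hw, rfl⟩, rfl⟩, h.rauzyMap_shift hw]

/-- The words `w` in `Ω_σ` such that no point of the orbit of `φ(w)` is ambiguous, neither for the
pieces nor for the translated pieces. -/
def goodWords (σ : Substitution A) (V : (A → ℝ) →ₗ[ℝ] F) (u : ℤ → A) : Set (ℤ → A) :=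
  {w | ∀ n : ℤ, shiftPow n w ∈ σ.subshift ∧ rauzyMap V u (shiftPow n w) ∈
    exchangeDomain (piece σ V u) ∩ exchangeDomain (translate σ V u)}

theorem goodWords_subset : goodWords σ V u ⊆ σ.subshift := fun w hw => by
  simpa using (hw 0).1

theorem rauzyMap_mem_of_mem_goodWords {w : ℤ → A} (hw : w ∈ goodWords σ V u) :
    rauzyMap V u w ∈ exchangeDomain (piece σ V u) := by
  simpa using (hw 0).2.1

theorem shiftPow_mem_goodWords {w : ℤ → A} (hw : w ∈ goodWords σ V u) (n : ℤ) :
    shiftPow n w ∈ goodWords σ V u := fun m => by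
  rw [shiftPow_shiftPow]
  exact hw _

/-- The point `φ(w)` of the orbit of a good word determines the letters of `w` one by one: it lies
in a single piece, which gives `w_0` and `φ(Sw)`, and in a single translated piece, which gives
`w_{-1}` and `φ(S⁻¹w)`. -/
theorem injOn_rauzyMap (h : PisotSetting σ β l u V N) :
    Set.InjOn (rauzyMap V u) (goodWords σ V u) := by
  have fwd : ∀ w ∈ goodWords σ V u, ∀ w' ∈ goodWords σ V u, rauzyMap V u w = rauzyMap V u w' →
      w 0 = w' 0 ∧ rauzyMap V u (shift w) = rauzyMap V u (shift w') := by
    intro w hw w' hw' he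
    have hΩ := goodWords_subset hw
    have hΩ' := goodWords_subset hw'
    have h0 : w 0 = w' 0 := (rauzyMap_mem_of_mem_goodWords hw).unique ⟨w, ⟨hΩ, rfl⟩, rfl⟩
      (he ▸ ⟨w', ⟨hΩ', rfl⟩, rfl⟩)
    exact ⟨h0, by rw [h.rauzyMap_shift hΩ, h.rauzyMap_shift hΩ', he, h0]⟩
  have bwd : ∀ w ∈ goodWords σ V u, ∀ w' ∈ goodWords σ V u,
      rauzyMap V u (shift w) = rauzyMap V u (shift w') → rauzyMap V u w = rauzyMap V u w' := by
    intro w hw w' hw' he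
    have hΩ := goodWords_subset hw
    have hΩ' := goodWords_subset hw'
    have h0 : w 0 = w' 0 := (hw 1).2.2.unique (h.mem_translate hΩ) (by
      have := h.mem_translate hΩ'
      rwa [← he] at this)
    rw [h.rauzyMap_shift hΩ, h.rauzyMap_shift hΩ', h0] at he
    exact add_right_cancel he
  intro w hw w' hw' he
  have hsucc : ∀ (v : ℤ → A) (n : ℤ), shiftPow (n + 1) v = shift (shiftPow n v) := fun v n => by
    rw [shift, shiftPow_shiftPow]
  have hall : ∀ n : ℤ, rauzyMap V u (shiftPow n w) = rauzyMap V u (shiftPow n w') := by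
    intro n
    induction n using Int.induction_on with
    | zero => simpa using he
    | succ i ih =>
      rw [hsucc, hsucc]
      exact (fwd _ (shiftPow_mem_goodWords hw _) _ (shiftPow_mem_goodWords hw' _) ih).2
    | pred i ih =>
      refine bwd _ (shiftPow_mem_goodWords hw _) _ (shiftPow_mem_goodWords hw' _) ?_
      rw [← hsucc, ← hsucc, sub_add_cancel]
      exact ih
  funext n
  have := (fwd _ (shiftPow_mem_goodWords hw n) _ (shiftPow_mem_goodWords hw' n) (hall n)).1
  simpa [shiftPow] using this

theorem bijOn_shift : Set.BijOn shift (goodWords σ V u) (goodWords σ V u) := by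
  refine ⟨fun w hw => shiftPow_mem_goodWords hw 1, fun w _ w' _ he => ?_, fun w hw =>
    ⟨shiftPow (-1) w, shiftPow_mem_goodWords hw _, by simp [shift, shiftPow_shiftPow]⟩⟩
  have := congrArg (shiftPow (-1)) he
  simpa [shift, shiftPow_shiftPow] using this

theorem bijOn_exchange (h : PisotSetting σ β l u V N) :
    Set.BijOn (exchange σ V u) (rauzyMap V u '' goodWords σ V u)
      (rauzyMap V u '' goodWords σ V u) := by
  have hφ : ∀ w ∈ goodWords σ V u,
      exchange σ V u (rauzyMap V u w) = rauzyMap V u (shift w) := fun w hw =>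
    (h.exchange_rauzyMap (goodWords_subset hw) (rauzyMap_mem_of_mem_goodWords hw)).symm
  refine ⟨?_, ?_, ?_⟩
  · rintro _ ⟨w, hw, rfl⟩
    exact ⟨shift w, bijOn_shift.mapsTo hw, (hφ w hw).symm⟩
  · rintro _ ⟨w, hw, rfl⟩ _ ⟨w', hw', rfl⟩ he
    rw [hφ w hw, hφ w' hw'] at he
    have h1 := h.injOn_rauzyMap (bijOn_shift.mapsTo hw) (bijOn_shift.mapsTo hw') he
    rw [bijOn_shift.injOn hw hw' h1]
  · rintro _ ⟨w, hw, rfl⟩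
    obtain ⟨w', hw', rfl⟩ := bijOn_shift.surjOn hw
    exact ⟨_, ⟨w', hw', rfl⟩, hφ w' hw'⟩

section measure
variable [MeasureSpace F] [BorelSpace F]

theorem measurableSet_piece (h : PisotSetting σ β l u V N) (a : A) :
    MeasurableSet (piece σ V u a) := (h.isCompact_piece a).measurableSet

theorem measurableSet_translate (h : PisotSetting σ β l u V N) (a : A) :
    MeasurableSet (translate σ V u a) := by
  rw [translate, Set.image_add_right]
  exact measurable_add_const _ (h.measurableSet_piece a)

theorem measurableSet_goodWords [MeasurableSpace A] [DiscreteMeasurableSpace A]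
    (h : PisotSetting σ β l u V N) : MeasurableSet (goodWords σ V u) := by
  set G := exchangeDomain (piece σ V u) ∩ exchangeDomain (translate σ V u) with hG
  have hGm : MeasurableSet G := (measurableSet_exchangeDomain h.measurableSet_piece).inter
    (measurableSet_exchangeDomain h.measurableSet_translate)
  have hΩ : MeasurableSet σ.subshift := σ.isCompact_subshift.measurableSet
  have h1 : MeasurableSet (σ.subshift ∩ rauzyMap V u ⁻¹' G) := by
    have h2 := (continuousOn_iff_continuous_domRestrict.1 h.continuousOn_rauzyMap).measurable hGm
    have h3 := hΩ.subtype_image h2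
    rwa [Set.domRestrict_eq, Set.preimage_comp, Subtype.image_preimage_coe] at h3
  have h4 : goodWords σ V u = ⋂ n : ℤ, shiftPow n ⁻¹' (σ.subshift ∩ rauzyMap V u ⁻¹' G) := by
    ext w
    simp only [goodWords, Set.mem_ofPred_eq, Set.mem_iInter, Set.mem_preimage, Set.mem_inter_iff, hG]
  rw [h4]
  exact MeasurableSet.iInter fun n => (continuous_shiftPow n).measurable h1

/-- A continuous injective image of a Borel set is a Borel set. -/
theorem measurableEmbedding_rauzyMap [MeasurableSpace A] [DiscreteMeasurableSpace A]
    (h : PisotSetting σ β l u V N) :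
    MeasurableEmbedding ((goodWords σ V u).domRestrict (rauzyMap V u)) := by
  have := h.measurableSet_goodWords.standardBorel
  exact (continuousOn_iff_continuous_domRestrict.1
    (h.continuousOn_rauzyMap.mono goodWords_subset)).measurable.measurableEmbedding
    (Set.injOn_iff_injective.1 h.injOn_rauzyMap)

theorem image_inter_eq (C : Set (ℤ → A)) :
    (goodWords σ V u).domRestrict (rauzyMap V u) '' (Subtype.val ⁻¹' C) =
      rauzyMap V u '' (goodWords σ V u ∩ C) := by
  rw [Set.domRestrict_eq, Set.image_comp, Subtype.image_preimage_coe]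

theorem measurableSet_image [MeasurableSpace A] [DiscreteMeasurableSpace A]
    (h : PisotSetting σ β l u V N) {C : Set (ℤ → A)} (hC : MeasurableSet C) :
    MeasurableSet (rauzyMap V u '' (goodWords σ V u ∩ C)) := by
  rw [← image_inter_eq]
  exact h.measurableEmbedding_rauzyMap.measurableSet_image.2 (measurable_subtype_coe hC)

theorem measurableSet_image_goodWords [MeasurableSpace A] [DiscreteMeasurableSpace A]
    (h : PisotSetting σ β l u V N) : MeasurableSet (rauzyMap V u '' goodWords σ V u) := by
  simpa using h.measurableSet_image MeasurableSet.univ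

variable [(volume : Measure F).IsAddHaarMeasure]

/-- The points that are not the image of a good word are translates of ambiguous points by the vectors
`V x` for integer vectors `x`, which are countably many. -/
theorem volume_diff_image_goodWords (h : PisotSetting σ β l u V N) :
    volume (fractal σ V u \ rauzyMap V u '' goodWords σ V u) = 0 := by
  set G := exchangeDomain (piece σ V u) ∩ exchangeDomain (translate σ V u) with hG
  have hnull : volume (fractal σ V u \ G) = 0 := by
    rw [hG, Set.sdiff_inter]
    refine measure_union_null ?_ ?_
    · rw [fractal_eq_iUnion]
      exact measure_iUnion_diff_exchangeDomain h.aedisjoint_piece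
    · rw [h.fractal_eq_iUnion_translate]
      exact measure_iUnion_diff_exchangeDomain h.aedisjoint_translate
  have hsub : fractal σ V u \ rauzyMap V u '' goodWords σ V u ⊆
      ⋃ x : A → ℤ, (fun y => y + V fun a => (x a : ℝ)) ⁻¹' (fractal σ V u \ G) := by
    rintro _ ⟨⟨w, hw, rfl⟩, hy⟩
    have hng : w ∉ goodWords σ V u := fun hc => hy ⟨w, hc, rfl⟩
    simp only [goodWords, Set.mem_ofPred_eq, not_forall] at hng
    obtain ⟨n, hn⟩ := hng
    have hΩ := Substitution.shiftPow_mem_subshift hw n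
    obtain ⟨x, hx⟩ := exists_int_abPrefix w n
    refine Set.mem_iUnion.2 ⟨x, ?_⟩
    rw [Set.mem_preimage, ← hx, ← h.rauzyMap_shiftPow hw]
    exact ⟨⟨_, hΩ, rfl⟩, fun hc => hn ⟨hΩ, hc⟩⟩
  refine measure_mono_null hsub (measure_iUnion_null fun x => ?_)
  rw [measure_preimage_add_right, hnull]

theorem isDomainExchange (h : PisotSetting σ β l u V N) :
    IsDomainExchange (fractal σ V u) (exchangeDomain (piece σ V u)) (exchange σ V u)
      (piece σ V u) where
  subset := fractal_eq_iUnion σ V u ▸ exchangeDomain_subset _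
  ae_defined := fractal_eq_iUnion σ V u ▸ measure_iUnion_diff_exchangeDomain h.aedisjoint_piece
  mapsTo := h.mapsTo_exchange
  union := fractal_eq_iUnion σ V u
  disjoint := h.aedisjoint_piece
  closure_interior := h.closure_interior_piece
  frontier_null := h.volume_frontier_piece
  interior_subset a x hx := ⟨a, interior_subset hx, fun b hb => by
    by_contra hba
    exact Set.disjoint_left.1 (h.disjoint_interior_piece (Ne.symm hba)) hx hb⟩
  translation a := ⟨V (Pi.single a 1), fun x hx => exchangeMap_of_mem _
    ⟨a, interior_subset hx, fun b hb => by
      by_contra hba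
      exact Set.disjoint_left.1 (h.disjoint_interior_piece (Ne.symm hba)) hx hb⟩
    (interior_subset hx)⟩
  volume_image := by
    refine le_antisymm (measure_mono h.mapsTo_exchange.image_subset) ?_
    have hsub : fractal σ V u ⊆ exchange σ V u '' exchangeDomain (piece σ V u) ∪
        (fractal σ V u \ rauzyMap V u '' goodWords σ V u) := by
      intro x hx
      by_cases hx' : x ∈ rauzyMap V u '' goodWords σ V u
      · obtain ⟨_, ⟨w, hw, rfl⟩, rfl⟩ := h.bijOn_exchange.surjOn hx'
        exact Or.inl ⟨_, rauzyMap_mem_of_mem_goodWords hw, rfl⟩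
      · exact Or.inr ⟨hx, hx'⟩
    refine (measure_mono hsub).trans ((measure_union_le _ _).trans ?_)
    rw [h.volume_diff_image_goodWords, add_zero]

theorem image_goodWords_subset :
    rauzyMap V u '' goodWords σ V u ⊆ exchangeDomain (piece σ V u) :=
  Set.image_subset_iff.2 fun _ hw => rauzyMap_mem_of_mem_goodWords hw

theorem isAEInvertible [MeasurableSpace A] [DiscreteMeasurableSpace A]
    (h : PisotSetting σ β l u V N) :
    IsAEInvertible (fractal σ V u) (exchangeDomain (piece σ V u)) (exchange σ V u) :=
  ⟨_, image_goodWords_subset, h.measurableSet_image_goodWords,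
    h.volume_diff_image_goodWords, h.bijOn_exchange⟩

/-- The normalized Lebesgue measure on the Rauzy fractal. -/
noncomputable def fractalMeasure (σ : Substitution A) (V : (A → ℝ) →ₗ[ℝ] F) (u : ℤ → A) :
    Measure F := (volume (fractal σ V u))⁻¹ • volume.restrict (fractal σ V u)

theorem isProbabilityMeasure_fractalMeasure (h : PisotSetting σ β l u V N) :
    IsProbabilityMeasure (fractalMeasure σ V u) := by
  constructor
  rw [fractalMeasure, Measure.smul_apply, Measure.restrict_apply_univ, smul_eq_mul]
  refine ENNReal.inv_mul_cancel ?_ h.isCompact_fractal.measure_lt_top.ne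
  have h1 := h.nonempty_interior_piece (u 0)
  have h2 := interior_mono (piece_subset_fractal σ V u (u 0))
  exact (Measure.measure_pos_of_nonempty_interior _ (h1.mono h2)).ne'

theorem fractalMeasure_eq (h : PisotSetting σ β l u V N) {B : Set F} (hB : B ⊆ fractal σ V u) :
    fractalMeasure σ V u B = (volume (fractal σ V u))⁻¹ * volume B := by
  rw [fractalMeasure, Measure.smul_apply,
    Measure.restrict_apply' h.isCompact_fractal.measurableSet, Set.inter_eq_left.2 hB, smul_eq_mul]

theorem fractalMeasure_compl_image (h : PisotSetting σ β l u V N) :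
    fractalMeasure σ V u (rauzyMap V u '' goodWords σ V u)ᶜ = 0 := by
  rw [fractalMeasure, Measure.smul_apply,
    Measure.restrict_apply' h.isCompact_fractal.measurableSet, Set.inter_comm, ← Set.sdiff_eq,
    h.volume_diff_image_goodWords, smul_zero]

section subshiftMeasure
variable [MeasurableSpace A] [DiscreteMeasurableSpace A]

/-- The invariant measure on the subshift, the image of the normalized Lebesgue measure on the Rauzy
fractal under the inverse of `φ`. -/
noncomputable def subshiftMeasure (σ : Substitution A) (V : (A → ℝ) →ₗ[ℝ] F) (u : ℤ → A) :
    Measure (ℤ → A) :=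
  ((fractalMeasure σ V u).comap ((goodWords σ V u).domRestrict (rauzyMap V u))).map Subtype.val

theorem subshiftMeasure_apply (h : PisotSetting σ β l u V N) {C : Set (ℤ → A)}
    (hC : MeasurableSet C) :
    subshiftMeasure σ V u C = fractalMeasure σ V u (rauzyMap V u '' (goodWords σ V u ∩ C)) := by
  rw [subshiftMeasure, Measure.map_apply measurable_subtype_coe hC,
    h.measurableEmbedding_rauzyMap.comap_apply, image_inter_eq]

/-- The shift invariance is the fact that the exchange map preserves the Lebesgue measure. -/
theorem isInvariantProb_subshiftMeasure (h : PisotSetting σ β l u V N) :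
    IsInvariantProb σ.subshift (subshiftMeasure σ V u) := by
  have hprob := h.isProbabilityMeasure_fractalMeasure
  have hshift : Measurable (shift : (ℤ → A) → ℤ → A) :=
    measurable_pi_lambda _ fun i => measurable_pi_apply (i + 1)
  have hsub : ∀ C : Set (ℤ → A), rauzyMap V u '' (goodWords σ V u ∩ C) ⊆ fractal σ V u :=
    fun C => Set.image_mono (Set.inter_subset_left.trans goodWords_subset)
  refine ⟨⟨?_⟩, ?_, ?_⟩
  · rw [h.subshiftMeasure_apply MeasurableSet.univ, Set.inter_univ]
    exact (prob_compl_eq_zero_iff h.measurableSet_image_goodWords).1 h.fractalMeasure_compl_image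
  · rw [h.subshiftMeasure_apply σ.isCompact_subshift.measurableSet.compl,
      (Set.disjoint_compl_right_iff_subset.2 goodWords_subset).inter_eq, Set.image_empty,
      measure_empty]
  · ext C hC
    rw [Measure.map_apply hshift hC, h.subshiftMeasure_apply (hshift hC),
      h.subshiftMeasure_apply hC]
    set B := rauzyMap V u '' (goodWords σ V u ∩ shift ⁻¹' C) with hB
    have hBY : B ⊆ rauzyMap V u '' goodWords σ V u := Set.image_mono Set.inter_subset_left
    have himg : exchange σ V u '' B = rauzyMap V u '' (goodWords σ V u ∩ C) := by
      have h1 : shift '' (goodWords σ V u ∩ shift ⁻¹' C) = goodWords σ V u ∩ C := by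
        rw [Set.image_inter_preimage, bijOn_shift.image_eq]
      rw [← h1, hB, Set.image_image, Set.image_image]
      exact Set.image_congr fun w hw => (h.exchange_rauzyMap (goodWords_subset hw.1)
        (rauzyMap_mem_of_mem_goodWords hw.1)).symm
    rw [← himg, h.fractalMeasure_eq (hsub _), h.fractalMeasure_eq (himg ▸ hsub C)]
    congr 1
    exact (measure_image_exchangeMap h.measurableSet_piece _ (h.measurableSet_image (hshift hC))
      (hBY.trans image_goodWords_subset) (h.bijOn_exchange.injOn.mono hBY)).symm

theorem isMeasurableConjugacy (h : PisotSetting σ β l u V N) :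
    IsMeasurableConjugacy σ.subshift shift (subshiftMeasure σ V u)
      (exchangeDomain (piece σ V u)) (exchange σ V u) (fractalMeasure σ V u) (rauzyMap V u) := by
  have : Nonempty (ℤ → A) := ⟨u⟩
  have hinv : Set.InvOn (Function.invFunOn (rauzyMap V u) (goodWords σ V u)) (rauzyMap V u)
      (goodWords σ V u) (rauzyMap V u '' goodWords σ V u) :=
    (h.injOn_rauzyMap.bijOn_image).invOn_invFunOn
  have hmaps : Set.MapsTo (Function.invFunOn (rauzyMap V u) (goodWords σ V u))
      (rauzyMap V u '' goodWords σ V u) (goodWords σ V u) := fun y hy =>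
    Function.invFunOn_mem hy
  refine ⟨goodWords σ V u, rauzyMap V u '' goodWords σ V u,
    Function.invFunOn (rauzyMap V u) (goodWords σ V u), goodWords_subset,
    h.measurableSet_goodWords, ?_, bijOn_shift, image_goodWords_subset,
    h.measurableSet_image_goodWords, h.fractalMeasure_compl_image, h.bijOn_exchange,
    Set.mapsTo_image _ _, hmaps, hinv, h.measurableEmbedding_rauzyMap.measurable, ?_,
    fun w hw => h.exchange_rauzyMap (goodWords_subset hw) (rauzyMap_mem_of_mem_goodWords hw), ?_⟩
  · rw [h.subshiftMeasure_apply h.measurableSet_goodWords.compl, Set.inter_compl_self,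
      Set.image_empty, measure_empty]
  · intro C hC
    have h1 : (rauzyMap V u '' goodWords σ V u).domRestrict
        (Function.invFunOn (rauzyMap V u) (goodWords σ V u)) ⁻¹' C =
        Subtype.val ⁻¹' (rauzyMap V u '' (goodWords σ V u ∩ C)) := by
      ext ⟨y, hy⟩
      simp only [Set.mem_preimage, Set.domRestrict_apply]
      constructor
      · exact fun hc => ⟨_, ⟨hmaps hy, hc⟩, hinv.2 hy⟩
      · rintro ⟨w, ⟨hw, hwC⟩, rfl⟩
        rwa [hinv.1 hw]
    rw [h1]
    exact measurable_subtype_coe (h.measurableSet_image hC)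
  · intro B hB
    have h1 : MeasurableSet (goodWords σ V u ∩ rauzyMap V u ⁻¹' B) := by
      have h2 := h.measurableSet_goodWords.subtype_image
        (h.measurableEmbedding_rauzyMap.measurable hB)
      rwa [Set.domRestrict_eq, Set.preimage_comp, Subtype.image_preimage_coe] at h2
    rw [h.subshiftMeasure_apply h1, ← Set.inter_assoc, Set.inter_self, Set.image_inter_preimage,
      Set.inter_comm]
    exact measure_inter_conull h.fractalMeasure_compl_image

end subshiftMeasure
end measure
end PisotSetting
end RauzyExchange

theorem mainTheorem9 {A : Type*} [Fintype A] [DecidableEq A] [TopologicalSpace A]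
    [DiscreteTopology A] [MeasurableSpace A] [DiscreteMeasurableSpace A]
    (σ : Substitution A) (d : ℕ) (β : ℝ) (P : Polynomial ℤ) (u : ℤ → A)
    (V : (A → ℝ) →ₗ[ℝ] EuclideanSpace ℝ (Fin d))
    (hprim : IsPrimitiveMatrix σ.incidence)
    (hβ : IsPerronEigenvalue σ.incidence β)
    (hpisot : IsUnitPisot β)
    (hdeg : (minpoly ℚ β).natDegree = d + 1)
    (hu : u ∈ σ.subshift)
    (hfix : σ.onWord u = u)
    (hP : (σ.incidence.map (Nat.cast : ℕ → ℚ)).charpoly =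
      minpoly ℚ β * P.map (Int.castRingHom ℚ))
    (hV : IsProjectionAlong V (projKernel σ.incidence β P))
    (hproper : σ.IsProper) :
    -- the map `φ` is well defined: it is the continuous extension of `S^n u ↦ V ab(u_{[0,n)})`
    (ContinuousOn (rauzyMap V u) σ.subshift ∧
      ∀ n : ℤ, rauzyMap V u (shiftPow n u) = V (abPrefix u n)) ∧
    -- the two decompositions of `R`
    (fractal σ V u = ⋃ a, piece σ V u a ∧
      Pairwise (fun a b => AEDisjoint volume (piece σ V u a) (piece σ V u b)) ∧
      fractal σ V u = ⋃ a, (fun x => x + V (Pi.single a 1)) '' piece σ V u a ∧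
      Pairwise (fun a b => AEDisjoint volume
        ((fun x => x + V (Pi.single a 1)) '' piece σ V u a)
        ((fun x => x + V (Pi.single b 1)) '' piece σ V u b))) ∧
    -- the map `E` is an invertible domain exchange
    (IsDomainExchange (fractal σ V u) (exchangeDomain (piece σ V u))
        (exchangeMap (piece σ V u) fun a => V (Pi.single a 1)) (piece σ V u) ∧
      IsAEInvertible (fractal σ V u) (exchangeDomain (piece σ V u))
        (exchangeMap (piece σ V u) fun a => V (Pi.single a 1))) ∧
    -- unique ergodicity of the subshift and the measurable conjugacy `φ`
    ∃ μ : Measure (ℤ → A), IsInvariantProb σ.subshift μ ∧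
      (∀ μ' : Measure (ℤ → A), IsInvariantProb σ.subshift μ' → μ' = μ) ∧
      IsMeasurableConjugacy σ.subshift shift μ
        (exchangeDomain (piece σ V u))
        (exchangeMap (piece σ V u) fun a => V (Pi.single a 1))
        ((volume (fractal σ V u))⁻¹ • volume.restrict (fractal σ V u))
        (rauzyMap V u) := by
  have hβ1 : 1 < β := hpisot.1.2.1
  obtain ⟨l, hl⟩ := exists_isLeftPerron (zero_lt_one.trans hβ1) hprim hβ
  obtain ⟨N, hN⟩ := exists_isContractingProjection hprim hβ hpisot hP hV hl
  have h : PisotSetting σ β l u V N := ⟨hprim, hβ1, hl, hproper, hu, hfix, hN⟩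
  exact ⟨⟨h.continuousOn_rauzyMap, h.rauzyMap_shiftPow_fixed⟩,
    ⟨PisotSetting.fractal_eq_iUnion σ V u, h.aedisjoint_piece, h.fractal_eq_iUnion_translate,
      h.aedisjoint_translate⟩,
    ⟨h.isDomainExchange, h.isAEInvertible⟩,
    PisotSetting.subshiftMeasure σ V u, h.isInvariantProb_subshiftMeasure,
    fun _ hμ' => h.isInvariantProb_unique h.isInvariantProb_subshiftMeasure hμ',
    h.isMeasurableConjugacy⟩
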